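/- Let $\theta(x,y,z)$ be a $\Delta^0_0$ formula of second-order arithmetic (number and set parameters allowed), and let $T$ be the statement $\forall x\,\exists y\,\forall z\;\theta(x,y,z)$. The following is formalized in second-order arithmetic; $\mathbb N$ denotes the set of all numbers in the sense of the theory. For finite sets $E,F\subseteq\mathbb N$, write $E<F$ if every element of $E$ is smaller than every element of $F$; $E<F$ are called $\theta$-apart if $\forall x<\max E\;\exists y<\min F\;\forall z<\max F\;\theta(x,y,z)$. For a family $\mathcal L$ of finite sets and $k\in\mathbb N$, let $\mathcal L\cdot k$ be the family of all finite sets $F$ that have $k$ subsets $X_0<X_1<\dots<X_{k-1}$ which belong to $\mathcal L$ and are pairwise $\theta$-apart; let $\mathcal L\cdot k^{(0)}=\mathcal L$ and $\mathcal L\cdot k^{(d+1)}=(\mathcal L\cdot k^{(d)})\cdot k$. Define families $L^\theta_n$ of finite sets by recursion on $n\in\mathbb N$: $L^\theta_0$ consists of all nonempty finite sets, and a nonempty finite set $F$ belongs to $L^\theta_{n+1}$ iff $F\setminus\{\min F\}\in L^\theta_n\cdot(\min F)^{(n+1)}$. A finite set is $\omega^n$-large${}^*(\theta)$ if it belongs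 to $L^\theta_n$. Let $\mathsf J^*_\theta$ be the set of all $n\in\mathbb N$ such that every infinite set has an $\omega^n$-large${}^*(\theta)$ finite subset $F$ with $\min F\ge 3$. A cut is a nonempty (not necessarily proper) initial segment of $\mathbb N$ closed under successor; a cut $I$ is additive if $n+n\in I$ for every $n\in I$. Proposition. $\mathsf{RCA}_0+\mathsf B\Sigma^0_2+T$ proves that $\mathsf J^*_\theta$ is an additive cut; that is, in every (possibly nonstandard) model $(M,S)$ of $\mathsf{RCA}_0+\mathsf B\Sigma^0_2+T$, for all values of the parameters of $\theta$ in $(M,S)$ for which $T$ holds, the set $\mathsf J^*_\theta$, computed in $(M,S)$, is an additive cut of $M$. -/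

import Mathlib

namespace SecondOrderArith

/-- Number terms of the language of second-order arithmetic with free number variables
`x₀, …, xₙ₋₁`. -/
inductive ArithTerm (n : ℕ) : Type
  | var (i : Fin n) : ArithTerm n
  | zero : ArithTerm n
  | one : ArithTerm n
  | add (s t : ArithTerm n) : ArithTerm n
  | mul (s t : ArithTerm n) : ArithTerm n

/-- `Δ⁰₀` formulas of second-order arithmetic with free set variables `X₀, …, Xₘ₋₁` and free
number variables `x₀, …, xₙ₋₁`: all quantifiers are number quantifiers bounded by a term.
The body of a quantifier has the bound variable as its variable number `0`, and the other
variables are shifted by one. -/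
inductive Delta0 (m : ℕ) : ℕ → Type
  | eq {n : ℕ} (s t : ArithTerm n) : Delta0 m n
  | lt {n : ℕ} (s t : ArithTerm n) : Delta0 m n
  | mem {n : ℕ} (t : ArithTerm n) (X : Fin m) : Delta0 m n
  | not {n : ℕ} (φ : Delta0 m n) : Delta0 m n
  | and {n : ℕ} (φ ψ : Delta0 m n) : Delta0 m n
  | or {n : ℕ} (φ ψ : Delta0 m n) : Delta0 m n
  | ball {n : ℕ} (t : ArithTerm n) (φ : Delta0 m (n + 1)) : Delta0 m n
  | bex {n : ℕ} (t : ArithTerm n) (φ : Delta0 m (n + 1)) : Delta0 m n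

section Semantics

variable {M : Type*} [CommSemiring M] [LinearOrder M]

/-- The value of a term under the assignment `v`. -/
def ArithTerm.eval {n : ℕ} (v : Fin n → M) : ArithTerm n → M
  | .var i => v i
  | .zero => 0
  | .one => 1
  | .add s t => s.eval v + t.eval v
  | .mul s t => s.eval v * t.eval v

/-- Truth of a `Δ⁰₀` formula, the set variables being interpreted by `V` and the number
variables by `v`. -/
def Delta0.Holds {m : ℕ} (V : Fin m → Set M) : {n : ℕ} → Delta0 m n → (Fin n → M) → Prop
  | _, .eq s t, v => s.eval v = t.eval v
  | _, .lt s t, v => s.eval v < t.eval v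
  | _, .mem t X, v => t.eval v ∈ V X
  | _, .not φ, v => ¬ φ.Holds V v
  | _, .and φ ψ, v => φ.Holds V v ∧ ψ.Holds V v
  | _, .or φ ψ, v => φ.Holds V v ∨ ψ.Holds V v
  | _, .ball t φ, v => ∀ a : M, a < t.eval v → φ.Holds V (Matrix.vecCons a v)
  | _, .bex t φ, v => ∃ a : M, a < t.eval v ∧ φ.Holds V (Matrix.vecCons a v)

/-- `(M, S)` is a model of `RCA₀`. Here `M` is the first-order part and `S` the collection of
sets. The type classes on `M` together with `discrete` say that `M` is a model of `PA⁻`, that is,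
the nonnegative part of a discretely ordered commutative ring; the two other fields are
`Σ⁰₁`-induction and `Δ⁰₁`-comprehension, both with number parameters from `M` and set parameters
from `S`. -/
structure IsModelRCA0 [IsStrictOrderedRing M] [CanonicallyOrderedAdd M] (S : Set (Set M)) :
    Prop where
  discrete : ∀ x y : M, x < y → x + 1 ≤ y
  sigma1_induction : ∀ {m p : ℕ} (φ : Delta0 m (p + 2)) (V : Fin m → Set M) (v : Fin p → M),
    (∀ i, V i ∈ S) →
    (∃ y, φ.Holds V (Matrix.vecCons y (Matrix.vecCons 0 v))) →
    (∀ x, (∃ y, φ.Holds V (Matrix.vecCons y (Matrix.vecCons x v))) →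
      ∃ y, φ.Holds V (Matrix.vecCons y (Matrix.vecCons (x + 1) v))) →
    ∀ x, ∃ y, φ.Holds V (Matrix.vecCons y (Matrix.vecCons x v))
  delta1_comprehension : ∀ {m p : ℕ} (φ ψ : Delta0 m (p + 2)) (V : Fin m → Set M)
    (v : Fin p → M), (∀ i, V i ∈ S) →
    (∀ x, (∃ y, φ.Holds V (Matrix.vecCons y (Matrix.vecCons x v))) ↔
      ∀ y, ψ.Holds V (Matrix.vecCons y (Matrix.vecCons x v))) →
    {x | ∃ y, φ.Holds V (Matrix.vecCons y (Matrix.vecCons x v))} ∈ S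

/-- The collection scheme `BΣ⁰₂` in `(M, S)`, with parameters: for every `Σ⁰₂` formula
`σ(x, y) = ∃ u ∀ w φ(w, u, y, x)` and every `a`, if `∀ x < a ∃ y σ(x, y)`, then
`∃ b ∀ x < a ∃ y < b σ(x, y)`. -/
def SatisfiesBSigma2 (S : Set (Set M)) : Prop :=
  ∀ {m p : ℕ} (φ : Delta0 m (p + 4)) (V : Fin m → Set M) (v : Fin p → M), (∀ i, V i ∈ S) →
    ∀ a : M,
      (∀ x < a, ∃ y, ∃ u, ∀ w, φ.Holds V
        (Matrix.vecCons w (Matrix.vecCons u (Matrix.vecCons y (Matrix.vecCons x v))))) →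
      ∃ b : M, ∀ x < a, ∃ y < b, ∃ u, ∀ w, φ.Holds V
        (Matrix.vecCons w (Matrix.vecCons u (Matrix.vecCons y (Matrix.vecCons x v))))

/-- The relation `θ(x, y, z)` on `M` defined by a `Δ⁰₀` formula whose first three number variables
are `x, y, z`; the set variables and the further number variables are parameters. -/
def Delta0.rel {m p : ℕ} (θ : Delta0 m (p + 3)) (V : Fin m → Set M) (v : Fin p → M)
    (x y z : M) : Prop :=
  θ.Holds V (Matrix.vecCons x (Matrix.vecCons y (Matrix.vecCons z v)))

/-! The standard coding of pairs, finite sets and functions in `RCA₀`. -/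

/-- The pairing function. -/
def pair (a b : M) : M := (a + b) ^ 2 + a

/-- Codes of quadruples. -/
def quad (a b c d : M) : M := pair a (pair b (pair c d))

/-- The finite set with code `c = ((k, m), n)`: the set of all `x < k` such that `m(x+1)+1`
divides `n`. Over `RCA₀` the sets of this form are exactly the bounded sets of the model. -/
def codedSet (c : M) : Set M :=
  {x | ∃ k m n, c = pair (pair k m) n ∧ x < k ∧ m * (x + 1) + 1 ∣ n}

/-- `f` is a function of the model, that is, its graph is one of the sets of the model. -/
def IsInternalFun (S : Set (Set M)) (f : M → M) : Prop :=
  {c | ∃ x, c = pair x (f x)} ∈ S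

/-- `E < F`. -/
def SetLT (E F : Set M) : Prop := ∀ e ∈ E, ∀ f ∈ F, e < f

/-- `E` and `F` are `Θ`-apart: `∀ x < max E, ∃ y < min F, ∀ z < max F, Θ(x, y, z)`. -/
def Apart (Θ : M → M → M → Prop) (E F : Set M) : Prop :=
  ∀ x, (∃ e ∈ E, x < e) → ∃ y, (∀ f ∈ F, y < f) ∧ ∀ z, (∃ f ∈ F, z < f) → Θ x y z

/-- The set `L` of the model codes the families `Lₙ · (k, …, k)` (`d` times `k`), for all `n`, `d`,
`k` in `M` simultaneously: `quad n d k F ∈ L` means that the finite set coded by `F` belongs to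
`Lₙ · (k, …, k)`. The three clauses are the recursive definition of these families, carried out
inside the model, where `n` and `d` may be nonstandard:
* `L₀` consists of the nonempty sets;
* `F ∈ Lₙ₊₁` iff `F \ {min F} ∈ Lₙ · (min F, …, min F)` (`n + 1` times `min F`);
* `F ∈ (Lₙ · (k, …, k)) · k` iff `F` has `k` pairwise `Θ`-apart subsets `F₀ < ⋯ < Fₖ₋₁` in
  `Lₙ · (k, …, k)`. -/
structure IsLargenessTable (S : Set (Set M)) (Θ : M → M → M → Prop) (L : Set M) : Prop where
  zero : ∀ k F : M, quad 0 0 k F ∈ L ↔ (codedSet F).Nonempty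
  succ : ∀ n k F : M, quad (n + 1) 0 k F ∈ L ↔
    ∃ a G : M, IsLeast (codedSet F) a ∧ codedSet G = codedSet F \ {a} ∧ quad n (n + 1) a G ∈ L
  mul : ∀ n d k F : M, quad n (d + 1) k F ∈ L ↔
    ∃ f : M → M, IsInternalFun S f ∧
      (∀ i < k, codedSet (f i) ⊆ codedSet F ∧ quad n d k (f i) ∈ L) ∧
      ∀ i j, i < j → j < k →
        SetLT (codedSet (f i)) (codedSet (f j)) ∧ Apart Θ (codedSet (f i)) (codedSet (f j))

/-- In `(M, S)`, the finite set coded by `F` is `ωⁿ`-large*(`Θ`). -/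
def LargeStar (S : Set (Set M)) (Θ : M → M → M → Prop) (n F : M) : Prop :=
  ∃ L ∈ S, IsLargenessTable S Θ L ∧ quad n 0 0 F ∈ L

/-- The set `J*_Θ` of the model `(M, S)`: all `n` such that every infinite set of the model has a
finite subset which is `ωⁿ`-large*(`Θ`). Finite sets that are tested for largeness have minimum
at least `3`. -/
def JStar (S : Set (Set M)) (Θ : M → M → M → Prop) : Set M :=
  {n | ∀ X ∈ S, (∀ b : M, ∃ x ∈ X, b < x) →
    ∃ F : M, codedSet F ⊆ X ∧ (∀ x ∈ codedSet F, 3 ≤ x) ∧ LargeStar S Θ n F}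

/-- A cut: a nonempty initial segment closed under successor. It need not be proper. -/
structure IsCut (I : Set M) : Prop where
  nonempty : I.Nonempty
  isLowerSet : IsLowerSet I
  succ_mem : ∀ n ∈ I, n + 1 ∈ I

/-- A cut closed under `n ↦ n + n`. -/
structure IsAdditiveCut (I : Set M) : Prop extends IsCut I where
  add_self_mem : ∀ n ∈ I, n + n ∈ I

end Semantics

end SecondOrderArith

/-!
The members of `J*` are all treated through one set `L` of the model, the largeness table. Its
existence is proved by course-of-values recursion on numbers only. A chain of pairwise apart subsets
of `F` may be replaced by the chain of the intervals of `F` which its members span, because largeness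
is monotone and apartness depends only on minima and maxima; so it suffices to record, for the intervals `F ∩ [b, e)`, how long their chains are
(`ChainBy`, `exists_chainTable`). The result satisfies the clauses of the definition
(`isLargenessTable_tableOf`) and is monotone (`chainMono`), and these clauses determine it
(`largenessTable_unique`), by `Π⁰₁`-induction on `n` and on the number of factors. To make
such recursions and inductions available, the predicates definable by `Δ⁰₀` formulas with parameters
are described semantically (`IsDelta`). By comprehension they include all `Δ⁰₁` predicates
(`isDelta_of_sigma_pi`), hence admit substitution of definable functions.

`T` and `BΣ⁰₂` enter once, in `exists_separating`. Suppose that `n ∈ J*` and that `X` is an infinite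
set. For each `a` there is by collection some `b` below which all `x < a` have witnesses `y` with
`∀ z, θ(x, y, z)`, so that sets with maximum `a` are apart from all finite sets above `b`.
Therefore the search for an infinite `Y ⊆ X` such that between any two elements `w < y` of `Y` there
is a block `X ∩ [b, y]` which is `ωⁿ`-large and apart from all sets with maximum `w` does not
terminate. The search itself only checks apartness up to `y`, which is a `Δ⁰₁` condition.

The key step is `add_mem_jStar`. Let `H ⊆ Y` be finite, and let its hull be the part of `X` between
`min H` and `max H`. If `H` has two elements, its hull contains a block and is `ωⁿ`-large. Passing
to hulls preserves apartness, so `H` being `ω^(2(j+i))`-large gives that its hull is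
`ω^(n+i)`-large, by induction on `i`: two successive levels `m + 2` and `m + 1` of `H`, where
`m = 2(j+i)`, supply `2m + 3` factors at least `min H`, while one level of the hull uses
`n + i + 1` factors, and `n ≤ 4j` makes this fewer (`large_hull`). Since `Y` has `ωⁿ`-large subsets,
`n + i ∈ J*` as soon as `n ≤ 4j` and `2(j+i) ≤ n`. With `j = i = q` this says that `4q ∈ J*` implies
`5q ∈ J*`, and four such steps more than double. With `i = 1` it gives closure under successor for
`n ≥ 8`. The remaining `n` are standard, and for them the `n + 1` factors required by level `n + 1`
are obtained one at a time from separating sets (`hasLarge_succ`).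
-/

set_option linter.unusedSectionVars false

namespace SecondOrderArith

/-! ### Predicates definable by `Δ⁰₀` formulas with parameters -/

section Definability

variable {M : Type*} [CommSemiring M] [LinearOrder M]

/-- Functions of several variables on `M` given by number terms with parameters. -/
inductive IsPoly : ∀ {n : ℕ}, ((Fin n → M) → M) → Prop
  | var {n : ℕ} (i : Fin n) : IsPoly (fun v => v i)
  | const {n : ℕ} (c : M) : IsPoly (fun _ : Fin n → M => c)
  | add {n : ℕ} {f g : (Fin n → M) → M} : IsPoly f → IsPoly g → IsPoly (fun v => f v + g v)
  | mul {n : ℕ} {f g : (Fin n → M) → M} : IsPoly f → IsPoly g → IsPoly (fun v => f v * g v)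

/-- Predicates on `M` defined by `Δ⁰₀` formulas with number parameters from `M` and set
parameters from `S`. Over `RCA₀` these are also the `Δ⁰₁`-definable ones
(`isDelta_of_sigma_pi`). -/
inductive IsDelta (S : Set (Set M)) : ∀ {n : ℕ}, ((Fin n → M) → Prop) → Prop
  | eq_poly {n : ℕ} {f g : (Fin n → M) → M} :
      IsPoly f → IsPoly g → IsDelta S (fun v => f v = g v)
  | lt_poly {n : ℕ} {f g : (Fin n → M) → M} :
      IsPoly f → IsPoly g → IsDelta S (fun v => f v < g v)
  | mem_poly {n : ℕ} {X : Set M} {f : (Fin n → M) → M} :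
      X ∈ S → IsPoly f → IsDelta S (fun v => f v ∈ X)
  | not {n : ℕ} {P : (Fin n → M) → Prop} : IsDelta S P → IsDelta S (fun v => ¬ P v)
  | and {n : ℕ} {P Q : (Fin n → M) → Prop} :
      IsDelta S P → IsDelta S Q → IsDelta S (fun v => P v ∧ Q v)
  | ball_vecCons {n : ℕ} {f : (Fin n → M) → M} {P : (Fin (n + 1) → M) → Prop} :
      IsPoly f → IsDelta S P → IsDelta S (fun v => ∀ a, a < f v → P (Matrix.vecCons a v))

/-- Renaming of the variables of a term. -/
def ArithTerm.rename {k l : ℕ} (r : Fin k → Fin l) : ArithTerm k → ArithTerm l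
  | .var i => .var (r i)
  | .zero => .zero
  | .one => .one
  | .add s t => .add (s.rename r) (t.rename r)
  | .mul s t => .mul (s.rename r) (t.rename r)

theorem ArithTerm.eval_rename {k l : ℕ} (r : Fin k → Fin l) (t : ArithTerm k) (w : Fin l → M) :
    (t.rename r).eval w = t.eval (fun i => w (r i)) := by
  induction t with
  | var i => rfl
  | zero => rfl
  | one => rfl
  | add s t hs ht => simp [rename, eval, hs, ht]
  | mul s t hs ht => simp [rename, eval, hs, ht]

/-- Renaming of the free number variables (by `r`) and of the set variables (by `g`) of a
formula. -/
def Delta0.rename {m m' : ℕ} (g : Fin m → Fin m') :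
    {k l : ℕ} → (Fin k → Fin l) → Delta0 m k → Delta0 m' l
  | _, _, r, .eq s t => .eq (s.rename r) (t.rename r)
  | _, _, r, .lt s t => .lt (s.rename r) (t.rename r)
  | _, _, r, .mem t X => .mem (t.rename r) (g X)
  | _, _, r, .not φ => .not (φ.rename g r)
  | _, _, r, .and φ ψ => .and (φ.rename g r) (ψ.rename g r)
  | _, _, r, .or φ ψ => .or (φ.rename g r) (ψ.rename g r)
  | _, _, r, .ball t φ => .ball (t.rename r) (φ.rename g (Fin.cons 0 (fun i => (r i).succ)))
  | _, _, r, .bex t φ => .bex (t.rename r) (φ.rename g (Fin.cons 0 (fun i => (r i).succ)))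

theorem vecCons_comp_cons {k l : ℕ} (r : Fin k → Fin l) (a : M) (w : Fin l → M) :
    (fun i => (Matrix.vecCons a w : Fin (l + 1) → M)
      ((Fin.cons 0 (fun i => (r i).succ) : Fin (k + 1) → Fin (l + 1)) i)) =
      Matrix.vecCons a (fun i => w (r i)) := by
  funext i
  refine Fin.cases ?_ (fun j => ?_) i <;> simp

theorem Delta0.holds_rename {m m' : ℕ} (g : Fin m → Fin m') (V : Fin m' → Set M) {k l : ℕ}
    (r : Fin k → Fin l) (φ : Delta0 m k) (w : Fin l → M) :
    (φ.rename g r).Holds V w ↔ φ.Holds (fun i => V (g i)) (fun i => w (r i)) := by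
  induction φ generalizing l with
  | eq s t => simp [rename, Holds, ArithTerm.eval_rename]
  | lt s t => simp [rename, Holds, ArithTerm.eval_rename]
  | mem t X => simp [rename, Holds, ArithTerm.eval_rename]
  | not φ ih => simp [rename, Holds, ih]
  | and φ ψ ih ih' => simp [rename, Holds, ih, ih']
  | or φ ψ ih ih' => simp [rename, Holds, ih, ih']
  | ball t φ ih => simp only [rename, Holds, ih, ArithTerm.eval_rename, vecCons_comp_cons]
  | bex t φ ih => simp only [rename, Holds, ih, ArithTerm.eval_rename, vecCons_comp_cons]

/-- The value of a place of a formula: a place stands for one of the variables or for a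
parameter. -/
abbrev place {n : ℕ} (v : Fin n → M) : Fin n ⊕ M → M := Sum.elim v id

theorem IsPoly.exists_term {n : ℕ} {f : (Fin n → M) → M} (hf : IsPoly f) :
    ∃ (k : ℕ) (t : ArithTerm k) (e : Fin k → Fin n ⊕ M),
      ∀ v, f v = t.eval (fun i => place v (e i)) := by
  induction hf with
  | var i => exact ⟨1, .var 0, fun _ => .inl i, fun v => rfl⟩
  | const c => exact ⟨1, .var 0, fun _ => .inr c, fun v => rfl⟩
  | add _ _ ihf ihg =>
    obtain ⟨k, t, e, h⟩ := ihf
    obtain ⟨k', t', e', h'⟩ := ihg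
    refine ⟨k + k', .add (t.rename (Fin.castAdd k')) (t'.rename (Fin.natAdd k)),
      Fin.append e e', fun v => ?_⟩
    simp [ArithTerm.eval, ArithTerm.eval_rename, h, h']
  | mul _ _ ihf ihg =>
    obtain ⟨k, t, e, h⟩ := ihf
    obtain ⟨k', t', e', h'⟩ := ihg
    refine ⟨k + k', .mul (t.rename (Fin.castAdd k')) (t'.rename (Fin.natAdd k)),
      Fin.append e e', fun v => ?_⟩
    simp [ArithTerm.eval, ArithTerm.eval_rename, h, h']

/-- A predicate in the inductively generated class is defined by a formula; its free variables stand
for arguments and for number parameters in no particular order. -/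
theorem IsDelta.exists_places {S : Set (Set M)} {n : ℕ} {P : (Fin n → M) → Prop}
    (hP : IsDelta S P) :
    ∃ (m k : ℕ) (φ : Delta0 m k) (V : Fin m → Set M) (e : Fin k → Fin n ⊕ M),
      (∀ i, V i ∈ S) ∧ ∀ v, P v ↔ φ.Holds V (fun i => place v (e i)) := by
  induction hP with
  | eq_poly hf hg =>
    obtain ⟨k, t, e, h⟩ := hf.exists_term
    obtain ⟨k', t', e', h'⟩ := hg.exists_term
    refine ⟨0, k + k', .eq (t.rename (Fin.castAdd k')) (t'.rename (Fin.natAdd k)),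
      Fin.elim0, Fin.append e e', fun i => i.elim0, fun v => ?_⟩
    simp [Delta0.Holds, ArithTerm.eval_rename, h, h']
  | lt_poly hf hg =>
    obtain ⟨k, t, e, h⟩ := hf.exists_term
    obtain ⟨k', t', e', h'⟩ := hg.exists_term
    refine ⟨0, k + k', .lt (t.rename (Fin.castAdd k')) (t'.rename (Fin.natAdd k)),
      Fin.elim0, Fin.append e e', fun i => i.elim0, fun v => ?_⟩
    simp [Delta0.Holds, ArithTerm.eval_rename, h, h']
  | @mem_poly n X f hX hf =>
    obtain ⟨k, t, e, h⟩ := hf.exists_term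
    refine ⟨1, k, .mem t 0, fun _ => X, e, fun i => hX, fun v => ?_⟩
    simp [Delta0.Holds, h]
  | not _ ih =>
    obtain ⟨m, k, φ, V, e, hV, h⟩ := ih
    exact ⟨m, k, .not φ, V, e, hV, fun v => by simp [Delta0.Holds, h]⟩
  | and _ _ ih ih' =>
    obtain ⟨m, k, φ, V, e, hV, h⟩ := ih
    obtain ⟨m', k', φ', V', e', hV', h'⟩ := ih'
    refine ⟨m + m', k + k', .and (φ.rename (Fin.castAdd m') (Fin.castAdd k'))
      (φ'.rename (Fin.natAdd m) (Fin.natAdd k)), Fin.append V V', Fin.append e e',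
      fun i => ?_, fun v => ?_⟩
    · refine Fin.addCases (fun j => ?_) (fun j => ?_) i
      · simpa using hV j
      · simpa using hV' j
    · simp [Delta0.Holds, Delta0.holds_rename, h, h']
  | @ball_vecCons n f P hf _ ih =>
    obtain ⟨k', t, e', ht⟩ := hf.exists_term
    obtain ⟨m, k, φ, V, e, hV, h⟩ := ih
    -- the places for variable `0` of the body become bound, the others stay free
    let r : Fin k → Fin (k' + k + 1) := fun i =>
      Sum.elim (Fin.cases 0 (fun _ => (Fin.natAdd k' i).succ))
        (fun _ => (Fin.natAdd k' i).succ) (e i)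
    let e₁ : Fin k → Fin n ⊕ M := fun i =>
      Sum.elim (Fin.cases (.inr 0) (fun j => .inl j)) (fun c => .inr c) (e i)
    refine ⟨m, k' + k, .ball (t.rename (Fin.castAdd k)) (φ.rename id r), V,
      Fin.append e' e₁, hV, fun v => ?_⟩
    have key : ∀ a : M, (fun i => (Matrix.vecCons a
        (fun i => place v (Fin.append e' e₁ i)) : Fin (k' + k + 1) → M) (r i)) =
        fun i => place (Matrix.vecCons a v) (e i) := by
      intro a
      funext i
      simp only [r, e₁]
      rcases hi : e i with j | c
      · obtain rfl | ⟨j, rfl⟩ := j.eq_zero_or_eq_succ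
        · simp
        · simp [hi]
      · simp [hi]
    simp only [Delta0.Holds, Delta0.holds_rename, ArithTerm.eval_rename, key]
    simp [h, ht]

/-- A predicate of `q` variables is defined by a formula in which the `q` variables come first
and are followed by the number parameters. -/
theorem IsDelta.exists_formula {S : Set (Set M)} {q : ℕ} {P : (Fin q → M) → Prop}
    (hP : IsDelta S P) :
    ∃ (m p : ℕ) (φ : Delta0 m (p + q)) (V : Fin m → Set M) (v : Fin p → M),
      (∀ i, V i ∈ S) ∧ ∀ (x : Fin q → M) (w : Fin (p + q) → M),
        (∀ j : Fin q, w ⟨j, by omega⟩ = x j) → (∀ i : Fin p, w ⟨i + q, by omega⟩ = v i) →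
        (P x ↔ φ.Holds V w) := by
  obtain ⟨m, k, φ, V, e, hV, h⟩ := hP.exists_places
  let r : Fin k → Fin (k + q) := fun i =>
    Sum.elim (fun j : Fin q => ⟨j, by omega⟩) (fun _ => ⟨i + q, by omega⟩) (e i)
  refine ⟨m, k, φ.rename id r, V, fun i => Sum.elim (fun _ => 0) id (e i), hV,
    fun x w hx hw => ?_⟩
  rw [h, Delta0.holds_rename]
  have : (fun i => place x (e i)) = fun i => w (r i) := by
    funext i
    simp only [r]
    have := hw i
    rcases hi : e i with j | c
    · simp [hx]
    · simp [hi] at this; simp [this]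
  rw [this]; rfl

theorem IsPoly.comp {n l : ℕ} {f : (Fin n → M) → M} (hf : IsPoly f)
    {σ : Fin n → (Fin l → M) → M} (hσ : ∀ i, IsPoly (σ i)) :
    IsPoly (fun v => f (fun i => σ i v)) := by
  induction hf with
  | var i => exact hσ i
  | const c => exact .const c
  | add _ _ ihf ihg => exact .add ihf ihg
  | mul _ _ ihf ihg => exact .mul ihf ihg

theorem IsPoly.comp_succ {n : ℕ} {f : (Fin n → M) → M} (hf : IsPoly f) :
    IsPoly (fun v : Fin (n + 1) → M => f (fun i => v i.succ)) :=
  hf.comp (fun i => .var i.succ)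

theorem IsDelta.comp_poly {S : Set (Set M)} {n l : ℕ} {P : (Fin n → M) → Prop}
    (hP : IsDelta S P) {σ : Fin n → (Fin l → M) → M} (hσ : ∀ i, IsPoly (σ i)) :
    IsDelta S (fun v => P (fun i => σ i v)) := by
  induction hP generalizing l with
  | eq_poly hf hg => exact .eq_poly (hf.comp hσ) (hg.comp hσ)
  | lt_poly hf hg => exact .lt_poly (hf.comp hσ) (hg.comp hσ)
  | mem_poly hX hf => exact .mem_poly hX (hf.comp hσ)
  | not _ ih => exact .not (ih hσ)
  | and _ _ ih ih' => exact .and (ih hσ) (ih' hσ)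
  | @ball_vecCons n f P hf _ ih =>
    have := ih (l := l + 1) (σ := Fin.cons (fun v => v 0) (fun i v => σ i (fun j => v j.succ)))
      (fun i => Fin.cases (.var 0) (fun j => (hσ j).comp_succ) i)
    convert IsDelta.ball_vecCons (hf.comp hσ) this using 5 with v a
    have e : (Matrix.vecCons a (fun i => σ i v) : Fin (n + 1) → M) = fun i =>
        (Fin.cons (fun v => v 0) (fun i v => σ i (fun j => v j.succ)) :
          Fin (n + 1) → (Fin (l + 1) → M) → M) i (Matrix.vecCons a v) := by
      funext i
      refine Fin.cases ?_ (fun j => ?_) i <;> simp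
    rw [e]

theorem ArithTerm.isPoly_eval {k n : ℕ} (t : ArithTerm k) {e : Fin k → (Fin n → M) → M}
    (he : ∀ i, IsPoly (e i)) : IsPoly (fun v => t.eval (fun i => e i v)) := by
  induction t with
  | var i => exact he i
  | zero => exact .const 0
  | one => exact .const 1
  | add s t hs ht => exact .add hs ht
  | mul s t hs ht => exact .mul hs ht

/-- Bounded universal quantification. -/
theorem IsDelta.ball_poly {S : Set (Set M)} {n : ℕ} {f : (Fin n → M) → M}
    {P : M → (Fin n → M) → Prop} (hf : IsPoly f)
    (hP : IsDelta S (fun w : Fin (n + 1) → M => P (w 0) (fun i => w i.succ))) :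
    IsDelta S (fun v => ∀ a, a < f v → P a v) := by
  simpa using IsDelta.ball_vecCons hf hP

theorem IsDelta.of_iff {S : Set (Set M)} {n : ℕ} {P Q : (Fin n → M) → Prop}
    (hP : IsDelta S P) (h : ∀ v, Q v ↔ P v) : IsDelta S Q := by
  have : Q = P := funext fun v => propext (h v)
  rwa [this]

theorem IsDelta.or {S : Set (Set M)} {n : ℕ} {P Q : (Fin n → M) → Prop}
    (hP : IsDelta S P) (hQ : IsDelta S Q) : IsDelta S (fun v => P v ∨ Q v) :=
  (hP.not.and hQ.not).not.of_iff fun v => by tauto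

theorem IsDelta.imp {S : Set (Set M)} {n : ℕ} {P Q : (Fin n → M) → Prop}
    (hP : IsDelta S P) (hQ : IsDelta S Q) : IsDelta S (fun v => P v → Q v) :=
  (hP.and hQ.not).not.of_iff fun v => by tauto

theorem IsDelta.iff {S : Set (Set M)} {n : ℕ} {P Q : (Fin n → M) → Prop}
    (hP : IsDelta S P) (hQ : IsDelta S Q) : IsDelta S (fun v => P v ↔ Q v) :=
  ((hP.imp hQ).and (hQ.imp hP)).of_iff fun v => by tauto

theorem IsDelta.bex_poly {S : Set (Set M)} {n : ℕ} {f : (Fin n → M) → M}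
    {P : M → (Fin n → M) → Prop} (hf : IsPoly f)
    (hP : IsDelta S (fun w : Fin (n + 1) → M => P (w 0) (fun i => w i.succ))) :
    IsDelta S (fun v => ∃ a, a < f v ∧ P a v) :=
  (IsDelta.ball_poly (P := fun a v => ¬ P a v) hf hP.not).not.of_iff fun v => by
    push Not; rfl

theorem IsDelta.const {S : Set (Set M)} {n : ℕ} (p : Prop) :
    IsDelta S (fun _ : Fin n → M => p) := by
  have h : IsDelta S (fun _ : Fin n → M => (0 : M) = 0) := .eq_poly (.const 0) (.const 0)
  by_cases hp : p
  · exact h.of_iff fun v => by simp [hp]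
  · exact h.not.of_iff fun v => by simp [hp]

/-- Conversely, a formula defines a predicate of the class, also after substitution of terms. -/
theorem Delta0.isDelta_holds {S : Set (Set M)} {m k n : ℕ} (φ : Delta0 m k) {V : Fin m → Set M}
    (hV : ∀ i, V i ∈ S) {e : Fin k → (Fin n → M) → M} (he : ∀ i, IsPoly (e i)) :
    IsDelta S (fun v => φ.Holds V (fun i => e i v)) := by
  induction φ generalizing n with
  | eq s t => exact .eq_poly (s.isPoly_eval he) (t.isPoly_eval he)
  | lt s t => exact .lt_poly (s.isPoly_eval he) (t.isPoly_eval he)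
  | mem t X => exact .mem_poly (hV X) (t.isPoly_eval he)
  | not φ ih => exact .not (ih he)
  | and φ ψ ih ih' => exact .and (ih he) (ih' he)
  | or φ ψ ih ih' => exact .or (ih he) (ih' he)
  | @ball k t φ ih =>
    have := ih (n := n + 1) (e := Fin.cons (fun v => v 0) (fun i v => e i (fun j => v j.succ)))
      (fun i => Fin.cases (.var 0) (fun j => (he j).comp_succ) i)
    refine IsDelta.ball_poly (P := fun a v => φ.Holds V (Matrix.vecCons a fun i => e i v))
      (t.isPoly_eval he) (this.of_iff fun w => ?_)
    have e' : (Matrix.vecCons (w 0) (fun i => e i (fun j => w j.succ)) : Fin (k + 1) → M) =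
        fun i => (Fin.cons (fun v => v 0) (fun i v => e i (fun j => v j.succ)) :
          Fin (k + 1) → (Fin (n + 1) → M) → M) i w := by
      funext i
      refine Fin.cases ?_ (fun j => ?_) i <;> simp
    rw [e']
  | @bex k t φ ih =>
    have := ih (n := n + 1) (e := Fin.cons (fun v => v 0) (fun i v => e i (fun j => v j.succ)))
      (fun i => Fin.cases (.var 0) (fun j => (he j).comp_succ) i)
    refine IsDelta.bex_poly (P := fun a v => φ.Holds V (Matrix.vecCons a fun i => e i v))
      (t.isPoly_eval he) (this.of_iff fun w => ?_)
    have e' : (Matrix.vecCons (w 0) (fun i => e i (fun j => w j.succ)) : Fin (k + 1) → M) =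
        fun i => (Fin.cons (fun v => v 0) (fun i v => e i (fun j => v j.succ)) :
          Fin (k + 1) → (Fin (n + 1) → M) → M) i w := by
      funext i
      refine Fin.cases ?_ (fun j => ?_) i <;> simp
    rw [e']

end Definability

/-! ### Pairing, induction and comprehension -/

section Induction

variable {M : Type*} [CommSemiring M] [LinearOrder M]

/-- Functions on `M` with a `Δ⁰₁`-definable graph; the value is variable number `0` of the graph. -/
def IsDeltaFun (S : Set (Set M)) {n : ℕ} (f : (Fin n → M) → M) : Prop :=
  IsDelta S (fun w : Fin (n + 1) → M => w 0 = f (fun i => w i.succ))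

/-- `Π⁰₁`-definable predicates. -/
def IsPi (S : Set (Set M)) {n : ℕ} (P : (Fin n → M) → Prop) : Prop :=
  ∃ Q : M → (Fin n → M) → Prop,
    IsDelta S (fun w : Fin (n + 1) → M => Q (w 0) (fun i => w i.succ)) ∧ ∀ v, P v ↔ ∀ y, Q y v

theorem IsDelta.rename {S : Set (Set M)} {n l : ℕ} {P : (Fin n → M) → Prop}
    (hP : IsDelta S P) (σ : Fin n → Fin l) : IsDelta S (fun w => P (fun i => w (σ i))) :=
  hP.comp_poly (σ := fun i w => w (σ i)) fun i => .var (σ i)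

variable [IsStrictOrderedRing M] [CanonicallyOrderedAdd M] {S : Set (Set M)}

theorem le_sq_of_discrete (hd : ∀ x y : M, x < y → x + 1 ≤ y) (a : M) : a ≤ a ^ 2 := by
  rcases eq_or_ne a 0 with rfl | ha
  · simp
  · have : 1 ≤ a := by simpa using hd 0 a (pos_iff_ne_zero.2 ha)
    calc a = a * 1 := by ring
      _ ≤ a * a := by gcongr
      _ = a ^ 2 := by ring

theorem succ_ne_zero (a : M) : a + 1 ≠ 0 :=
  (add_pos_of_nonneg_of_pos (by simp) one_pos).ne'

theorem le_pair_left (a b : M) : a ≤ pair a b := le_add_self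

theorem pair_lt_pair_left {a a' b : M} (h : a < a') : pair a b < pair a' b := by
  have : (a + b) ^ 2 ≤ (a' + b) ^ 2 := by gcongr
  unfold pair; exact add_lt_add_of_le_of_lt this h

theorem IsPoly.pair {n : ℕ} {f g : (Fin n → M) → M} (hf : IsPoly f) (hg : IsPoly g) :
    IsPoly (fun v => pair (f v) (g v)) := by
  have : (fun v => SecondOrderArith.pair (f v) (g v)) =
      fun v => (f v + g v) * (f v + g v) + f v := by
    funext v; simp [SecondOrderArith.pair, sq]
  rw [this]
  exact ((hf.add hg).mul (hf.add hg)).add hf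

namespace IsModelRCA0

variable (h : IsModelRCA0 S)
include h

theorem lt_add_one_iff {a b : M} : a < b + 1 ↔ a ≤ b :=
  ⟨fun hab => not_lt.1 fun hba => absurd (h.discrete _ _ hba) (not_le.2 hab),
    fun hab => lt_of_le_of_lt hab (lt_add_one b)⟩

theorem add_one_le_iff {a b : M} : a + 1 ≤ b ↔ a < b :=
  ⟨fun hab => lt_of_lt_of_le (lt_add_one a) hab, h.discrete a b⟩

theorem exists_eq_add_one {a : M} (ha : a ≠ 0) : ∃ b, a = b + 1 := by
  obtain ⟨b, hb⟩ := exists_add_of_le (h.discrete 0 a (pos_iff_ne_zero.2 ha))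
  exact ⟨b, by rw [hb]; ring⟩

theorem le_pair_right (a b : M) : b ≤ pair a b :=
  calc b ≤ a + b := le_add_self
    _ ≤ (a + b) ^ 2 := le_sq_of_discrete h.discrete _
    _ ≤ _ := le_self_add

theorem pair_add_le {a b a' b' : M} (hab : pair a b = pair a' b') : a' + b' ≤ a + b := by
  by_contra hlt
  have h1 := h.discrete _ _ (not_le.1 hlt)
  have h2 : (a + b + 1) ^ 2 ≤ (a' + b') ^ 2 := by gcongr
  have h3 : pair a b < (a + b + 1) ^ 2 := by
    have : (a + b + 1) ^ 2 = pair a b + (a + b + b + 1) := by unfold pair; ring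
    rw [this]
    exact lt_add_of_pos_right _ (by positivity)
  have h4 : (a' + b') ^ 2 ≤ pair a' b' := le_self_add
  exact absurd (h3.trans_le (h2.trans h4)) (by rw [hab]; exact lt_irrefl _)

theorem pair_inj {a b a' b' : M} : pair a b = pair a' b' ↔ a = a' ∧ b = b' := by
  refine ⟨fun hab => ?_, by rintro ⟨rfl, rfl⟩; rfl⟩
  have hs : a + b = a' + b' := le_antisymm (h.pair_add_le hab.symm) (h.pair_add_le hab)
  have ha : a = a' := by
    unfold pair at hab; rw [hs] at hab; exact add_left_cancel hab
  subst ha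
  exact ⟨rfl, add_left_cancel hs⟩

theorem quad_inj {a b c d a' b' c' d' : M} :
    quad a b c d = quad a' b' c' d' ↔ a = a' ∧ b = b' ∧ c = c' ∧ d = d' := by
  simp [quad, h.pair_inj]

/-- `Σ⁰₁`-induction. -/
theorem sigma_induction {P : M → M → Prop}
    (hP : IsDelta S (fun w : Fin 2 → M => P (w 0) (w 1))) (h0 : ∃ y, P y 0)
    (hs : ∀ x, (∃ y, P y x) → ∃ y, P y (x + 1)) (x : M) : ∃ y, P y x := by
  obtain ⟨m, p, φ, V, v, hV, hφ⟩ := hP.exists_formula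
  have key : ∀ y x, P y x ↔ φ.Holds V (Matrix.vecCons y (Matrix.vecCons x v)) := fun y x =>
    hφ ![y, x] (Matrix.vecCons y (Matrix.vecCons x v))
      (fun j => by fin_cases j <;> rfl) (fun i => rfl)
  simp only [key] at h0 hs ⊢
  exact h.sigma1_induction φ V v hV h0 hs x

theorem delta_induction {P : M → Prop} (hP : IsDelta S (fun w : Fin 1 → M => P (w 0)))
    (h0 : P 0) (hs : ∀ x, P x → P (x + 1)) (x : M) : P x := by
  have := h.sigma_induction (P := fun _ x => P x) (hP.rename (fun _ => 1)) ⟨0, h0⟩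
    (fun x hx => ⟨0, hs x hx.choose_spec⟩) x
  exact this.choose_spec

/-- `Π⁰₁`-induction, which over `RCA₀` follows from `Σ⁰₁`-induction. -/
theorem pi_induction {P : M → Prop} (hP : IsPi S (fun w : Fin 1 → M => P (w 0)))
    (h0 : P 0) (hs : ∀ x, P x → P (x + 1)) (x : M) : P x := by
  obtain ⟨Q', hQ', hPQ'⟩ := hP
  obtain ⟨Q, hQ, hPQ⟩ : ∃ Q : M → M → Prop, IsDelta S (fun w : Fin 2 → M => Q (w 0) (w 1)) ∧
      ∀ x, P x ↔ ∀ y, Q y x := by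
    refine ⟨fun y x => Q' y (fun _ => x), ?_, fun x => hPQ' (fun _ => x)⟩
    convert hQ' using 3 with w
    funext i; fin_cases i; rfl
  by_contra hx
  -- the failure at `x` is carried down to `0`, by induction on the distance `z` to `x`
  have key : ∀ z, ∃ y, x < z ∨ ∃ u < x + 1, u + z = x ∧ ¬ Q y u := by
    refine h.sigma_induction ?_ ?_ ?_
    · refine .or (.lt_poly (.const x) (.var 1)) (.bex_poly (.const _) (.and ?_ ?_))
      · exact .eq_poly (.add (.var 0) (.var 2)) (.const x)
      · exact (hQ.comp_poly (σ := ![fun w => w 1, fun w => w 0])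
          (fun i => by fin_cases i <;> exact .var _)).not
    · rw [hPQ] at hx
      push Not at hx
      obtain ⟨y, hy⟩ := hx
      exact ⟨y, .inr ⟨x, lt_add_one x, add_zero x, hy⟩⟩
    · rintro z ⟨y, hxz | ⟨u, hu, rfl, hy⟩⟩
      · exact ⟨0, .inl (hxz.trans (lt_add_one z))⟩
      · rcases eq_or_ne u 0 with rfl | hu0
        · exact ⟨0, .inl (by simp)⟩
        obtain ⟨u, rfl⟩ := h.exists_eq_add_one hu0
        have : ¬ P u := fun hu => hy ((hPQ _).1 (hs u hu) y)
        rw [hPQ] at this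
        push Not at this
        obtain ⟨y', hy'⟩ := this
        refine ⟨y', .inr ⟨u, ?_, by ring, hy'⟩⟩
        rw [h.lt_add_one_iff]
        calc u ≤ u + (1 + z) := le_self_add
          _ = u + 1 + z := by ring
  obtain ⟨y, hxx | ⟨u, -, hu, hy⟩⟩ := key x
  · exact lt_irrefl _ hxx
  · have : u = 0 := by simpa using hu
    subst this
    exact hy ((hPQ 0).1 h0 y)

/-- The least number principle. -/
theorem exists_least {P : M → Prop} (hP : IsDelta S (fun w : Fin 1 → M => P (w 0)))
    (hex : ∃ x, P x) : ∃ x, P x ∧ ∀ y < x, ¬ P y := by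
  by_contra hno
  push Not at hno
  have key : ∀ x, ∀ y, y < x → ¬ P y := by
    refine h.delta_induction ?_ (fun y hy => absurd hy (by simp)) (fun x ih y hy => ?_)
    · exact .ball_poly (.var 0) (hP.rename (fun _ => 0)).not
    · intro hPy
      obtain ⟨z, hz, hPz⟩ := hno y hPy
      exact ih z (hz.trans_le (h.lt_add_one_iff.1 hy)) hPz
  obtain ⟨x, hx⟩ := hex
  exact key (x + 1) x (lt_add_one x) hx

/-- `Δ⁰₁`-comprehension. -/
theorem comprehension {P : M → Prop} {Q R : M → M → Prop}
    (hQ : IsDelta S (fun w : Fin 2 → M => Q (w 0) (w 1)))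
    (hR : IsDelta S (fun w : Fin 2 → M => R (w 0) (w 1)))
    (hPQ : ∀ x, P x ↔ ∃ y, Q y x) (hPR : ∀ x, P x ↔ ∀ y, R y x) : {x | P x} ∈ S := by
  obtain ⟨m, p, φ, V, v, hV, hφ⟩ := hQ.exists_formula
  obtain ⟨m', p', ψ, V', v', hV', hψ⟩ := hR.exists_formula
  -- both formulas are given the same parameters
  let r : Fin (p + 2) → Fin (p + p' + 2) := fun i => ⟨i, by omega⟩
  let r' : Fin (p' + 2) → Fin (p + p' + 2) := fun i =>
    if hi : i.val < 2 then ⟨i, by omega⟩ else ⟨p + i, by omega⟩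
  have hVV : ∀ i, Fin.append V V' i ∈ S := fun i => by
    refine Fin.addCases (fun j => ?_) (fun j => ?_) i
    · simpa using hV j
    · simpa using hV' j
  have key : ∀ y x, Q y x ↔ (φ.rename (Fin.castAdd m') r).Holds (Fin.append V V')
      (Matrix.vecCons y (Matrix.vecCons x (Fin.append v v'))) := fun y x => by
    rw [Delta0.holds_rename]
    simp only [Fin.append_left]
    refine hφ ![y, x] _ (fun j => by fin_cases j <;> rfl) (fun i => ?_)
    exact Fin.append_left v v' i
  have key' : ∀ y x, R y x ↔ (ψ.rename (Fin.natAdd m) r').Holds (Fin.append V V')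
      (Matrix.vecCons y (Matrix.vecCons x (Fin.append v v'))) := fun y x => by
    rw [Delta0.holds_rename]
    simp only [Fin.append_right]
    refine hψ ![y, x] _ (fun j => by fin_cases j <;> rfl) (fun i => ?_)
    have : r' ⟨i + 2, by omega⟩ = ⟨p + i + 2, by omega⟩ := by simp [r', add_assoc]
    rw [this]
    exact Fin.append_right v v' i
  have e : {x | P x} = {x | ∃ y, (φ.rename (Fin.castAdd m') r).Holds (Fin.append V V')
      (Matrix.vecCons y (Matrix.vecCons x (Fin.append v v')))} := by
    ext x
    rw [Set.mem_ofPred_eq, Set.mem_ofPred_eq, hPQ]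
    exact exists_congr fun y => key y x
  rw [e]
  refine h.delta1_comprehension _ (ψ.rename (Fin.natAdd m) r') _ _ hVV fun x => ?_
  rw [← exists_congr fun y => key y x, ← forall_congr' fun y => key' y x, ← hPQ, ← hPR]

/-- Every `Δ⁰₁`-definable predicate is `Δ⁰₀` in set parameters from `S`: by comprehension, the
codes of the tuples that satisfy it form a set of the model. -/
theorem isDelta_of_sigma_pi {n : ℕ} {P : (Fin n → M) → Prop} {Q R : M → (Fin n → M) → Prop}
    (hQ : IsDelta S (fun w : Fin (n + 1) → M => Q (w 0) (fun i => w i.succ)))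
    (hR : IsDelta S (fun w : Fin (n + 1) → M => R (w 0) (fun i => w i.succ)))
    (hPQ : ∀ v, P v ↔ ∃ y, Q y v) (hPR : ∀ v, P v ↔ ∀ y, R y v) : IsDelta S P := by
  induction n with
  | zero =>
    have : P = fun _ => P Fin.elim0 := funext fun v => by congr; exact Subsingleton.elim _ _
    rw [this]; exact .const _
  | succ n ih =>
    rcases n with _ | n
    · have e : ∀ w : Fin 2 → M, (fun i : Fin 1 => w i.succ) = fun _ => w 1 := fun w => by
        funext i; fin_cases i; rfl
      simp only [e] at hQ hR
      have := h.comprehension (P := fun x => P (fun _ => x)) hQ hR (fun x => hPQ _) (fun x => hPR _)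
      refine (IsDelta.mem_poly this (.var (0 : Fin 1))).of_iff fun v => ?_
      have : v = fun _ => v 0 := by funext i; fin_cases i; rfl
      show P v ↔ P fun _ => v 0
      rw [← this]
    · -- the first two variables are replaced by their pair
      let U : (M → (Fin (n + 2) → M) → Prop) → M → (Fin (n + 1) → M) → Prop := fun Q y u =>
        ∃ a < u 0 + 1, ∃ b < u 0 + 1, u 0 = pair a b ∧
          Q y (Matrix.vecCons a (Matrix.vecCons b (fun i => u i.succ)))
      have hU : ∀ Q : M → (Fin (n + 2) → M) → Prop,
          IsDelta S (fun w : Fin (n + 2 + 1) → M => Q (w 0) (fun i => w i.succ)) →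
          IsDelta S (fun w : Fin (n + 1 + 1) → M => U Q (w 0) (fun i => w i.succ)) := by
        intro Q hQ
        have h1 : IsPoly (fun w : Fin (n + 2) → M => w 1 + 1) := .add (.var 1) (.const 1)
        have h2 : IsPoly (fun w : Fin (n + 3) → M => w 2 + 1) := .add (.var 2) (.const 1)
        refine .bex_poly h1 (.bex_poly h2 (.and ?_ ?_))
        · exact .eq_poly (.var 3) (.pair (.var 1) (.var 0))
        · refine (hQ.comp_poly (σ := Fin.cons (fun w => w 2) (Fin.cons (fun w => w 1)
            (Fin.cons (fun w => w 0) (fun i w => w i.succ.succ.succ.succ)))) ?_).of_iff ?_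
          · refine Fin.cases (.var _) (Fin.cases (.var _) (Fin.cases (.var _) fun i => .var _))
          · intro w
            have : (Matrix.vecCons (w 1) (Matrix.vecCons (w 0)
                (fun i : Fin n => w i.succ.succ.succ.succ)) : Fin (n + 2) → M) = fun i =>
                (Fin.cons (fun w => w 1) (Fin.cons (fun w => w 0)
                  (fun i w => w i.succ.succ.succ.succ)) :
                    Fin (n + 2) → (Fin (n + 2 + 1 + 1) → M) → M) i w := by
              funext i
              refine Fin.cases ?_ (Fin.cases ?_ (fun j => ?_)) i <;> simp
            simp only [Fin.cons_zero, Fin.cons_succ]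
            rw [← this]; rfl
      have hUeq : ∀ Q y u, U Q y u ↔ ∃ a b, u 0 = pair a b ∧
          Q y (Matrix.vecCons a (Matrix.vecCons b (fun i => u i.succ))) := by
        intro Q y u
        constructor
        · rintro ⟨a, -, b, -, h1, h2⟩; exact ⟨a, b, h1, h2⟩
        · rintro ⟨a, b, h1, h2⟩
          exact ⟨a, h.lt_add_one_iff.2 (h1 ▸ le_pair_left a b), b,
            h.lt_add_one_iff.2 (h1 ▸ h.le_pair_right a b), h1, h2⟩
      have hnot := hU (fun y v => ¬ R y v) hR.not
      have := ih (P := fun u => ∃ a b, u 0 = pair a b ∧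
          P (Matrix.vecCons a (Matrix.vecCons b (fun i => u i.succ)))) (Q := U Q)
          (R := fun y u => (∃ a < u 0 + 1, ∃ b < u 0 + 1, u 0 = pair a b) ∧
            ¬ U (fun y v => ¬ R y v) y u) (hU Q hQ) ?_ ?_ ?_
      · have := this.comp_poly (σ := (Fin.cons (fun v => pair (v 0) (v 1))
          (fun i v => v i.succ.succ) : Fin (n + 1) → (Fin (n + 2) → M) → M)) ?_
        · refine this.of_iff fun v => ?_
          simp only [Fin.cons_zero, Fin.cons_succ, h.pair_inj]
          have e : v = Matrix.vecCons (v 0) (Matrix.vecCons (v 1) (fun i => v i.succ.succ)) := by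
            funext i
            refine Fin.cases ?_ (Fin.cases ?_ (fun j => ?_)) i <;> rfl
          constructor
          · intro hv
            exact ⟨v 0, v 1, ⟨rfl, rfl⟩, e ▸ hv⟩
          · rintro ⟨a, b, ⟨rfl, rfl⟩, hv⟩
            rwa [← e] at hv
        · exact Fin.cases (.pair (.var 0) (.var 1)) (fun i => .var _)
      · refine .and ?_ hnot.not
        have h1 : IsPoly (fun w : Fin (n + 2) → M => w 1 + 1) := .add (.var 1) (.const 1)
        have h2 : IsPoly (fun w : Fin (n + 3) → M => w 2 + 1) := .add (.var 2) (.const 1)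
        exact .bex_poly h1 (.bex_poly h2 (.eq_poly (.var 3) (.pair (.var 1) (.var 0))))
      · intro u
        simp only [hUeq, hPQ]
        constructor
        · rintro ⟨a, b, hab, y, hy⟩; exact ⟨y, a, b, hab, hy⟩
        · rintro ⟨y, a, b, hab, hy⟩; exact ⟨a, b, hab, y, hy⟩
      · intro u
        simp only [hUeq, hPR]
        constructor
        · rintro ⟨a, b, hab, hy⟩ y
          refine ⟨⟨a, h.lt_add_one_iff.2 (hab ▸ le_pair_left a b), b,
            h.lt_add_one_iff.2 (hab ▸ h.le_pair_right a b), hab⟩, ?_⟩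
          rintro ⟨a', b', hab', hn⟩
          obtain ⟨rfl, rfl⟩ := h.pair_inj.1 (hab.symm.trans hab')
          exact hn (hy y)
        · intro H
          obtain ⟨a, -, b, -, hab⟩ := (H 0).1
          refine ⟨a, b, hab, fun y => ?_⟩
          by_contra hn
          exact (H y).2 ⟨a, b, hab, hn⟩

end IsModelRCA0

end Induction

/-! ### Closure properties of the `Δ⁰₁`-definable predicates and functions -/

section Closure

variable {M : Type*} [CommSemiring M] [LinearOrder M] {S : Set (Set M)}

theorem IsDeltaFun.rename {n l : ℕ} {f : (Fin n → M) → M} (hf : IsDeltaFun S f)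
    (σ : Fin n → Fin l) : IsDeltaFun S (fun w => f (fun i => w (σ i))) := by
  have : ∀ i, IsPoly ((Fin.cons (fun v => v 0) (fun i v => v (σ i).succ) :
      Fin (n + 1) → (Fin (l + 1) → M) → M) i) :=
    Fin.cases (.var _) fun i => .var _
  refine (IsDelta.comp_poly hf this).of_iff fun w => ?_
  simp

theorem IsPoly.isDeltaFun {n : ℕ} {f : (Fin n → M) → M} (hf : IsPoly f) : IsDeltaFun S f :=
  .eq_poly (.var 0) hf.comp_succ

theorem IsDelta.isPi {n : ℕ} {P : (Fin n → M) → Prop} (hP : IsDelta S P) : IsPi S P :=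
  ⟨fun _ v => P v, hP.rename Fin.succ, fun v => by simp⟩

variable [IsStrictOrderedRing M] [CanonicallyOrderedAdd M]

namespace IsModelRCA0

variable (h : IsModelRCA0 S)
include h

/-- Functions of the class may be substituted into predicates: `P (f v) v` is both
`∃ y, y = f v ∧ P y v` and `∀ y, y = f v → P y v`. -/
theorem subst {n : ℕ} {P : M → (Fin n → M) → Prop} {f : (Fin n → M) → M}
    (hP : IsDelta S (fun w : Fin (n + 1) → M => P (w 0) (fun i => w i.succ)))
    (hf : IsDeltaFun S f) : IsDelta S (fun v => P (f v) v) :=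
  h.isDelta_of_sigma_pi (Q := fun y v => y = f v ∧ P y v) (R := fun y v => y = f v → P y v)
    (IsDelta.and hf hP) (IsDelta.imp hf hP) (fun v => by simp) (fun v => by simp)

theorem subst_fun {n : ℕ} {g : M → (Fin n → M) → M} {f : (Fin n → M) → M}
    (hg : IsDeltaFun S (fun w : Fin (n + 1) → M => g (w 0) (fun i => w i.succ)))
    (hf : IsDeltaFun S f) : IsDeltaFun S (fun v => g (f v) v) := by
  have hf' : IsDeltaFun S (fun w : Fin (n + 1) → M => f (fun i => w i.succ)) :=
    hf.rename Fin.succ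
  refine h.subst (P := fun a w => w 0 = g a (fun i => w i.succ)) ?_ hf'
  have : ∀ i, IsPoly ((Fin.cons (fun v => v 1) (Fin.cons (fun v => v 0)
      (fun i v => v i.succ.succ)) : Fin (n + 1 + 1) → (Fin (n + 2) → M) → M) i) :=
    Fin.cases (.var _) (Fin.cases (.var _) fun i => .var _)
  refine (IsDelta.comp_poly hg this).of_iff fun w => ?_
  simp

theorem fun_var {n : ℕ} (i : Fin n) : IsDeltaFun S (fun v : Fin n → M => v i) :=
  (IsPoly.var i).isDeltaFun

theorem fun_const {n : ℕ} (c : M) : IsDeltaFun S (fun _ : Fin n → M => c) :=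
  (IsPoly.const c).isDeltaFun

theorem fun_add {n : ℕ} {f g : (Fin n → M) → M} (hf : IsDeltaFun S f) (hg : IsDeltaFun S g) :
    IsDeltaFun S (fun v => f v + g v) :=
  h.subst_fun (g := fun a v => a + g v)
    (h.subst_fun (g := fun b w => w 0 + b) (IsPoly.add (.var 1) (.var 0)).isDeltaFun
      (hg.rename Fin.succ)) hf

theorem fun_mul {n : ℕ} {f g : (Fin n → M) → M} (hf : IsDeltaFun S f) (hg : IsDeltaFun S g) :
    IsDeltaFun S (fun v => f v * g v) :=
  h.subst_fun (g := fun a v => a * g v)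
    (h.subst_fun (g := fun b w => w 0 * b) (IsPoly.mul (.var 1) (.var 0)).isDeltaFun
      (hg.rename Fin.succ)) hf

theorem fun_pair {n : ℕ} {f g : (Fin n → M) → M} (hf : IsDeltaFun S f) (hg : IsDeltaFun S g) :
    IsDeltaFun S (fun v => pair (f v) (g v)) :=
  h.subst_fun (g := fun a v => pair a (g v))
    (h.subst_fun (g := fun b w => pair (w 0) b) (IsPoly.pair (.var 1) (.var 0)).isDeltaFun
      (hg.rename Fin.succ)) hf

theorem fun_quad {n : ℕ} {f g f' g' : (Fin n → M) → M} (hf : IsDeltaFun S f)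
    (hg : IsDeltaFun S g) (hf' : IsDeltaFun S f') (hg' : IsDeltaFun S g') :
    IsDeltaFun S (fun v => quad (f v) (g v) (f' v) (g' v)) :=
  h.fun_pair hf (h.fun_pair hg (h.fun_pair hf' hg'))

theorem delta_eq {n : ℕ} {f g : (Fin n → M) → M} (hf : IsDeltaFun S f) (hg : IsDeltaFun S g) :
    IsDelta S (fun v => f v = g v) :=
  h.subst (P := fun a v => a = g v) hg hf

theorem delta_lt {n : ℕ} {f g : (Fin n → M) → M} (hf : IsDeltaFun S f) (hg : IsDeltaFun S g) :
    IsDelta S (fun v => f v < g v) :=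
  h.subst (P := fun a v => a < g v)
    (h.subst (P := fun b w => w 0 < b) (IsDelta.lt_poly (.var 1) (.var 0))
      (hg.rename Fin.succ)) hf

theorem delta_le {n : ℕ} {f g : (Fin n → M) → M} (hf : IsDeltaFun S f) (hg : IsDeltaFun S g) :
    IsDelta S (fun v => f v ≤ g v) :=
  (h.delta_lt hg hf).not.of_iff fun _ => not_lt.symm

theorem delta_mem {n : ℕ} {X : Set M} (hX : X ∈ S) {f : (Fin n → M) → M}
    (hf : IsDeltaFun S f) : IsDelta S (fun v => f v ∈ X) :=
  h.subst (P := fun a _ => a ∈ X) (.mem_poly hX (.var 0)) hf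

theorem delta_ball {n : ℕ} {f : (Fin n → M) → M} {P : M → (Fin n → M) → Prop}
    (hf : IsDeltaFun S f)
    (hP : IsDelta S (fun w : Fin (n + 1) → M => P (w 0) (fun i => w i.succ))) :
    IsDelta S (fun v => ∀ a < f v, P a v) := by
  refine h.subst (P := fun b v => ∀ a < b, P a v) (.ball_poly (.var 0) ?_) hf
  exact hP.rename (Fin.cons 0 (fun i => i.succ.succ))

theorem delta_bex {n : ℕ} {f : (Fin n → M) → M} {P : M → (Fin n → M) → Prop}
    (hf : IsDeltaFun S f)
    (hP : IsDelta S (fun w : Fin (n + 1) → M => P (w 0) (fun i => w i.succ))) :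
    IsDelta S (fun v => ∃ a < f v, P a v) :=
  (h.delta_ball (P := fun a v => ¬ P a v) hf hP.not).not.of_iff fun v => by
    push Not; rfl

theorem delta_ball_le {n : ℕ} {f : (Fin n → M) → M} {P : M → (Fin n → M) → Prop}
    (hf : IsDeltaFun S f)
    (hP : IsDelta S (fun w : Fin (n + 1) → M => P (w 0) (fun i => w i.succ))) :
    IsDelta S (fun v => ∀ a ≤ f v, P a v) :=
  (h.delta_ball (h.fun_add hf (h.fun_const 1)) hP).of_iff fun v => by simp [h.lt_add_one_iff]

theorem delta_bex_le {n : ℕ} {f : (Fin n → M) → M} {P : M → (Fin n → M) → Prop}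
    (hf : IsDeltaFun S f)
    (hP : IsDelta S (fun w : Fin (n + 1) → M => P (w 0) (fun i => w i.succ))) :
    IsDelta S (fun v => ∃ a ≤ f v, P a v) :=
  (h.delta_bex (h.fun_add hf (h.fun_const 1)) hP).of_iff fun v => by simp [h.lt_add_one_iff]

theorem comp2 {n : ℕ} {P : M → M → Prop} {f g : (Fin n → M) → M}
    (hP : IsDelta S (fun w : Fin 2 → M => P (w 0) (w 1))) (hf : IsDeltaFun S f)
    (hg : IsDeltaFun S g) : IsDelta S (fun v => P (f v) (g v)) :=
  h.subst (P := fun a v => P a (g v)) (h.subst (P := fun b w => P (w 0) b)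
    (hP.rename ![1, 0]) (hg.rename Fin.succ)) hf

theorem comp3 {n : ℕ} {P : M → M → M → Prop} {f g f' : (Fin n → M) → M}
    (hP : IsDelta S (fun w : Fin 3 → M => P (w 0) (w 1) (w 2))) (hf : IsDeltaFun S f)
    (hg : IsDeltaFun S g) (hf' : IsDeltaFun S f') :
    IsDelta S (fun v => P (f v) (g v) (f' v)) :=
  h.subst (P := fun a v => P a (g v) (f' v)) (h.subst (P := fun b w => P (w 0) b
    (f' fun i => w i.succ)) (h.subst (P := fun c w => P (w 1) (w 0) c)
      (hP.rename ![2, 1, 0]) (hf'.rename fun i => i.succ.succ)) (hg.rename Fin.succ)) hf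

theorem fun_comp1 {n : ℕ} {F : M → M} {f : (Fin n → M) → M}
    (hF : IsDeltaFun S (fun w : Fin 1 → M => F (w 0))) (hf : IsDeltaFun S f) :
    IsDeltaFun S (fun v => F (f v)) :=
  h.subst_fun (g := fun a _ => F a) (hF.rename fun _ => 0) hf

theorem fun_of_graph {n : ℕ} {f : (Fin n → M) → M} {R : M → (Fin n → M) → Prop}
    (hR : IsDelta S (fun w : Fin (n + 1) → M => R (w 0) (fun i => w i.succ)))
    (hf : ∀ a v, a = f v ↔ R a v) : IsDeltaFun S f :=
  IsDelta.of_iff hR fun _ => hf _ _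

theorem setOf_mem {P : M → Prop} (hP : IsDelta S (fun w : Fin 1 → M => P (w 0))) :
    {x | P x} ∈ S :=
  h.comprehension (Q := fun _ x => P x) (R := fun _ x => P x) (hP.rename fun _ => 1)
    (hP.rename fun _ => 1) (fun x => by simp) (fun x => by simp)

/-- The syntax-directed closure rules of the `Δ⁰₁`-definable predicates and functions, as one
rewrite rule set for `simp`. The premises of a rule are discharged by the rules themselves, so the
discharge depth has to exceed the depth of the expression. -/
theorem delta_rules :
    (∀ {n : ℕ} (i : Fin n), IsDeltaFun S (fun v : Fin n → M => v i)) ∧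
    (∀ {n : ℕ} (c : M), IsDeltaFun S (fun _ : Fin n → M => c)) ∧
    (∀ {n : ℕ} {f g : (Fin n → M) → M}, IsDeltaFun S f → IsDeltaFun S g →
      IsDeltaFun S (fun v => f v + g v)) ∧
    (∀ {n : ℕ} {f g : (Fin n → M) → M}, IsDeltaFun S f → IsDeltaFun S g →
      IsDeltaFun S (fun v => f v * g v)) ∧
    (∀ {n : ℕ} {f g : (Fin n → M) → M}, IsDeltaFun S f → IsDeltaFun S g →
      IsDelta S (fun v => f v = g v)) ∧
    (∀ {n : ℕ} {f g : (Fin n → M) → M}, IsDeltaFun S f → IsDeltaFun S g →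
      IsDelta S (fun v => f v < g v)) ∧
    (∀ {n : ℕ} {f g : (Fin n → M) → M}, IsDeltaFun S f → IsDeltaFun S g →
      IsDelta S (fun v => f v ≤ g v)) ∧
    (∀ {n : ℕ} (p : Prop), IsDelta S (fun _ : Fin n → M => p)) ∧
    (∀ {n : ℕ} {P : (Fin n → M) → Prop}, IsDelta S P → IsDelta S (fun v => ¬ P v)) ∧
    (∀ {n : ℕ} {P Q : (Fin n → M) → Prop}, IsDelta S P → IsDelta S Q →
      IsDelta S (fun v => P v ∧ Q v)) ∧
    (∀ {n : ℕ} {P Q : (Fin n → M) → Prop}, IsDelta S P → IsDelta S Q →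
      IsDelta S (fun v => P v ∨ Q v)) ∧
    (∀ {n : ℕ} {P Q : (Fin n → M) → Prop}, IsDelta S P → IsDelta S Q →
      IsDelta S (fun v => P v → Q v)) ∧
    (∀ {n : ℕ} {P Q : (Fin n → M) → Prop}, IsDelta S P → IsDelta S Q →
      IsDelta S (fun v => P v ↔ Q v)) ∧
    (∀ {n : ℕ} {f : (Fin n → M) → M} {P : M → (Fin n → M) → Prop}, IsDeltaFun S f →
      IsDelta S (fun w : Fin (n + 1) → M => P (w 0) (fun i => w i.succ)) →
      IsDelta S (fun v => ∀ a < f v, P a v)) ∧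
    (∀ {n : ℕ} {f : (Fin n → M) → M} {P : M → (Fin n → M) → Prop}, IsDeltaFun S f →
      IsDelta S (fun w : Fin (n + 1) → M => P (w 0) (fun i => w i.succ)) →
      IsDelta S (fun v => ∃ a < f v, P a v)) ∧
    (∀ {n : ℕ} {f : (Fin n → M) → M} {P : M → (Fin n → M) → Prop}, IsDeltaFun S f →
      IsDelta S (fun w : Fin (n + 1) → M => P (w 0) (fun i => w i.succ)) →
      IsDelta S (fun v => ∀ a ≤ f v, P a v)) ∧
    (∀ {n : ℕ} {f : (Fin n → M) → M} {P : M → (Fin n → M) → Prop}, IsDeltaFun S f →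
      IsDelta S (fun w : Fin (n + 1) → M => P (w 0) (fun i => w i.succ)) →
      IsDelta S (fun v => ∃ a ≤ f v, P a v)) :=
  ⟨h.fun_var, h.fun_const, h.fun_add, h.fun_mul, h.delta_eq, h.delta_lt, h.delta_le, .const,
    .not, .and, .or, .imp, .iff, h.delta_ball, h.delta_bex, h.delta_ball_le, h.delta_bex_le⟩

theorem delta_dvd {n : ℕ} {f g : (Fin n → M) → M} (hf : IsDeltaFun S f) (hg : IsDeltaFun S g) :
    IsDelta S (fun v => f v ∣ g v) := by
  have hf' := hf.rename (Fin.succ (n := n))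
  have hg' := hg.rename (Fin.succ (n := n))
  refine (h.delta_bex_le (P := fun a v => g v = f v * a) hg
    (h.delta_eq hg' (h.fun_mul hf' (h.fun_var 0)))).of_iff fun v => ?_
  constructor
  · rintro ⟨a, ha⟩
    rcases eq_or_ne (f v) 0 with h0 | h0
    · exact ⟨0, by simp, by simp [ha, h0]⟩
    · refine ⟨a, ?_, ha⟩
      obtain ⟨b, hb⟩ := h.exists_eq_add_one h0
      rw [ha, hb]
      calc a ≤ b * a + a := le_add_self
        _ = _ := by ring
  · rintro ⟨a, -, ha⟩; exact ⟨a, ha⟩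

/-- The quantifiers in the definition of `codedSet` can be bounded by the code. -/
theorem mem_codedSet_iff {c x : M} : x ∈ codedSet c ↔
    ∃ k ≤ c, ∃ m ≤ c, ∃ n ≤ c, c = pair (pair k m) n ∧ x < k ∧ m * (x + 1) + 1 ∣ n := by
  constructor
  · rintro ⟨k, m, n, hc, hx, hd⟩
    have h1 : pair k m ≤ c := hc ▸ le_pair_left _ _
    exact ⟨k, (le_pair_left k m).trans h1, m, (h.le_pair_right k m).trans h1, n,
      hc ▸ h.le_pair_right _ _, hc, hx, hd⟩
  · rintro ⟨k, -, m, -, n, -, H⟩; exact ⟨k, m, n, H⟩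

theorem lt_of_mem_codedSet {c x : M} (hx : x ∈ codedSet c) : x < c := by
  obtain ⟨k, hk, m, -, n, -, -, hx, -⟩ := h.mem_codedSet_iff.1 hx
  exact hx.trans_le hk

theorem delta_mem_codedSet {n : ℕ} {f g : (Fin n → M) → M} (hf : IsDeltaFun S f)
    (hg : IsDeltaFun S g) : IsDelta S (fun v => f v ∈ codedSet (g v)) := by
  suffices IsDelta S (fun v : Fin 2 → M => v 0 ∈ codedSet (v 1)) from
    h.comp2 (P := fun x c => x ∈ codedSet c) this hf hg
  simp only [h.mem_codedSet_iff]
  simp (maxDischargeDepth := 99) only [h.delta_rules, h.delta_dvd, h.fun_pair]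

/-- Two universal number quantifiers are contracted to one, by way of a common bound. -/
theorem pi_forall {n : ℕ} {P : M → (Fin n → M) → Prop}
    (hP : IsPi S (fun w : Fin (n + 1) → M => P (w 0) (fun i => w i.succ))) :
    IsPi S (fun v => ∀ a, P a v) := by
  obtain ⟨Q, hQ, hPQ⟩ := hP
  refine ⟨fun z v => ∀ a ≤ z, ∀ y ≤ z, Q y (Matrix.vecCons a v), ?_, fun v => ?_⟩
  · refine h.delta_ball_le (h.fun_var 0) (h.delta_ball_le (h.fun_var 1) ?_)
    have : ∀ i, IsPoly ((Fin.cons (fun v => v 0) (Fin.cons (fun v => v 1)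
      (fun i v => v i.succ.succ.succ)) : Fin (n + 1 + 1) → (Fin (n + 3) → M) → M) i) :=
      Fin.cases (.var _) (Fin.cases (.var _) fun i => .var _)
    refine (IsDelta.comp_poly hQ this).of_iff fun w => ?_
    simp only [Fin.cons_zero, Fin.cons_succ]
    have : (Matrix.vecCons (w 1) fun i => w i.succ.succ.succ : Fin (n + 1) → M) =
        fun i => (Fin.cons (fun v => v 1) (fun i v => v i.succ.succ.succ) :
          Fin (n + 1) → (Fin (n + 3) → M) → M) i w := by
      funext i; refine Fin.cases ?_ (fun j => ?_) i <;> simp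
    rw [← this]; rfl
  · have key : ∀ a, P a v ↔ ∀ y, Q y (Matrix.vecCons a v) := fun a => by
      have := hPQ (Matrix.vecCons a v)
      simpa using this
    simp only [key]
    exact ⟨fun H z a _ y _ => H a y,
      fun H a y => H (max a y) a (le_max_left _ _) y (le_max_right _ _)⟩

theorem pi_imp {n : ℕ} {P Q : (Fin n → M) → Prop} (hP : IsDelta S P) (hQ : IsPi S Q) :
    IsPi S (fun v => P v → Q v) := by
  obtain ⟨Q', hQ', hQQ⟩ := hQ
  exact ⟨fun y v => P v → Q' y v, (hP.rename Fin.succ).imp hQ', fun v => by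
    simp only [hQQ]; exact ⟨fun H y hp => H hp y, fun H hp y => H y hp⟩⟩

end IsModelRCA0

end Closure

/-! ### Coding of bounded sets, choice and recursion -/

section Coding

variable {M : Type*} [CommSemiring M] [LinearOrder M] {S : Set (Set M)}
  [IsStrictOrderedRing M] [CanonicallyOrderedAdd M]

theorem dvd_right_of_dvd_add {p a b : M} (hab : p ∣ a + b) (ha : p ∣ a) : p ∣ b := by
  obtain ⟨s, rfl⟩ := ha
  obtain ⟨t, ht⟩ := hab
  rcases le_total s t with hst | hst
  · obtain ⟨r, rfl⟩ := exists_add_of_le hst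
    exact ⟨r, by rw [mul_add] at ht; exact add_left_cancel ht⟩
  · have : p * s + b ≤ p * s + 0 := by rw [ht, add_zero]; gcongr
    have : b = 0 := by simpa using le_of_add_le_add_left this
    rw [this]; exact dvd_zero p

/-- The moduli `m(x+1)+1` and `m(j+1)+1` of Gödel's coding are coprime when the distance of `x`
and `j` divides `m`. -/
theorem dvd_of_dvd_mul_modulus {m x j i n : M} (hi : i ∣ m) (hij : j = x + i ∨ x = j + i)
    (hd : m * (x + 1) + 1 ∣ n * (m * (j + 1) + 1)) : m * (x + 1) + 1 ∣ n := by
  obtain ⟨e, he⟩ := hi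
  have h1 : m * (x + 1) + 1 ∣ n * m * i := by
    rcases hij with rfl | rfl
    · refine dvd_right_of_dvd_add (a := n * (m * (x + 1) + 1)) ?_ (dvd_mul_left _ _)
      convert hd using 1; ring
    · refine dvd_right_of_dvd_add (a := n * (m * (j + 1) + 1)) ?_ hd
      convert dvd_mul_left (m * (j + i + 1) + 1) n using 1; ring
  have h2 : m * (x + 1) + 1 ∣ n * (m * (x + 1)) ^ 2 := by
    have : n * (m * (x + 1)) ^ 2 = n * m * i * (e * (x + 1) ^ 2) := by
      calc n * (m * (x + 1)) ^ 2 = n * m * m * (x + 1) ^ 2 := by ring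
        _ = n * m * (i * e) * (x + 1) ^ 2 := by rw [← he]
        _ = _ := by ring
    rw [this]; exact h1.mul_right _
  -- with `p = t + 1` one has `n t² + n p = n t p + n`
  refine dvd_right_of_dvd_add (a := n * (m * (x + 1)) * (m * (x + 1) + 1)) ?_ (dvd_mul_left _ _)
  have : n * (m * (x + 1)) * (m * (x + 1) + 1) + n =
      n * (m * (x + 1)) ^ 2 + n * (m * (x + 1) + 1) := by ring
  rw [this]; exact dvd_add h2 (dvd_mul_left _ _)

namespace IsModelRCA0

variable (h : IsModelRCA0 S)
include h

theorem le_of_dvd {p n : M} (hn : n ≠ 0) (hp : p ∣ n) : p ≤ n := by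
  obtain ⟨c, rfl⟩ := hp
  have hc : c ≠ 0 := by rintro rfl; simp at hn
  obtain ⟨b, rfl⟩ := h.exists_eq_add_one hc
  calc p ≤ p * b + p := le_add_self
    _ = _ := by ring

theorem exists_common_multiple (k : M) : ∃ m, m ≠ 0 ∧ ∀ i ≤ k, i ≠ 0 → i ∣ m := by
  refine h.sigma_induction (P := fun m k => m ≠ 0 ∧ ∀ i ≤ k, i ≠ 0 → i ∣ m) ?_ ?_ ?_ k
  · simp (maxDischargeDepth := 99) only [h.delta_rules, h.delta_dvd, ne_eq]
  · exact ⟨1, one_ne_zero, fun i hi hi0 => absurd (by simpa using hi) hi0⟩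
  · rintro x ⟨m, hm, H⟩
    refine ⟨m * (x + 1), ?_, fun i hi hi0 => ?_⟩
    · exact mul_ne_zero hm (succ_ne_zero _)
    · rcases hi.lt_or_eq with hi | rfl
      · exact (H i (h.lt_add_one_iff.1 hi) hi0).mul_right _
      · exact dvd_mul_left _ _

/-- Bounded comprehension: every bounded part of a set of the model is coded. -/
theorem exists_code {A : Set M} (hA : A ∈ S) (k : M) :
    ∃ c, codedSet c = {x | x < k ∧ x ∈ A} := by
  obtain ⟨m, hm, hdvd⟩ := h.exists_common_multiple k
  have hdiff : ∀ x j, x < k → j < k → x ≠ j → ∃ i, i ∣ m ∧ (j = x + i ∨ x = j + i) := by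
    intro x j hx hj hxj
    rcases hxj.lt_or_gt with hlt | hlt
    · obtain ⟨i, rfl⟩ := exists_add_of_le hlt.le
      refine ⟨i, hdvd i (le_add_self.trans hj.le) ?_, .inl rfl⟩
      rintro rfl; simp at hlt
    · obtain ⟨i, rfl⟩ := exists_add_of_le hlt.le
      refine ⟨i, hdvd i (le_add_self.trans hx.le) ?_, .inr rfl⟩
      rintro rfl; simp at hlt
  -- `n` is the product of the moduli of the elements of `A` below `j`
  have key : ∀ j, ∃ n, ∀ x < k, m * (x + 1) + 1 ∣ n ↔ x < j ∧ x ∈ A := by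
    refine h.sigma_induction ?_ ⟨1, fun x _ => ?_⟩ ?_
    · simp (maxDischargeDepth := 99) only [h.delta_rules, h.delta_dvd, h.delta_mem hA]
    · simp only [not_lt_zero, false_and, iff_false]
      intro hd
      have h1 := h.le_of_dvd one_ne_zero hd
      have : m * (x + 1) ≠ 0 := mul_ne_zero hm (succ_ne_zero _)
      exact absurd h1 (not_le.2 (lt_add_of_pos_left _ (pos_iff_ne_zero.2 this)))
    · rintro j ⟨n, hn⟩
      by_cases hj : j ∈ A ∧ j < k
      · refine ⟨n * (m * (j + 1) + 1), fun x hx => ?_⟩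
        rcases eq_or_ne x j with rfl | hxj
        · simp [hj.1]
        · obtain ⟨i, hi, hij⟩ := hdiff x j hx hj.2 hxj
          have : x < j + 1 ↔ x < j := by
            rw [h.lt_add_one_iff]; exact ⟨fun hle => lt_of_le_of_ne hle hxj, le_of_lt⟩
          rw [this, ← hn x hx]
          exact ⟨dvd_of_dvd_mul_modulus hi hij, fun hd => hd.mul_right _⟩
      · refine ⟨n, fun x hx => ?_⟩
        rw [hn x hx, h.lt_add_one_iff]
        constructor
        · exact fun H => ⟨H.1.le, H.2⟩
        · rintro ⟨h1, h2⟩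
          exact ⟨lt_of_le_of_ne h1 (by rintro rfl; exact hj ⟨h2, hx⟩), h2⟩
  obtain ⟨n, hn⟩ := key k
  refine ⟨pair (pair k m) n, ?_⟩
  ext x
  constructor
  · rintro ⟨k', m', n', hc, hx, hd⟩
    obtain ⟨hkm, rfl⟩ := h.pair_inj.1 hc
    obtain ⟨rfl, rfl⟩ := h.pair_inj.1 hkm
    exact (hn x hx).1 hd
  · intro hx
    exact ⟨k, m, n, rfl, hx.1, (hn x hx.1).2 hx⟩

theorem codedSet_mem (c : M) : codedSet c ∈ S :=
  h.setOf_mem (h.delta_mem_codedSet (h.fun_var 0) (h.fun_const c))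

theorem exists_code_of {P : M → Prop} (hP : IsDelta S (fun w : Fin 1 → M => P (w 0))) (k : M) :
    ∃ c, codedSet c = {x | x < k ∧ P x} :=
  h.exists_code (h.setOf_mem hP) k

theorem delta_code_eq {n : ℕ} {f g : (Fin n → M) → M} {P : M → (Fin n → M) → Prop}
    (hf : IsDeltaFun S f) (hg : IsDeltaFun S g)
    (hP : IsDelta S (fun w : Fin (n + 1) → M => P (w 0) (fun i => w i.succ))) :
    IsDelta S (fun v => codedSet (f v) = {x | x < g v ∧ P x v}) := by
  have hf' := hf.rename (Fin.succ (n := n))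
  have hg' := hg.rename (Fin.succ (n := n))
  have : IsDelta S (fun v => ∀ x < f v + g v, x ∈ codedSet (f v) ↔ x < g v ∧ P x v) := by
    simp (maxDischargeDepth := 99) only [h.delta_rules, h.delta_mem_codedSet, hf, hg, hP, hf', hg']
  refine this.of_iff fun v => ?_
  rw [Set.ext_iff]
  constructor
  · exact fun H x _ => H x
  · intro H x
    by_cases hx : x < f v + g v
    · exact H x hx
    · constructor
      · exact fun hxf => absurd ((h.lt_of_mem_codedSet hxf).trans_le le_self_add) hx
      · exact fun hxg => absurd (hxg.1.trans_le le_add_self) hx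

theorem isInternalFun_iff {f : M → M} :
    IsInternalFun S f ↔ IsDeltaFun S (fun w : Fin 1 → M => f (w 0)) := by
  constructor
  · intro hf
    refine h.fun_of_graph (R := fun y w => pair (w 0) y ∈ {c | ∃ x, c = pair x (f x)}) ?_ ?_
    · exact h.delta_mem hf (h.fun_pair (h.fun_var _) (h.fun_var _))
    · intro a v
      constructor
      · rintro rfl; exact ⟨v 0, rfl⟩
      · rintro ⟨x, hx⟩
        obtain ⟨h1, rfl⟩ := h.pair_inj.1 hx
        rw [h1]
  · intro hf
    have : {c | ∃ x, c = pair x (f x)} = {c | ∃ x ≤ c, c = pair x (f x)} := by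
      ext c
      exact ⟨fun ⟨x, hx⟩ => ⟨x, hx ▸ le_pair_left _ _, hx⟩, fun ⟨x, _, hx⟩ => ⟨x, hx⟩⟩
    unfold IsInternalFun
    rw [this]
    refine h.setOf_mem ?_
    simp (maxDischargeDepth := 99) only [h.delta_rules, h.fun_pair, h.fun_comp1 hf]

/-- Choice for `Δ⁰₁` relations: the least witnesses form a function of the model. -/
theorem exists_choice {R : M → M → Prop}
    (hR : ∀ {n : ℕ} {f g : (Fin n → M) → M}, IsDeltaFun S f → IsDeltaFun S g →
      IsDelta S (fun v => R (f v) (g v)))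
    {k : M} (hex : ∀ i < k, ∃ c, R i c) :
    ∃ f : M → M, IsInternalFun S f ∧ ∀ i < k, R i (f i) := by
  have hleast : ∀ i, ∃ c, (i < k ∧ R i c ∧ ∀ c' < c, ¬ R i c') ∨ (¬ i < k ∧ c = 0) := by
    intro i
    by_cases hi : i < k
    · obtain ⟨c, hc⟩ := h.exists_least (P := R i) (hR (h.fun_const _) (h.fun_var _)) (hex i hi)
      exact ⟨c, .inl ⟨hi, hc⟩⟩
    · exact ⟨0, .inr ⟨hi, rfl⟩⟩
  choose f hf using hleast
  refine ⟨f, h.isInternalFun_iff.2 (h.fun_of_graph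
    (R := fun c w => (w 0 < k ∧ R (w 0) c ∧ ∀ c' < c, ¬ R (w 0) c') ∨ (¬ w 0 < k ∧ c = 0))
    ?_ ?_), fun i hi => ?_⟩
  · simp (maxDischargeDepth := 99) only [h.delta_rules, hR]
  · intro a v
    constructor
    · rintro rfl; exact hf _
    · intro ha
      rcases ha with ⟨h1, h2, h3⟩ | ⟨h1, h2⟩ <;> rcases hf (v 0) with ⟨h1', h2', h3'⟩ | ⟨h1', h2'⟩
      · rcases lt_trichotomy a (f (v 0)) with hlt | heq | hlt
        · exact absurd h2 (h3' _ hlt)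
        · exact heq
        · exact absurd h2' (h3 _ hlt)
      · exact absurd h1 h1'
      · exact absurd h1' h1
      · rw [h2, h2']
  · rcases hf i with ⟨_, h2, _⟩ | ⟨h1, _⟩
    · exact h2
    · exact absurd hi h1

/-- Course-of-values recursion for sets: a `Δ⁰₁` operator `Φ` such that `Φ A y` depends only on
`A ∩ [0, y)` has a fixed point in the model. -/
theorem exists_recursion {Φ : Set M → M → Prop}
    (hΦ : IsDelta S (fun w : Fin 2 → M => Φ (codedSet (w 0)) (w 1)))
    (hloc : ∀ A B y, (∀ x < y, x ∈ A ↔ x ∈ B) → (Φ A y ↔ Φ B y)) :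
    ∃ Y ∈ S, ∀ y, y ∈ Y ↔ Φ Y y := by
  have hΦ' : ∀ {n : ℕ} {f g : (Fin n → M) → M}, IsDeltaFun S f → IsDeltaFun S g →
      IsDelta S (fun v => Φ (codedSet (f v)) (g v)) := fun hf hg =>
    h.comp2 (P := fun c y => Φ (codedSet c) y) hΦ hf hg
  -- `c` codes the fixed point below `w`; the set is read off from these approximations
  let good : M → M → Prop := fun c w => ∀ y < w, y ∈ codedSet c ↔ Φ (codedSet c) y
  have hgood : ∀ w, ∃ c, good c w := by
    refine h.sigma_induction ?_ ⟨0, fun y hy => absurd hy (by simp)⟩ ?_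
    · simp (maxDischargeDepth := 99) only [h.delta_rules, h.delta_mem_codedSet, hΦ', good]
    · rintro w ⟨c, hc⟩
      obtain ⟨c', hc'⟩ := h.exists_code_of
        (P := fun x => (x < w ∧ x ∈ codedSet c) ∨ (x = w ∧ Φ (codedSet c) w)) (by
          simp (maxDischargeDepth := 99) only [h.delta_rules, h.delta_mem_codedSet]) (w + 1)
      have hlow : ∀ x < w, x ∈ codedSet c' ↔ x ∈ codedSet c := by
        intro x hx
        rw [hc']
        constructor
        · rintro ⟨-, ⟨-, h1⟩ | ⟨rfl, -⟩⟩
          · exact h1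
          · exact absurd hx (lt_irrefl _)
        · exact fun h1 => ⟨hx.trans (lt_add_one w), .inl ⟨hx, h1⟩⟩
      refine ⟨c', fun y hy => ?_⟩
      rcases (h.lt_add_one_iff.1 hy).lt_or_eq with hy | rfl
      · rw [hlow y hy, hc y hy]
        exact hloc _ _ _ fun x hx => (hlow x (hx.trans hy)).symm
      · rw [hloc _ _ _ hlow, hc']
        constructor
        · rintro ⟨-, ⟨h1, -⟩ | ⟨-, h1⟩⟩
          · exact absurd h1 (lt_irrefl _)
          · exact h1
        · exact fun h1 => ⟨lt_add_one y, .inr ⟨rfl, h1⟩⟩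
  have huniq : ∀ c c' w w', good c w → good c' w' → ∀ y, y < w → y < w' →
      (y ∈ codedSet c ↔ y ∈ codedSet c') := by
    intro c c' w w' hc hc'
    by_contra! hne
    obtain ⟨y, ⟨hy, hy', hne⟩, hmin⟩ := h.exists_least
      (P := fun y => y < w ∧ y < w' ∧ ¬ (y ∈ codedSet c ↔ y ∈ codedSet c')) (by
        simp (maxDischargeDepth := 99) only [h.delta_rules, h.delta_mem_codedSet])
      (by obtain ⟨y, h1, h2, h3⟩ := hne; exact ⟨y, h1, h2, by tauto⟩)
    refine hne ?_
    rw [hc y hy, hc' y hy']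
    refine hloc _ _ _ fun x hx => ?_
    by_contra hx'
    exact hmin x hx ⟨hx.trans hy, hx.trans hy', hx'⟩
  refine ⟨{y | ∃ c, good c (y + 1) ∧ y ∈ codedSet c}, ?_, ?_⟩
  · refine h.comprehension (Q := fun c y => good c (y + 1) ∧ y ∈ codedSet c)
      (R := fun c y => good c (y + 1) → y ∈ codedSet c) ?_ ?_ (fun y => Iff.rfl) ?_
    · simp (maxDischargeDepth := 99) only [h.delta_rules, h.delta_mem_codedSet, hΦ', good]
    · simp (maxDischargeDepth := 99) only [h.delta_rules, h.delta_mem_codedSet, hΦ', good]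
    · intro y
      constructor
      · rintro ⟨c, hc, hy⟩ c' hc'
        exact (huniq c c' _ _ hc hc' y (lt_add_one y) (lt_add_one y)).1 hy
      · intro H
        obtain ⟨c, hc⟩ := hgood (y + 1)
        exact ⟨c, hc, H c hc⟩
  · have hY : ∀ c w, good c w → ∀ y < w,
        (y ∈ codedSet c ↔ y ∈ {y | ∃ c, good c (y + 1) ∧ y ∈ codedSet c}) := by
      intro c w hc y hy
      constructor
      · intro hyc
        exact ⟨c, fun z hz => hc z ((h.lt_add_one_iff.1 hz).trans_lt hy), hyc⟩
      · rintro ⟨c', hc', hyc⟩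
        exact (huniq c c' _ _ hc hc' y hy (lt_add_one y)).2 hyc
    intro y
    obtain ⟨c, hc⟩ := hgood (y + 1)
    rw [← hY c _ hc y (lt_add_one y), hc y (lt_add_one y)]
    exact hloc _ _ _ fun x hx => hY c _ hc x (hx.trans (lt_add_one y))

end IsModelRCA0

end Coding

/-! ### The recursion for chains of apart sets -/

section ChainTable

variable {M : Type*} [CommSemiring M] [LinearOrder M] {S : Set (Set M)}
  [IsStrictOrderedRing M] [CanonicallyOrderedAdd M] {Θ : M → M → M → Prop}

/-- The condition under which a finite set with minimum `b` and maximum `y` is `Θ`-apart from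
the finite sets before it with maximum `w`. -/
def ApartAt (Θ : M → M → M → Prop) (w b y : M) : Prop :=
  ∀ x < w, ∃ u < b, ∀ z < y, Θ x u z

/-- The number with the digits `n, d, j, k, b, e` in base `B`, paired with `c` and `B`. For fixed `B`
and `c` it is monotone in the lexicographic order, so that a recursion on `n`, then on `d`, then
on `j` becomes a course-of-values recursion on the index. -/
def chainIndex (B c n d j k b e : M) : M :=
  pair (((((n * B + d) * B + j) * B + k) * B + b) * B + e) (pair c B)

/-- Membership of `F ∩ [b, e)` in `Lₙ · (k, …, k)` (`d` times `k`), expressed by the relation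
`σ n d j k b e`, which says that `F ∩ [b, e)` has `j` pairwise apart subsets in
`Lₙ · (k, …, k)`. -/
def LargeBy (σ : M → M → M → M → M → M → Prop) (F : Set M) (n d k b e : M) : Prop :=
  (d = 0 ∧ n = 0 ∧ ∃ x < e, b ≤ x ∧ x ∈ F) ∨
  (d = 0 ∧ ∃ n' < n, n = n' + 1 ∧ ∃ a < e, b ≤ a ∧ a ∈ F ∧ (∀ x < a, x ∈ F → x < b) ∧
    σ n' n' a a (a + 1) e) ∨
  ∃ d' < d, d = d' + 1 ∧ σ n d' k k b e

/-- One step of the recursion for chains: the last member of a chain of length `j` can be taken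
to be an interval `F ∩ [b', y]` with `b', y ∈ F`, and the remaining ones lie below some
`w ∈ F`. -/
def ChainBy (Θ : M → M → M → Prop) (σ : M → M → M → M → M → M → Prop) (F : Set M)
    (n d j k b e : M) : Prop :=
  j = 0 ∨ ∃ j' < j, j = j' + 1 ∧ ∃ y < e, ∃ b' ≤ y, b ≤ b' ∧ b' ∈ F ∧ y ∈ F ∧
    LargeBy σ F n d k b' (y + 1) ∧
    (j' = 0 ∨ ∃ w < b', w ∈ F ∧ ApartAt Θ w b' y ∧ σ n d j' k b (w + 1))

/-- The relation `σ` coded by a set `Y` for the finite set with code `c`, for arguments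
below `B`. -/
abbrev chainRel (Y : Set M) (B c n d j k b e : M) : Prop := chainIndex B c n d j k b e ∈ Y

/-- The arguments of the chain relation are below the base `B`. -/
structure IsDigits (B n d j k b e : M) : Prop where
  n_lt : n < B
  d_lt : d < B
  j_lt : j < B
  k_lt : k < B
  b_lt : b < B
  e_lt : e < B

/-- `Y` satisfies the recursion equations for chains. -/
def IsChainTable (Θ : M → M → M → Prop) (Y : Set M) : Prop :=
  ∀ B c n d j k b e : M, IsDigits B n d j k b e →
    (chainRel Y B c n d j k b e ↔ ChainBy Θ (chainRel Y B c) (codedSet c) n d j k b e)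

namespace IsModelRCA0

variable (h : IsModelRCA0 S)
include h

theorem horner_lt {B q q' r r' : M} (hq : q < q') (hr : r < B) : q * B + r < q' * B + r' :=
  calc q * B + r < q * B + B := by gcongr
    _ = (q + 1) * B := by ring
    _ ≤ q' * B := by gcongr; exact h.discrete _ _ hq
    _ ≤ _ := le_self_add

theorem horner_inj {B q q' r r' : M} (hr : r < B) (hr' : r' < B)
    (heq : q * B + r = q' * B + r') : q = q' ∧ r = r' := by
  rcases lt_trichotomy q q' with hq | rfl | hq
  · exact absurd heq (h.horner_lt hq hr).ne
  · exact ⟨rfl, add_left_cancel heq⟩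
  · exact absurd heq (h.horner_lt hq hr').ne'

theorem chainIndex_inj {B c n d j k b e B' c' n' d' j' k' b' e' : M}
    (hx : IsDigits B n d j k b e) (hx' : IsDigits B' n' d' j' k' b' e')
    (heq : chainIndex B c n d j k b e = chainIndex B' c' n' d' j' k' b' e') :
    B = B' ∧ c = c' ∧ n = n' ∧ d = d' ∧ j = j' ∧ k = k' ∧ b = b' ∧ e = e' := by
  obtain ⟨h1, h2⟩ := h.pair_inj.1 heq
  obtain ⟨rfl, rfl⟩ := h.pair_inj.1 h2
  obtain ⟨h3, rfl⟩ := h.horner_inj hx.e_lt hx'.e_lt h1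
  obtain ⟨h4, rfl⟩ := h.horner_inj hx.b_lt hx'.b_lt h3
  obtain ⟨h5, rfl⟩ := h.horner_inj hx.k_lt hx'.k_lt h4
  obtain ⟨h6, rfl⟩ := h.horner_inj hx.j_lt hx'.j_lt h5
  obtain ⟨rfl, rfl⟩ := h.horner_inj hx.d_lt hx'.d_lt h6
  exact ⟨rfl, rfl, rfl, rfl, rfl, rfl, rfl, rfl⟩

theorem chainIndex_lt {B c n d j k b e n' d' j' k' b' e' : M}
    (hx : IsDigits B n' d' j' k' b' e')
    (hlt : n' < n ∨ n' = n ∧ (d' < d ∨ d' = d ∧ j' < j)) :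
    chainIndex B c n' d' j' k' b' e' < chainIndex B c n d j k b e := by
  refine pair_lt_pair_left (h.horner_lt (h.horner_lt (h.horner_lt ?_ hx.k_lt) hx.b_lt) hx.e_lt)
  rcases hlt with h1 | ⟨rfl, h1 | ⟨rfl, h1⟩⟩
  · exact h.horner_lt (h.horner_lt h1 hx.d_lt) hx.j_lt
  · exact h.horner_lt (by gcongr) hx.j_lt
  · gcongr

variable (hΘ : ∀ {n : ℕ} {f g k : (Fin n → M) → M}, IsDeltaFun S f → IsDeltaFun S g →
  IsDeltaFun S k → IsDelta S (fun v => Θ (f v) (g v) (k v)))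

omit h in
theorem largeBy_congr {σ τ : M → M → M → M → M → M → Prop} {F : Set M} {n d k b e : M}
    (h1 : ∀ n' a, n = n' + 1 → a < e → (σ n' n' a a (a + 1) e ↔ τ n' n' a a (a + 1) e))
    (h2 : ∀ d', d = d' + 1 → (σ n d' k k b e ↔ τ n d' k k b e)) :
    LargeBy σ F n d k b e ↔ LargeBy τ F n d k b e := by
  unfold LargeBy
  refine or_congr Iff.rfl (or_congr (and_congr_right fun _ => exists_congr fun n' =>
    and_congr_right fun _ => and_congr_right fun hn => exists_congr fun a =>
    and_congr_right fun ha => and_congr_right fun _ => and_congr_right fun _ =>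
    and_congr_right fun _ => h1 n' a hn ha) ?_)
  exact exists_congr fun d' => and_congr_right fun _ => and_congr_right fun hd => h2 d' hd

theorem chainBy_congr {σ τ : M → M → M → M → M → M → Prop} {F : Set M} {B n d j k b e : M}
    (hx : IsDigits B n d j k b e)
    (hστ : ∀ n' d' j' k' b' e', IsDigits B n' d' j' k' b' e' →
      (n' < n ∨ n' = n ∧ (d' < d ∨ d' = d ∧ j' < j)) →
      (σ n' d' j' k' b' e' ↔ τ n' d' j' k' b' e')) :
    ChainBy Θ σ F n d j k b e ↔ ChainBy Θ τ F n d j k b e := by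
  unfold ChainBy
  refine or_congr Iff.rfl (exists_congr fun j' => and_congr_right fun hj' =>
    and_congr_right fun _ => exists_congr fun y => and_congr_right fun hy =>
    exists_congr fun b' => and_congr_right fun hb' => and_congr_right fun _ =>
    and_congr_right fun _ => and_congr_right fun _ => and_congr ?_ ?_)
  · have hyB : y + 1 < B := (h.discrete _ _ hy).trans_lt hx.e_lt
    refine largeBy_congr (fun n' a hn ha => ?_) (fun d' hd => ?_)
    · have hn' : n' < n := hn ▸ lt_add_one n'
      have haB : a + 1 < B := (h.discrete _ _ ha).trans_lt hyB
      have haB' : a < B := (lt_add_one a).trans haB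
      exact hστ _ _ _ _ _ _ ⟨hn'.trans hx.n_lt, hn'.trans hx.n_lt, haB', haB', haB, hyB⟩ (.inl hn')
    · have hd' : d' < d := hd ▸ lt_add_one d'
      exact hστ _ _ _ _ _ _ ⟨hx.n_lt, hd'.trans hx.d_lt, hx.k_lt, hx.k_lt,
        (hb'.trans (le_self_add)).trans_lt hyB, hyB⟩ (.inr ⟨rfl, .inl hd'⟩)
  · refine or_congr Iff.rfl (exists_congr fun w => and_congr_right fun hw =>
      and_congr_right fun _ => and_congr_right fun _ => ?_)
    exact hστ _ _ _ _ _ _ ⟨hx.n_lt, hx.d_lt, hj'.trans hx.j_lt, hx.k_lt, hx.b_lt,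
      ((h.discrete _ _ hw).trans (hb'.trans hy.le)).trans_lt hx.e_lt⟩ (.inr ⟨rfl, .inr ⟨rfl, hj'⟩⟩)

theorem fun_chainIndex {n : ℕ} {f₁ f₂ f₃ f₄ f₅ f₆ f₇ f₈ : (Fin n → M) → M}
    (h₁ : IsDeltaFun S f₁) (h₂ : IsDeltaFun S f₂) (h₃ : IsDeltaFun S f₃) (h₄ : IsDeltaFun S f₄)
    (h₅ : IsDeltaFun S f₅) (h₆ : IsDeltaFun S f₆) (h₇ : IsDeltaFun S f₇)
    (h₈ : IsDeltaFun S f₈) : IsDeltaFun S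
      (fun v => chainIndex (f₁ v) (f₂ v) (f₃ v) (f₄ v) (f₅ v) (f₆ v) (f₇ v) (f₈ v)) := by
  unfold chainIndex
  simp (maxDischargeDepth := 99) only [h.delta_rules, h.fun_pair, h₁, h₂, h₃, h₄, h₅, h₆, h₇, h₈]

include hΘ in
theorem delta_apartAt {n : ℕ} {f g k : (Fin n → M) → M} (hf : IsDeltaFun S f)
    (hg : IsDeltaFun S g) (hk : IsDeltaFun S k) :
    IsDelta S (fun v => ApartAt Θ (f v) (g v) (k v)) := by
  refine h.comp3 (P := fun w b y => ApartAt Θ w b y) ?_ hf hg hk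
  unfold ApartAt
  simp (maxDischargeDepth := 99) only [h.delta_rules, hΘ]

include hΘ in
theorem exists_chainTable : ∃ Y ∈ S, IsChainTable Θ Y := by
  have hA := fun {n : ℕ} {f g k : (Fin n → M) → M} => h.delta_apartAt hΘ (f := f) (g := g) (k := k)
  let Φ : Set M → M → Prop := fun A q => ∃ B ≤ q, ∃ c ≤ q,
    ∃ n < B, ∃ d < B, ∃ j < B, ∃ k < B, ∃ b < B, ∃ e < B,
      q = chainIndex B c n d j k b e ∧ ChainBy Θ (chainRel A B c) (codedSet c) n d j k b e
  have hdef : IsDelta S (fun w : Fin 2 → M => Φ (codedSet (w 0)) (w 1)) := by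
    unfold Φ ChainBy LargeBy chainRel
    simp (maxDischargeDepth := 99) only [h.delta_rules, h.delta_mem_codedSet, h.fun_chainIndex, hA]
  have hloc : ∀ A B y, (∀ x < y, x ∈ A ↔ x ∈ B) → (Φ A y ↔ Φ B y) := by
    intro A A' q hAA
    refine exists_congr fun B => and_congr_right fun _ => exists_congr fun c =>
      and_congr_right fun _ => exists_congr fun n => and_congr_right fun hn =>
      exists_congr fun d => and_congr_right fun hd => exists_congr fun j =>
      and_congr_right fun hj => exists_congr fun k => and_congr_right fun hk =>
      exists_congr fun b => and_congr_right fun hb => exists_congr fun e =>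
      and_congr_right fun he => and_congr_right fun hq => ?_
    refine h.chainBy_congr ⟨hn, hd, hj, hk, hb, he⟩ fun n' d' j' k' b' e' hx hlt => ?_
    exact hAA _ (hq ▸ h.chainIndex_lt hx hlt)
  obtain ⟨Y, hYS, hY⟩ := h.exists_recursion hdef hloc
  refine ⟨Y, hYS, fun B c n d j k b e hx => ?_⟩
  unfold chainRel
  rw [hY]
  constructor
  · rintro ⟨B', -, c', -, n', hn, d', hd, j', hj, k', hk, b', hb, e', he, heq, H⟩
    obtain ⟨rfl, rfl, rfl, rfl, rfl, rfl, rfl, rfl⟩ :=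
      h.chainIndex_inj hx ⟨hn, hd, hj, hk, hb, he⟩ heq
    exact H
  · intro H
    have h1 : pair c B ≤ chainIndex B c n d j k b e := h.le_pair_right _ _
    exact ⟨B, (h.le_pair_right _ _).trans h1, c, (le_pair_left _ _).trans h1, n, hx.n_lt,
      d, hx.d_lt, j, hx.j_lt, k, hx.k_lt, b, hx.b_lt, e, hx.e_lt, rfl, H⟩

end IsModelRCA0

end ChainTable

/-! ### Monotonicity of the chain table -/

section Monotone

variable {M : Type*} [CommSemiring M] [LinearOrder M] {S : Set (Set M)}
  [IsStrictOrderedRing M] [CanonicallyOrderedAdd M] {Θ : M → M → M → Prop}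

/-- Monotonicity of chains of length `j` in `Lₙ · (k, …, k)`: they stay when the finite set is
enlarged and when `j` and `k` are made smaller. -/
def ChainMono (Y : Set M) (n d j : M) : Prop :=
  ∀ B c k b e B' c' i k' b' e' : M, IsDigits B n d j k b e → IsDigits B' n d i k' b' e' →
    i ≤ j → k' ≤ k →
    (∀ x < e, b ≤ x → x ∈ codedSet c → b' ≤ x ∧ x < e' ∧ x ∈ codedSet c') →
    chainRel Y B c n d j k b e → chainRel Y B' c' n d i k' b' e'

namespace IsModelRCA0

variable (h : IsModelRCA0 S)
include h

theorem exists_greatest {c : M} (hc : (codedSet c).Nonempty) :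
    ∃ y ∈ codedSet c, ∀ x ∈ codedSet c, x ≤ y := by
  obtain ⟨e, he, hmin⟩ := h.exists_least (P := fun e => ∀ x < c, x ∈ codedSet c → x < e)
    (by simp (maxDischargeDepth := 99) only [h.delta_rules, h.delta_mem_codedSet])
    ⟨c, fun x hx _ => hx⟩
  have he' : ∀ x ∈ codedSet c, x < e := fun x hx => he x (h.lt_of_mem_codedSet hx) hx
  obtain ⟨x, hx⟩ := hc
  obtain ⟨y, rfl⟩ := h.exists_eq_add_one (a := e) (by rintro rfl; simpa using he' x hx)
  refine ⟨y, ?_, fun x hx => h.lt_add_one_iff.1 (he' x hx)⟩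
  by_contra hy
  refine hmin y (lt_add_one y) fun x _ hx => ?_
  exact lt_of_le_of_ne (h.lt_add_one_iff.1 (he' x hx)) (by rintro rfl; exact hy hx)

theorem exists_isLeast {A : Set M} (hA : A ∈ S) (hne : A.Nonempty) : ∃ a, IsLeast A a := by
  obtain ⟨a, ha, hmin⟩ := h.exists_least (P := fun x => x ∈ A) (h.delta_mem hA (h.fun_var 0)) hne
  exact ⟨a, ha, fun x hx => not_lt.1 fun hlt => hmin x hlt hx⟩

theorem delta_isDigits {n : ℕ} {f₁ f₂ f₃ f₄ f₅ f₆ f₇ : (Fin n → M) → M}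
    (h₁ : IsDeltaFun S f₁) (h₂ : IsDeltaFun S f₂) (h₃ : IsDeltaFun S f₃) (h₄ : IsDeltaFun S f₄)
    (h₅ : IsDeltaFun S f₅) (h₆ : IsDeltaFun S f₆) (h₇ : IsDeltaFun S f₇) : IsDelta S
      (fun v => IsDigits (f₁ v) (f₂ v) (f₃ v) (f₄ v) (f₅ v) (f₆ v) (f₇ v)) := by
  have : IsDelta S (fun v => f₂ v < f₁ v ∧ f₃ v < f₁ v ∧ f₄ v < f₁ v ∧ f₅ v < f₁ v ∧
      f₆ v < f₁ v ∧ f₇ v < f₁ v) := by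
    simp (maxDischargeDepth := 99) only [h.delta_rules, h₁, h₂, h₃, h₄, h₅, h₆, h₇]
  exact this.of_iff fun v => ⟨fun ⟨a, b, c, d, e, f⟩ => ⟨a, b, c, d, e, f⟩,
    fun ⟨a, b, c, d, e, f⟩ => ⟨a, b, c, d, e, f⟩⟩

/-- Monotonicity passes from chains to membership in `Lₙ · (k, …, k)`. In the successor clause a
larger set may have a smaller minimum `a' ≤ a`, which asks for shorter chains only. -/
theorem largeBy_mono {Y : Set M} {n d : M}
    (h1 : ∀ n', n = n' + 1 → ∀ d j, ChainMono Y n' d j)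
    (h2 : ∀ d', d = d' + 1 → ∀ j, ChainMono Y n d' j)
    {B c k b e B' c' k' b' e' : M} (hx : IsDigits B n d k k b e)
    (hx' : IsDigits B' n d k' k' b' e') (hk : k' ≤ k)
    (hsub : ∀ x < e, b ≤ x → x ∈ codedSet c → b' ≤ x ∧ x < e' ∧ x ∈ codedSet c')
    (H : LargeBy (chainRel Y B c) (codedSet c) n d k b e) :
    LargeBy (chainRel Y B' c') (codedSet c') n d k' b' e' := by
  rcases H with ⟨hd, hn, x, hxe, hbx, hxc⟩ | ⟨hd, n', hn', hn, a, hae, hba, hac, hmin, H⟩ |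
    ⟨d', hd', hd, H⟩
  · obtain ⟨h3, h4, h5⟩ := hsub x hxe hbx hxc
    exact .inl ⟨hd, hn, x, h4, h3, h5⟩
  · obtain ⟨a', ⟨ha1, ha2, ha3⟩, hmin'⟩ := h.exists_least
      (P := fun x => b' ≤ x ∧ x < e' ∧ x ∈ codedSet c')
      (by simp (maxDischargeDepth := 99) only [h.delta_rules, h.delta_mem_codedSet])
      ⟨a, hsub a hae hba hac⟩
    have haa : a' ≤ a := not_lt.1 fun hlt => hmin' a hlt (hsub a hae hba hac)
    refine .inr (.inl ⟨hd, n', hn', hn, a', ha2, ha1, ha3, fun x hxa hxc => ?_, ?_⟩)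
    · by_contra hbx
      exact hmin' x hxa ⟨not_lt.1 hbx, hxa.trans ha2, hxc⟩
    · refine h1 n' hn n' a B c a (a + 1) e B' c' a' a' (a' + 1) e' ?_ ?_ haa haa ?_ H
      · exact ⟨hn'.trans hx.n_lt, hn'.trans hx.n_lt, hae.trans hx.e_lt, hae.trans hx.e_lt,
          (h.discrete _ _ hae).trans_lt hx.e_lt, hx.e_lt⟩
      · exact ⟨hn'.trans hx'.n_lt, hn'.trans hx'.n_lt, ha2.trans hx'.e_lt, ha2.trans hx'.e_lt,
          (h.discrete _ _ ha2).trans_lt hx'.e_lt, hx'.e_lt⟩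
      · intro x hxe hax hxc
        obtain ⟨_, h4, h5⟩ := hsub x hxe (hba.trans (le_self_add.trans hax)) hxc
        exact ⟨(by gcongr : a' + 1 ≤ a + 1).trans hax, h4, h5⟩
  · refine .inr (.inr ⟨d', hd', hd, ?_⟩)
    exact h2 d' hd k B c k b e B' c' k' k' b' e' ⟨hx.n_lt, hd'.trans hx.d_lt, hx.k_lt, hx.k_lt,
      hx.b_lt, hx.e_lt⟩ ⟨hx'.n_lt, hd'.trans hx'.d_lt, hx'.k_lt, hx'.k_lt, hx'.b_lt, hx'.e_lt⟩
      hk hk hsub H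

variable {Y : Set M} (hYS : Y ∈ S) (hY : IsChainTable Θ Y)

include hYS in
theorem pi_chainMono {n : ℕ} {f g k : (Fin n → M) → M} (hf : IsDeltaFun S f)
    (hg : IsDeltaFun S g) (hk : IsDeltaFun S k) :
    IsPi S (fun v => ChainMono Y (f v) (g v) (k v)) := by
  unfold ChainMono chainRel
  repeat refine h.pi_forall ?_
  refine IsDelta.isPi ?_
  have r := fun {l : ℕ} {f : (Fin n → M) → M} (σ : Fin n → Fin l) (hf : IsDeltaFun S f) =>
    hf.rename σ
  simp (maxDischargeDepth := 99) only [h.delta_rules, h.delta_isDigits, h.delta_mem_codedSet,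
    h.delta_mem hYS, h.fun_chainIndex, r _ hf, r _ hg, r _ hk]

include hYS hY in
theorem chainMono_of {n d : M} (h1 : ∀ n', n = n' + 1 → ∀ d j, ChainMono Y n' d j)
    (h2 : ∀ d', d = d' + 1 → ∀ j, ChainMono Y n d' j) (j : M) : ChainMono Y n d j := by
  refine h.pi_induction (h.pi_chainMono hYS (h.fun_const n) (h.fun_const d) (h.fun_var 0)) ?_ ?_ j
  · intro B c k b e B' c' i k' b' e' hx hx' hi hk hsub H
    exact (hY _ _ _ _ _ _ _ _ hx').2 (.inl (by simpa using hi))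
  · intro j ih B c k b e B' c' i k' b' e' hx hx' hi hk hsub H
    rcases eq_or_ne i 0 with hi0 | hi0
    · exact (hY _ _ _ _ _ _ _ _ hx').2 (.inl hi0)
    obtain ⟨i, rfl⟩ := h.exists_eq_add_one hi0
    have hij : i ≤ j := by simpa using hi
    rcases (hY _ _ _ _ _ _ _ _ hx).1 H with hj0 | ⟨j', -, hj', y, hy, b₀, hb₀, hbb, hbF, hyF, hL, H⟩
    · simp at hj0
    obtain rfl : j = j' := add_right_cancel hj'
    have hyB : y + 1 < B := (h.discrete _ _ hy).trans_lt hx.e_lt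
    obtain ⟨hb1, hb2, hb3⟩ := hsub b₀ (hb₀.trans_lt hy) hbb hbF
    obtain ⟨hy1, hy2, hy3⟩ := hsub y hy (hbb.trans hb₀) hyF
    have hyB' : y + 1 < B' := (h.discrete _ _ hy2).trans_lt hx'.e_lt
    refine (hY _ _ _ _ _ _ _ _ hx').2 (.inr ⟨i, lt_add_one i, rfl, y, hy2, b₀, hb₀, hb1, hb3, hy3,
      ?_, ?_⟩)
    · refine h.largeBy_mono h1 h2 ⟨hx.n_lt, hx.d_lt, hx.k_lt, hx.k_lt, (hb₀.trans_lt hy).trans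
        hx.e_lt, hyB⟩ ⟨hx'.n_lt, hx'.d_lt, hx'.k_lt, hx'.k_lt, hb2.trans hx'.e_lt, hyB'⟩ hk ?_ hL
      intro x hx1 hx2 hx3
      exact ⟨hx2, hx1, (hsub x ((h.lt_add_one_iff.1 hx1).trans_lt hy) (hbb.trans hx2) hx3).2.2⟩
    · rcases eq_or_ne i 0 with hi0 | hi0
      · exact .inl hi0
      have hj0 : j ≠ 0 := by rintro rfl; exact hi0 (by simpa using hij)
      obtain ⟨w, hw, hwF, hap, hch⟩ := H.resolve_left hj0
      have hwB : w + 1 < B := (h.discrete _ _ hw).trans_lt ((hb₀.trans_lt hy).trans hx.e_lt)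
      have hdig : IsDigits B n d j k b (w + 1) :=
        ⟨hx.n_lt, hx.d_lt, (lt_add_one j).trans hx.j_lt, hx.k_lt, hx.b_lt, hwB⟩
      have hbw : b ≤ w := by
        rcases (hY _ _ _ _ _ _ _ _ hdig).1 hch with h0 | ⟨_, -, -, y', hy', b', hb', hbb', -⟩
        · exact absurd h0 hj0
        · exact hbb'.trans (hb'.trans (h.lt_add_one_iff.1 hy'))
      have hwe : w < e := hw.trans (hb₀.trans_lt hy)
      obtain ⟨_, hw2, hw3⟩ := hsub w hwe hbw hwF
      refine .inr ⟨w, hw, hw3, hap, ?_⟩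
      refine ih B c k b (w + 1) B' c' i k' b' (w + 1) hdig ⟨hx'.n_lt, hx'.d_lt,
        (lt_add_one i).trans hx'.j_lt, hx'.k_lt, hx'.b_lt,
        (h.discrete _ _ hw2).trans_lt hx'.e_lt⟩ hij hk ?_ hch
      intro x hx1 hx2 hx3
      obtain ⟨h4, h5, h6⟩ := hsub x ((h.lt_add_one_iff.1 hx1).trans_lt hwe) hx2 hx3
      exact ⟨h4, hx1, h6⟩

include hYS hY in
theorem chainMono (n d j : M) : ChainMono Y n d j := by
  refine h.pi_induction (P := fun n => ∀ d j, ChainMono Y n d j)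
    (h.pi_forall (h.pi_forall (h.pi_chainMono hYS (h.fun_var _) (h.fun_var _) (h.fun_var _))))
    ?_ ?_ n d j
  · refine h.pi_induction (P := fun d => ∀ j, ChainMono Y 0 d j)
      (h.pi_forall (h.pi_chainMono hYS (h.fun_const _) (h.fun_var _) (h.fun_var _))) ?_ ?_
    · exact h.chainMono_of hYS hY (fun n' hn => absurd hn.symm (succ_ne_zero n'))
        (fun d' hd => absurd hd.symm (succ_ne_zero d'))
    · intro d ih
      exact h.chainMono_of hYS hY (fun n' hn => absurd hn.symm (succ_ne_zero n'))
        (fun d' hd => add_right_cancel hd ▸ ih)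
  · intro n ihn
    refine h.pi_induction (P := fun d => ∀ j, ChainMono Y (n + 1) d j)
      (h.pi_forall (h.pi_chainMono hYS (h.fun_const _) (h.fun_var _) (h.fun_var _))) ?_ ?_
    · exact h.chainMono_of hYS hY (fun n' hn => add_right_cancel hn ▸ ihn)
        (fun d' hd => absurd hd.symm (succ_ne_zero d'))
    · intro d ih
      exact h.chainMono_of hYS hY (fun n' hn => add_right_cancel hn ▸ ihn)
        (fun d' hd => add_right_cancel hd ▸ ih)

end IsModelRCA0

end Monotone

/-! ### Existence and uniqueness of the largeness table -/

section Table

variable {M : Type*} [CommSemiring M] [LinearOrder M] {S : Set (Set M)}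
  [IsStrictOrderedRing M] [CanonicallyOrderedAdd M] {Θ : M → M → M → Prop}

/-- The largeness table computed from a chain table. -/
def tableOf (Y : Set M) : Set M :=
  {q | ∃ n ≤ q, ∃ d ≤ q, ∃ k ≤ q, ∃ F ≤ q, q = quad n d k F ∧
    LargeBy (chainRel Y (n + d + k + F + 1) F) (codedSet F) n d k 0 F}

theorem base_isDigits (n d k F : M) : IsDigits (n + d + k + F + 1) n d k k 0 F := by
  have h1 : 0 ≤ n := by simp
  have h2 : 0 ≤ d := by simp
  have h3 : 0 ≤ k := by simp
  have h4 : 0 ≤ F := by simp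
  have h5 : (0 : M) < 1 := one_pos
  constructor <;> grind

namespace IsModelRCA0

variable (h : IsModelRCA0 S)
include h

theorem quad_mem_tableOf {Y : Set M} {n d k F : M} : quad n d k F ∈ tableOf Y ↔
    LargeBy (chainRel Y (n + d + k + F + 1) F) (codedSet F) n d k 0 F := by
  constructor
  · rintro ⟨n', -, d', -, k', -, F', -, heq, H⟩
    obtain ⟨rfl, rfl, rfl, rfl⟩ := h.quad_inj.1 heq
    exact H
  · intro H
    have h1 : pair d (pair k F) ≤ quad n d k F := h.le_pair_right _ _
    have h2 : pair k F ≤ quad n d k F := (h.le_pair_right _ _).trans h1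
    exact ⟨n, le_pair_left _ _, d, (le_pair_left _ _).trans h1, k, (le_pair_left _ _).trans h2, F,
      (h.le_pair_right _ _).trans h2, rfl, H⟩

theorem tableOf_mem {Y : Set M} (hYS : Y ∈ S) : tableOf Y ∈ S := by
  refine h.setOf_mem ?_
  unfold LargeBy chainRel
  simp (maxDischargeDepth := 99) only [h.delta_rules, h.delta_mem_codedSet, h.fun_chainIndex,
    h.fun_quad, h.delta_mem hYS]

theorem delta_largeBy {Y : Set M} (hYS : Y ∈ S) {l : ℕ}
    {B c c' n d k b e : (Fin l → M) → M} (hB : IsDeltaFun S B)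
    (hc : IsDeltaFun S c) (hc' : IsDeltaFun S c') (hn : IsDeltaFun S n) (hd : IsDeltaFun S d)
    (hk : IsDeltaFun S k) (hb : IsDeltaFun S b) (he : IsDeltaFun S e) :
    IsDelta S (fun v => LargeBy (chainRel Y (B v) (c v)) (codedSet (c' v)) (n v) (d v) (k v)
      (b v) (e v)) := by
  have r := fun {m : ℕ} {f : (Fin l → M) → M} (σ : Fin l → Fin m) (hf : IsDeltaFun S f) =>
    hf.rename σ
  unfold LargeBy chainRel
  simp (maxDischargeDepth := 99) only [h.delta_rules, h.delta_mem_codedSet, h.fun_chainIndex,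
    h.delta_mem hYS, r _ hB, r _ hc, r _ hc', r _ hn, r _ hd, r _ hk, r _ hb, r _ he]

variable {Y : Set M} (hYS : Y ∈ S) (hY : IsChainTable Θ Y)

include hY in
theorem largeBy_nonempty {B c n d k b e : M} (hx : IsDigits B n d k k b e) (hk : k ≠ 0)
    (H : LargeBy (chainRel Y B c) (codedSet c) n d k b e) : ∃ x < e, b ≤ x ∧ x ∈ codedSet c := by
  rcases H with ⟨-, -, H⟩ | ⟨-, _, -, -, a, ha, hba, haF, -⟩ | ⟨d', hd', hd, H⟩
  · exact H
  · exact ⟨a, ha, hba, haF⟩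
  · have hx' : IsDigits B n d' k k b e :=
      ⟨hx.n_lt, hd'.trans hx.d_lt, hx.k_lt, hx.k_lt, hx.b_lt, hx.e_lt⟩
    rcases (hY _ _ _ _ _ _ _ _ hx').1 H with h0 | ⟨_, -, -, y, hy, b', hb', hbb', -, hyF, -⟩
    · exact absurd h0 hk
    · exact ⟨y, hy, hbb'.trans hb', hyF⟩

include hYS hY in
theorem largeBy_interval {B c n d k b e B' c' b' e' : M} (hx : IsDigits B n d k k b e)
    (hx' : IsDigits B' n d k k b' e')
    (hsub : ∀ x < e, b ≤ x → x ∈ codedSet c → b' ≤ x ∧ x < e' ∧ x ∈ codedSet c')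
    (H : LargeBy (chainRel Y B c) (codedSet c) n d k b e) :
    LargeBy (chainRel Y B' c') (codedSet c') n d k b' e' :=
  h.largeBy_mono (fun n' _ => h.chainMono hYS hY n') (fun d' _ => h.chainMono hYS hY n d')
    hx hx' le_rfl hsub H

variable (hΘ : ∀ {n : ℕ} {f g k : (Fin n → M) → M}, IsDeltaFun S f → IsDeltaFun S g →
  IsDeltaFun S k → IsDelta S (fun v => Θ (f v) (g v) (k v)))

include hYS hY hΘ in
/-- A chain of length `k` recorded in the table is realized by a function of the model: its
`i`-th member is the last interval of a chain of length `i + 1` in the shortest initial segment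
of `F` that has one. -/
theorem exists_fun_of_chain {n d k F : M}
    (H : chainRel Y (n + (d + 1) + k + F + 1) F n d k k 0 F) :
    ∃ f : M → M, IsInternalFun S f ∧
      (∀ i < k, codedSet (f i) ⊆ codedSet F ∧ quad n d k (f i) ∈ tableOf Y) ∧
      ∀ i j, i < j → j < k →
        SetLT (codedSet (f i)) (codedSet (f j)) ∧ Apart Θ (codedSet (f i)) (codedSet (f j)) := by
  set B := n + (d + 1) + k + F + 1 with hBdef
  have hB : IsDigits B n (d + 1) k k 0 F := base_isDigits _ _ _ _
  have hd : d < B := (lt_add_one d).trans hB.d_lt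
  have hdig : ∀ j e, j ≤ k → e ≤ F → IsDigits B n d j k 0 e := fun j e hj he =>
    ⟨hB.n_lt, hd, hj.trans_lt hB.k_lt, hB.k_lt, hB.b_lt, he.trans_lt hB.e_lt⟩
  -- `e` is the end of the shortest initial segment with a chain of length `j`
  let isEnd : M → M → Prop := fun j e =>
    chainRel Y B F n d j k 0 e ∧ ∀ e' < e, ¬ chainRel Y B F n d j k 0 e'
  let R : M → M → Prop := fun i G => ∃ e ≤ F, isEnd (i + 1) e ∧ ∃ y < e, ∃ b ≤ y,
    b ∈ codedSet F ∧ y ∈ codedSet F ∧ LargeBy (chainRel Y B F) (codedSet F) n d k b (y + 1) ∧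
    (i = 0 ∨ ∃ w < b, ApartAt Θ w b y ∧ chainRel Y B F n d i k 0 (w + 1)) ∧
    codedSet G = {x | x < y + 1 ∧ (b ≤ x ∧ x ∈ codedSet F)}
  have hA := fun {n : ℕ} {f g k : (Fin n → M) → M} => h.delta_apartAt hΘ (f := f) (g := g) (k := k)
  have hR : IsDelta S (fun w : Fin 2 → M => R (w 0) (w 1)) := by
    unfold R isEnd
    simp (maxDischargeDepth := 99) only [h.delta_rules, h.delta_mem_codedSet, h.fun_chainIndex,
      h.delta_mem hYS, h.delta_largeBy hYS, h.delta_code_eq, hA]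
  have hex : ∀ i < k, ∃ G, R i G := by
    intro i hi
    have hi1 : i + 1 ≤ k := h.discrete _ _ hi
    have hch : chainRel Y B F n d (i + 1) k 0 F :=
      h.chainMono hYS hY n d k _ _ _ _ _ _ _ _ _ _ _ (hdig k F le_rfl le_rfl)
        (hdig (i + 1) F hi1 le_rfl) hi1 le_rfl (fun x hx _ hxF => ⟨by simp, hx, hxF⟩) H
    obtain ⟨e, he, hmin⟩ := h.exists_least (P := fun e => chainRel Y B F n d (i + 1) k 0 e)
      (by simp (maxDischargeDepth := 99) only [h.delta_rules, h.delta_mem hYS,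
        h.fun_chainIndex]) ⟨F, hch⟩
    have heF : e ≤ F := not_lt.1 fun hlt => hmin F hlt hch
    rcases (hY _ _ _ _ _ _ _ _ (hdig (i + 1) e hi1 heF)).1 he with
      h0 | ⟨i', -, hi', y, hy, b, hb, -, hbF, hyF, hL, hw⟩
    · exact absurd h0 (succ_ne_zero i)
    obtain rfl : i = i' := add_right_cancel hi'
    obtain ⟨G, hG⟩ := h.exists_code_of (P := fun x => b ≤ x ∧ x ∈ codedSet F)
      (by simp (maxDischargeDepth := 99) only [h.delta_rules, h.delta_mem_codedSet]) (y + 1)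
    refine ⟨G, e, heF, ⟨he, hmin⟩, y, hy, b, hb, hbF, hyF, hL, ?_, hG⟩
    exact hw.imp_right fun ⟨w, hw, _, h1, h2⟩ => ⟨w, hw, h1, h2⟩
  obtain ⟨f, hf, hfR⟩ := h.exists_choice (R := R) (fun hf hg => h.comp2 hR hf hg) hex
  refine ⟨f, hf, fun i hi => ?_, fun i j hij hj => ?_⟩
  · obtain ⟨e, heF, -, y, hy, b, hb, hbF, hyF, hL, -, hG⟩ := hfR i hi
    refine ⟨fun x hx => ?_, h.quad_mem_tableOf.2 ?_⟩
    · rw [hG] at hx; exact hx.2.2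
    · have hyB : y + 1 < B := (h.discrete _ _ hy).trans_lt (heF.trans_lt hB.e_lt)
      refine h.largeBy_interval hYS hY ⟨hB.n_lt, hd, hB.k_lt, hB.k_lt,
        (hb.trans le_self_add).trans_lt hyB, hyB⟩ (base_isDigits n d k (f i)) ?_ hL
      intro x hx1 hx2 hx3
      have hx : x ∈ codedSet (f i) := by rw [hG]; exact ⟨hx1, hx2, hx3⟩
      exact ⟨by simp, h.lt_of_mem_codedSet hx, hx⟩
  · obtain ⟨e, heF, ⟨-, hmin⟩, y, hy, b, hb, hbF, hyF, -, -, hG⟩ := hfR i (hij.trans hj)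
    obtain ⟨e', heF', -, y', hy', b', hb', hbF', hyF', -, hw, hG'⟩ := hfR j hj
    obtain ⟨w, hw, hap, hch⟩ := hw.resolve_left (by rintro rfl; simp at hij)
    have hwF : w + 1 ≤ F := (h.discrete _ _ hw).trans (hb'.trans (hy'.le.trans heF'))
    have hew : e ≤ w + 1 := by
      refine not_lt.1 fun hlt => hmin _ hlt ?_
      exact h.chainMono hYS hY n d j _ _ _ _ _ _ _ _ _ _ _ (hdig j (w + 1) hj.le hwF)
        (hdig (i + 1) (w + 1) ((h.discrete _ _ hij).trans hj.le) hwF) (h.discrete _ _ hij) le_rfl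
        (fun x hx _ hxF => ⟨by simp, hx, hxF⟩) hch
    have hyw : y ≤ w := h.lt_add_one_iff.1 (hy.trans_le hew)
    rw [hG, hG']
    constructor
    · intro x hx z hz
      exact (((h.lt_add_one_iff.1 hx.1).trans hyw).trans_lt hw).trans_le hz.2.1
    · rintro x ⟨z, hz, hxz⟩
      obtain ⟨u, hu, hzu⟩ := hap x (hxz.trans_le ((h.lt_add_one_iff.1 hz.1).trans hyw))
      refine ⟨u, fun z hz => hu.trans_le hz.2.1, ?_⟩
      rintro z ⟨t, ht, hzt⟩
      exact hzu z (hzt.trans_le (h.lt_add_one_iff.1 ht.1))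

include hYS hY in
/-- Conversely, for an arbitrary sequence of apart sets the intervals spanned by its members are
recorded in the table, by induction on the number of members. -/
theorem chain_of_fun {n d k F : M} {f : M → M} (hf : IsInternalFun S f)
    (hfF : ∀ i < k, codedSet (f i) ⊆ codedSet F ∧ quad n d k (f i) ∈ tableOf Y)
    (hfap : ∀ i j, i < j → j < k →
        SetLT (codedSet (f i)) (codedSet (f j)) ∧ Apart Θ (codedSet (f i)) (codedSet (f j))) :
    chainRel Y (n + (d + 1) + k + F + 1) F n d k k 0 F := by
  set B := n + (d + 1) + k + F + 1 with hBdef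
  have hB : IsDigits B n (d + 1) k k 0 F := base_isDigits _ _ _ _
  have hd : d < B := (lt_add_one d).trans hB.d_lt
  have hdig : ∀ j e, j ≤ k → e ≤ F → IsDigits B n d j k 0 e := fun j e hj he =>
    ⟨hB.n_lt, hd, hj.trans_lt hB.k_lt, hB.k_lt, hB.b_lt, he.trans_lt hB.e_lt⟩
  have hne : ∀ i < k, (codedSet (f i)).Nonempty := by
    intro i hi
    have hk : k ≠ 0 := by rintro rfl; simp at hi
    obtain ⟨x, -, -, hx⟩ := h.largeBy_nonempty hY (base_isDigits n d k (f i)) hk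
      (h.quad_mem_tableOf.1 (hfF i hi).2)
    exact ⟨x, hx⟩
  have hf' := h.isInternalFun_iff.1 hf
  have key : ∀ j, j < k → ∀ y < F, y ∈ codedSet (f j) → (∀ x < F, x ∈ codedSet (f j) → x ≤ y) →
      chainRel Y B F n d (j + 1) k 0 (y + 1) := by
    have hlast : ∀ j, j < k → ∀ y < F, y ∈ codedSet (f j) →
        (∀ x < F, x ∈ codedSet (f j) → x ≤ y) → (j = 0 ∨ ∃ i, j = i + 1 ∧ ∃ w < F,
          w ∈ codedSet (f i) ∧ (∀ x < F, x ∈ codedSet (f i) → x ≤ w) ∧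
          chainRel Y B F n d j k 0 (w + 1)) → chainRel Y B F n d (j + 1) k 0 (y + 1) := by
      intro j hj y hy hyf hmax hprev
      have hyF : y + 1 ≤ F := h.discrete _ _ hy
      obtain ⟨b, hbf, hbmin⟩ := h.exists_isLeast (h.codedSet_mem (f j)) (hne j hj)
      have hby : b ≤ y := hbmin hyf
      refine (hY _ _ _ _ _ _ _ _ (hdig (j + 1) (y + 1) (h.discrete _ _ hj) hyF)).2
        (.inr ⟨j, lt_add_one j, rfl, y, lt_add_one y, b, hby, by simp, (hfF j hj).1 hbf,
          (hfF j hj).1 hyf, ?_, ?_⟩)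
      · refine h.largeBy_interval hYS hY (base_isDigits n d k (f j)) ⟨hB.n_lt, hd, hB.k_lt,
          hB.k_lt, (hby.trans hy.le).trans_lt hB.e_lt, hyF.trans_lt hB.e_lt⟩ ?_
          (h.quad_mem_tableOf.1 (hfF j hj).2)
        intro x _ _ hx
        have hxF := (hfF j hj).1 hx
        exact ⟨hbmin hx, h.lt_add_one_iff.2 (hmax x (h.lt_of_mem_codedSet hxF) hx), hxF⟩
      · refine hprev.imp_right ?_
        rintro ⟨i, rfl, w, hwF, hwf, -, hch⟩
        have hij := hfap i (i + 1) (lt_add_one i) hj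
        refine ⟨w, hij.1 w hwf b hbf, (hfF i ((lt_add_one i).trans hj)).1 hwf, fun x hx => ?_, hch⟩
        obtain ⟨u, hu, hz⟩ := hij.2 x ⟨w, hwf, hx⟩
        exact ⟨u, hu b hbf, fun z hzy => hz z ⟨y, hyf, hzy⟩⟩
    refine h.delta_induction ?_ ?_ ?_
    · simp (maxDischargeDepth := 99) only [h.delta_rules, h.delta_mem_codedSet, h.fun_chainIndex,
        h.delta_mem hYS, h.fun_comp1 hf']
    · exact fun hj y hy hyf hmax => hlast 0 hj y hy hyf hmax (.inl rfl)
    · intro i ih hj y hy hyf hmax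
      have hi := (lt_add_one i).trans hj
      obtain ⟨w, hwf, hwmax⟩ := h.exists_greatest (hne i hi)
      have hwF := h.lt_of_mem_codedSet ((hfF i hi).1 hwf)
      exact hlast (i + 1) hj y hy hyf hmax (.inr ⟨i, rfl, w, hwF, hwf, fun x _ => hwmax x,
        ih hi w hwF hwf fun x _ => hwmax x⟩)
  rcases eq_or_ne k 0 with hk | hk
  · exact (hY _ _ _ _ _ _ _ _ (hdig k F le_rfl le_rfl)).2 (.inl hk)
  · obtain ⟨j, hj⟩ := h.exists_eq_add_one hk
    have hjk : j < k := hj ▸ lt_add_one j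
    obtain ⟨y, hyf, hmax⟩ := h.exists_greatest (hne j hjk)
    have hyF := h.lt_of_mem_codedSet ((hfF j hjk).1 hyf)
    have hch := key j hjk y hyF hyf fun x _ => hmax x
    have hyF' : y + 1 ≤ F := h.discrete _ _ hyF
    exact h.chainMono hYS hY n d (j + 1) _ _ _ _ _ _ _ _ _ _ _
      (hdig (j + 1) (y + 1) hj.ge hyF') (hdig k F le_rfl le_rfl) hj.le le_rfl
      (fun x hx _ hxF => ⟨by simp, hx.trans_le hyF', hxF⟩) hch

include hYS hY hΘ in
theorem isLargenessTable_tableOf : IsLargenessTable S Θ (tableOf Y) where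
  zero k F := by
    rw [h.quad_mem_tableOf]
    constructor
    · rintro (⟨-, -, x, -, -, hx⟩ | ⟨-, n', hn', -⟩ | ⟨d', hd', -⟩)
      · exact ⟨x, hx⟩
      · simp at hn'
      · simp at hd'
    · rintro ⟨x, hx⟩
      exact .inl ⟨rfl, rfl, x, h.lt_of_mem_codedSet hx, by simp, hx⟩
  succ n k F := by
    rw [h.quad_mem_tableOf]
    have hB := base_isDigits (n + 1) 0 k F
    set B := n + 1 + 0 + k + F + 1
    have hnB : n < B := (lt_add_one n).trans hB.n_lt
    constructor
    · rintro (⟨-, hn, -⟩ | ⟨-, n', hn', hn, a, haF, -, haF', hmin, H⟩ | ⟨d', hd', -⟩)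
      · exact absurd hn (succ_ne_zero n)
      · obtain rfl : n = n' := add_right_cancel hn
        obtain ⟨G, hG⟩ := h.exists_code_of (P := fun x => x ∈ codedSet F ∧ x ≠ a)
          (by simp (maxDischargeDepth := 99) only [h.delta_rules, h.delta_mem_codedSet, ne_eq]) F
        have hleast : IsLeast (codedSet F) a :=
          ⟨haF', fun x hx => not_lt.1 fun hlt => by simpa using hmin x hlt hx⟩
        refine ⟨a, G, hleast, ?_, h.quad_mem_tableOf.2 (.inr (.inr ⟨n, lt_add_one n, rfl, ?_⟩))⟩
        · rw [hG]; ext x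
          exact ⟨fun hx => hx.2, fun hx => ⟨h.lt_of_mem_codedSet hx.1, hx⟩⟩
        · have hB' := base_isDigits n (n + 1) a G
          refine h.chainMono hYS hY n n a _ _ _ _ _ _ _ _ _ _ _ ⟨hnB, hnB, haF.trans hB.e_lt,
            haF.trans hB.e_lt, (h.discrete _ _ haF).trans_lt hB.e_lt, hB.e_lt⟩
            ⟨hB'.n_lt, hB'.n_lt, hB'.j_lt, hB'.k_lt, hB'.b_lt, hB'.e_lt⟩ le_rfl le_rfl ?_ H
          intro x hx hax hxF
          have hxG : x ∈ codedSet G := by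
            rw [hG]
            exact ⟨hx, hxF, (h.add_one_le_iff.1 hax).ne'⟩
          exact ⟨by simp, h.lt_of_mem_codedSet hxG, hxG⟩
      · simp at hd'
    · rintro ⟨a, G, hleast, hG, H⟩
      have haF := h.lt_of_mem_codedSet hleast.1
      have hB' := base_isDigits n (n + 1) a G
      rcases h.quad_mem_tableOf.1 H with ⟨hn, -⟩ | ⟨hn, -⟩ | ⟨d', -, hd', H⟩
      · exact absurd hn (succ_ne_zero n)
      · exact absurd hn (succ_ne_zero n)
      obtain rfl : n = d' := add_right_cancel hd'
      refine .inr (.inl ⟨rfl, n, lt_add_one n, rfl, a, haF, by simp, hleast.1,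
        fun x hx hxF => absurd (hleast.2 hxF) (not_le.2 hx), ?_⟩)
      refine h.chainMono hYS hY n n a _ _ _ _ _ _ _ _ _ _ _ ⟨hB'.n_lt, hB'.n_lt, hB'.j_lt,
        hB'.k_lt, hB'.b_lt, hB'.e_lt⟩ ⟨hnB, hnB, haF.trans hB.e_lt,
        haF.trans hB.e_lt, (h.discrete _ _ haF).trans_lt hB.e_lt, hB.e_lt⟩ le_rfl le_rfl ?_ H
      intro x _ _ hxG
      rw [hG] at hxG
      exact ⟨h.discrete _ _ (lt_of_le_of_ne (hleast.2 hxG.1) fun heq => hxG.2 heq.symm),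
        h.lt_of_mem_codedSet hxG.1, hxG.1⟩
  mul n d k F := by
    rw [h.quad_mem_tableOf]
    constructor
    · rintro (⟨hd, -⟩ | ⟨hd, -⟩ | ⟨d', -, hd, H⟩)
      · exact absurd hd (succ_ne_zero d)
      · exact absurd hd (succ_ne_zero d)
      · obtain rfl : d = d' := add_right_cancel hd
        exact h.exists_fun_of_chain hYS hY hΘ H
    · rintro ⟨f, hf, hfF, hfap⟩
      exact .inr (.inr ⟨d, lt_add_one d, rfl, h.chain_of_fun hYS hY hf hfF hfap⟩)

include hΘ in
/-- The model has a largeness table; it can be taken monotone in `F` and antitone in `k`. -/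
theorem exists_largenessTable : ∃ L ∈ S, IsLargenessTable S Θ L ∧
    ∀ n d k k' F F', codedSet F ⊆ codedSet F' → k' ≤ k → quad n d k F ∈ L →
      quad n d k' F' ∈ L := by
  obtain ⟨Y, hYS, hY⟩ := h.exists_chainTable hΘ
  refine ⟨tableOf Y, h.tableOf_mem hYS, h.isLargenessTable_tableOf hYS hY hΘ, ?_⟩
  intro n d k k' F F' hFF hk H
  rw [h.quad_mem_tableOf] at H ⊢
  exact h.largeBy_mono (fun n' _ => h.chainMono hYS hY n') (fun d' _ => h.chainMono hYS hY n d')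
    (base_isDigits _ _ _ _) (base_isDigits _ _ _ _) hk (fun x _ _ hx => ⟨by simp,
      h.lt_of_mem_codedSet (hFF hx), hFF hx⟩) H

/-- The recursion clauses determine the largeness table. -/
theorem largenessTable_unique {L L' : Set M} (hL : L ∈ S) (hL' : L' ∈ S)
    (hT : IsLargenessTable S Θ L) (hT' : IsLargenessTable S Θ L') (n d : M) :
    ∀ k F, quad n d k F ∈ L ↔ quad n d k F ∈ L' := by
  have hpi : ∀ {l : ℕ} {f g : (Fin l → M) → M}, IsDeltaFun S f → IsDeltaFun S g →
      IsPi S (fun v => ∀ k F, quad (f v) (g v) k F ∈ L ↔ quad (f v) (g v) k F ∈ L') := by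
    intro l f g hf hg
    have r := fun {m : ℕ} {f : (Fin l → M) → M} (σ : Fin l → Fin m) (hf : IsDeltaFun S f) =>
      hf.rename σ
    repeat refine h.pi_forall ?_
    refine IsDelta.isPi ?_
    simp (maxDischargeDepth := 99) only [h.delta_rules, h.fun_quad, h.delta_mem hL,
      h.delta_mem hL', r _ hf, r _ hg]
  have hmul : ∀ n, (∀ k F, quad n 0 k F ∈ L ↔ quad n 0 k F ∈ L') →
      ∀ d k F, quad n d k F ∈ L ↔ quad n d k F ∈ L' := by
    intro n h0
    refine h.pi_induction (hpi (h.fun_const n) (h.fun_var 0)) h0 fun d ih k F => ?_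
    rw [hT.mul, hT'.mul]
    simp only [ih]
  refine h.pi_induction (P := fun n => ∀ d k F, quad n d k F ∈ L ↔ quad n d k F ∈ L')
    (h.pi_forall (hpi (h.fun_var 1) (h.fun_var 0))) (hmul 0 fun k F => ?_)
    (fun n ih => hmul (n + 1) fun k F => ?_) n d
  · rw [hT.zero, hT'.zero]
  · rw [hT.succ, hT'.succ]
    simp only [ih]

end IsModelRCA0

end Table

/-! ### Large sets and their hulls -/

section Combinatorics

variable {M : Type*} [CommSemiring M] [LinearOrder M] {S : Set (Set M)}
  [IsStrictOrderedRing M] [CanonicallyOrderedAdd M] {Θ : M → M → M → Prop}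

/-- A largeness table of the model which is monotone in the finite set and antitone in `k`. -/
structure IsMonotoneTable (S : Set (Set M)) (Θ : M → M → M → Prop) (L : Set M) : Prop where
  mem : L ∈ S
  table : IsLargenessTable S Θ L
  mono : ∀ {n d k k' F F' : M}, codedSet F ⊆ codedSet F' → k' ≤ k → quad n d k F ∈ L →
    quad n d k' F' ∈ L

/-- The part of `X` between the minimum and the maximum of `A`. -/
def hull (X A : Set M) : Set M := {x | x ∈ X ∧ (∃ a ∈ A, a ≤ x) ∧ ∃ b ∈ A, x ≤ b}

/-- Unbounded subsets of the model. -/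
def IsUnbounded (X : Set M) : Prop := ∀ b : M, ∃ x ∈ X, b < x

theorem subset_hull {X A : Set M} (hA : A ⊆ X) : A ⊆ hull X A := fun x hx =>
  ⟨hA hx, ⟨x, hx, le_rfl⟩, x, hx, le_rfl⟩

theorem hull_subset_hull {X A B : Set M} (hAB : A ⊆ B) : hull X A ⊆ hull X B :=
  fun _ ⟨hx, ⟨a, ha, hax⟩, b, hb, hxb⟩ => ⟨hx, ⟨a, hAB ha, hax⟩, b, hAB hb, hxb⟩

theorem SetLT.hull {X A B : Set M} (hAB : SetLT A B) : SetLT (hull X A) (hull X B) :=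
  fun _ ⟨_, _, b, hb, hxb⟩ _ ⟨_, ⟨a, ha, hay⟩, _⟩ => (hxb.trans_lt (hAB b hb a ha)).trans_le hay

theorem Apart.hull {X A B : Set M} (hAB : Apart Θ A B) : Apart Θ (hull X A) (hull X B) := by
  rintro x ⟨e, ⟨-, -, b, hb, heb⟩, hxe⟩
  obtain ⟨u, hu, hz⟩ := hAB x ⟨b, hb, hxe.trans_le heb⟩
  refine ⟨u, fun y ⟨_, ⟨a, ha, hay⟩, _⟩ => (hu a ha).trans_le hay, ?_⟩
  rintro z ⟨y, ⟨-, -, b, hb, hyb⟩, hzy⟩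
  exact hz z ⟨b, hb, hzy.trans_le hyb⟩

theorem ApartAt.mono {w w' b y : M} (hw : w' ≤ w) (H : ApartAt Θ w b y) : ApartAt Θ w' b y :=
  fun x hx => H x (hx.trans_le hw)

namespace IsModelRCA0

variable (h : IsModelRCA0 S)
include h

theorem mem_hull_codedSet_iff {X : Set M} {H x : M} : x ∈ hull X (codedSet H) ↔
    x < H ∧ (x ∈ X ∧ (∃ a ≤ x, a ∈ codedSet H) ∧ ∃ b < H, b ∈ codedSet H ∧ x ≤ b) := by
  constructor
  · rintro ⟨hx, ⟨a, ha, hax⟩, b, hb, hxb⟩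
    have hbH := h.lt_of_mem_codedSet hb
    exact ⟨hxb.trans_lt hbH, hx, ⟨a, hax, ha⟩, b, hbH, hb, hxb⟩
  · rintro ⟨-, hx, ⟨a, hax, ha⟩, b, -, hb, hxb⟩
    exact ⟨hx, ⟨a, ha, hax⟩, b, hb, hxb⟩

theorem hull_codedSet {X : Set M} (H : M) : hull X (codedSet H) = {x | x < H ∧ (x ∈ X ∧
    (∃ a ≤ x, a ∈ codedSet H) ∧ ∃ b < H, b ∈ codedSet H ∧ x ≤ b)} :=
  Set.ext fun _ => h.mem_hull_codedSet_iff

theorem exists_code_hull {X : Set M} (hX : X ∈ S) (H : M) :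
    ∃ G, codedSet G = hull X (codedSet H) := by
  rw [h.hull_codedSet]
  refine h.exists_code_of ?_ H
  simp (maxDischargeDepth := 99) only [h.delta_rules, h.delta_mem_codedSet, h.delta_mem hX]

theorem delta_code_eq_hull {X : Set M} (hX : X ∈ S) {n : ℕ} {f g : (Fin n → M) → M}
    (hf : IsDeltaFun S f) (hg : IsDeltaFun S g) :
    IsDelta S (fun v => codedSet (f v) = hull X (codedSet (g v))) := by
  have r := fun {l : ℕ} {f : (Fin n → M) → M} (σ : Fin n → Fin l) (hf : IsDeltaFun S f) =>
    hf.rename σ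
  simp only [h.hull_codedSet]
  simp (maxDischargeDepth := 99) only [h.delta_rules, h.delta_mem_codedSet, h.delta_code_eq,
    h.delta_mem hX, r _ hf, r _ hg]

theorem isInternalFun_const (c : M) : IsInternalFun S (fun _ : M => c) :=
  h.isInternalFun_iff.2 (h.fun_const c)

variable {L : Set M} (hL : IsMonotoneTable S Θ L)
include hL

theorem large_of_mul_succ {n d k F : M} (hk : k ≠ 0) (H : quad n (d + 1) k F ∈ L) :
    quad n d k F ∈ L := by
  obtain ⟨f, -, hf, -⟩ := (hL.table.mul n d k F).1 H
  obtain ⟨h1, h2⟩ := hf 0 (pos_iff_ne_zero.2 hk)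
  exact hL.mono h1 le_rfl h2

theorem large_of_mul_le {n d d' k F : M} (hk : k ≠ 0) (hd : d ≤ d') (H : quad n d' k F ∈ L) :
    quad n d k F ∈ L := by
  obtain ⟨e, rfl⟩ := exists_add_of_le hd
  refine h.delta_induction (P := fun e => quad n (d + e) k F ∈ L → quad n d k F ∈ L) ?_ ?_ ?_ e H
  · simp (maxDischargeDepth := 99) only [h.delta_rules, h.fun_quad, h.delta_mem hL.mem]
  · simp
  · intro e ih H
    rw [← add_assoc] at H
    exact ih (h.large_of_mul_succ hL hk H)

/-- Without factors `k` the value of `k` is irrelevant. -/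
theorem large_congr {n k k' F : M} (H : quad n 0 k F ∈ L) : quad n 0 k' F ∈ L := by
  rcases eq_or_ne n 0 with rfl | hn
  · rw [hL.table.zero] at H ⊢; exact H
  · obtain ⟨n, rfl⟩ := h.exists_eq_add_one hn
    rw [hL.table.succ] at H ⊢; exact H

theorem large_nonempty' {n k F : M} (H : quad n 0 k F ∈ L) : (codedSet F).Nonempty := by
  rcases eq_or_ne n 0 with rfl | hn
  · exact (hL.table.zero k F).1 H
  · obtain ⟨n, rfl⟩ := h.exists_eq_add_one hn
    obtain ⟨a, -, ha, -⟩ := (hL.table.succ n k F).1 H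
    exact ⟨a, ha.1⟩

theorem large_nonempty {n d k F : M} (hd : d = 0 ∨ k ≠ 0) (H : quad n d k F ∈ L) :
    (codedSet F).Nonempty := by
  rcases hd with rfl | hk
  · exact h.large_nonempty' hL H
  · exact h.large_nonempty' hL (h.large_of_mul_le hL hk (by simp) H)

theorem large_of_le {n n' F : M} (hn : n ≤ n') (hF : ∀ x ∈ codedSet F, x ≠ 0)
    (H : quad n' 0 0 F ∈ L) : quad n 0 0 F ∈ L := by
  obtain ⟨e, rfl⟩ := exists_add_of_le hn
  refine h.delta_induction (P := fun e => quad (n + e) 0 0 F ∈ L → quad n 0 0 F ∈ L)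
    ?_ ?_ ?_ e H
  · simp (maxDischargeDepth := 99) only [h.delta_rules, h.fun_quad, h.delta_mem hL.mem]
  · simp
  · intro e ih H
    rw [← add_assoc] at H
    obtain ⟨a, G, ha, hG, HG⟩ := (hL.table.succ _ _ _).1 H
    have h1 := h.large_of_mul_le hL (d := 0) (hF a ha.1) (by simp) HG
    exact ih (hL.mono (by rw [hG]; exact Set.sdiff_subset) le_rfl (h.large_congr hL h1))

theorem exists_lt_of_large {m F : M} (hm : m ≠ 0) (hF : ∀ x ∈ codedSet F, x ≠ 0)
    (H : quad m 0 0 F ∈ L) : ∃ a ∈ codedSet F, ∃ y ∈ codedSet F, a < y := by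
  obtain ⟨m, rfl⟩ := h.exists_eq_add_one hm
  obtain ⟨a, G, ha, hG, HG⟩ := (hL.table.succ _ _ _).1 H
  obtain ⟨y, hy⟩ := h.large_nonempty hL (.inr (hF a ha.1)) HG
  rw [hG] at hy
  exact ⟨a, ha.1, y, hy.1, lt_of_le_of_ne (ha.2 hy.1) fun heq => hy.2 heq.symm⟩

/-- If largeness in `Lₘ · (k, …, k)` with `d₀` factors passes from subsets `H` of `Z` to largeness
of `hull X H` in `Lₛ · (k, …, k)` with `s₀` factors, then it also does so with `d` more factors on
both sides, because apartness passes to hulls. -/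
theorem large_hull_of_mul {X Z : Set M} (hX : X ∈ S) (hZ : Z ∈ S) {m s d₀ s₀ k : M}
    (h0 : ∀ H G, codedSet H ⊆ Z → (∀ x ∈ codedSet H, k ≤ x) → quad m d₀ k H ∈ L →
      codedSet G = hull X (codedSet H) → quad s s₀ k G ∈ L) (d : M) :
    ∀ H G, (∀ x < H, x ∈ codedSet H → x ∈ Z ∧ k ≤ x) → quad m (d₀ + d) k H ∈ L →
      codedSet G = hull X (codedSet H) → quad s (s₀ + d) k G ∈ L := by
  refine h.pi_induction (P := fun d => ∀ H G, (∀ x < H, x ∈ codedSet H → x ∈ Z ∧ k ≤ x) →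
    quad m (d₀ + d) k H ∈ L → codedSet G = hull X (codedSet H) → quad s (s₀ + d) k G ∈ L)
    (h.pi_forall (h.pi_forall (IsDelta.isPi ?_))) ?_ ?_ d
  · simp (maxDischargeDepth := 99) only [h.delta_rules, h.fun_quad, h.delta_mem hL.mem,
      h.delta_mem hZ, h.delta_mem_codedSet, h.delta_code_eq_hull hX]
  · intro H G hH hHL hG
    rw [add_zero] at hHL ⊢
    exact h0 H G (fun x hx => (hH x (h.lt_of_mem_codedSet hx) hx).1)
      (fun x hx => (hH x (h.lt_of_mem_codedSet hx) hx).2) hHL hG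
  · intro d ih H G hH hHL hG
    rw [← add_assoc] at hHL ⊢
    obtain ⟨f, hf, hfH, hfap⟩ := (hL.table.mul _ _ _ _).1 hHL
    have hf' := h.isInternalFun_iff.1 hf
    obtain ⟨g, hg, hgf⟩ := h.exists_choice (k := k)
      (R := fun i c => codedSet c = hull X (codedSet (f i)))
      (fun hi hc => h.delta_code_eq_hull hX hc (h.fun_comp1 hf' hi))
      (fun i _ => h.exists_code_hull hX (f i))
    refine (hL.table.mul _ _ _ _).2 ⟨g, hg, fun i hi => ⟨?_, ?_⟩, fun i j hij hj => ?_⟩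
    · rw [hgf i hi, hG]; exact hull_subset_hull (hfH i hi).1
    · refine ih (f i) (g i) (fun x _ hx => ?_) (hfH i hi).2 (hgf i hi)
      have hxH := (hfH i hi).1 hx
      exact hH x (h.lt_of_mem_codedSet hxH) hxH
    · rw [hgf i (hij.trans hj), hgf j hj]
      exact ⟨(hfap i j hij hj).1.hull, (hfap i j hij hj).2.hull⟩

/-- Dropping the minima of the members of `Lₘ₊₁`, which are at least `k`, leaves `m + 1` factors
`k`. -/
theorem large_drop_min {Z : Set M} (hZ : Z ∈ S) {m k d H G : M} (hHZ : codedSet H ⊆ Z)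
    (hk : ∀ x ∈ codedSet H, k ≤ x) (hH : quad (m + 1) d k H ∈ L)
    (hG : codedSet G = hull Z (codedSet H)) : quad m (m + 1 + d) k G ∈ L := by
  refine h.large_hull_of_mul hL hZ hZ (m := m + 1) (d₀ := 0) ?_ d H G
    (fun x _ hx => ⟨hHZ hx, hk x hx⟩) (by rwa [zero_add]) hG
  intro H G hHZ hk hH hG
  obtain ⟨a, G', ha, hG', HG⟩ := (hL.table.succ _ _ _).1 hH
  refine hL.mono ?_ (hk a ha.1) HG
  rw [hG', hG]
  exact Set.sdiff_subset.trans (subset_hull hHZ)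

end IsModelRCA0

end Combinatorics

/-! ### Separating sets -/

section Blocks

variable {M : Type*} [CommSemiring M] [LinearOrder M] {S : Set (Set M)}
  [IsStrictOrderedRing M] [CanonicallyOrderedAdd M] {Θ : M → M → M → Prop}

/-- Between any two elements `w < y` of `Y` there is some `b` such that `X ∩ [b, y]` belongs to
`Lₙ · (k, …, k)` (`e` times `k`) and is apart from all sets with maximum `w`. -/
def Separates (Θ : M → M → M → Prop) (L X Y : Set M) (n e k : M) : Prop :=
  ∀ w ∈ Y, ∀ y ∈ Y, w < y → ∃ b ≤ y, w < b ∧ ApartAt Θ w b y ∧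
    ∀ G, (∀ x ∈ X, b ≤ x → x ≤ y → x ∈ codedSet G) → quad n e k G ∈ L

namespace IsModelRCA0

variable (h : IsModelRCA0 S)
include h

theorem exists_code_Icc {X : Set M} (hX : X ∈ S) (b y : M) :
    ∃ G, codedSet G = {x | x < y + 1 ∧ (b ≤ x ∧ x ∈ X)} :=
  h.exists_code_of (P := fun x => b ≤ x ∧ x ∈ X)
    (by simp (maxDischargeDepth := 99) only [h.delta_rules, h.delta_mem hX]) (y + 1)

theorem delta_code_eq_Icc {X : Set M} (hX : X ∈ S) {l : ℕ} {G b y : (Fin l → M) → M}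
    (hG : IsDeltaFun S G) (hb : IsDeltaFun S b) (hy : IsDeltaFun S y) :
    IsDelta S (fun v => codedSet (G v) = {x | x < y v + 1 ∧ (b v ≤ x ∧ x ∈ X)}) := by
  have hb' := hb.rename (Fin.succ (n := l))
  simp (maxDischargeDepth := 99) only [h.delta_rules, h.delta_mem hX, h.delta_code_eq, hG, hb', hy]

theorem sep_mem {X : Set M} (hX : X ∈ S) {P : M → Prop}
    (hP : IsDelta S (fun w : Fin 1 → M => P (w 0))) : {x | x ∈ X ∧ P x} ∈ S :=
  h.setOf_mem (P := fun x => x ∈ X ∧ P x) ((h.delta_mem hX (h.fun_var 0)).and hP)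

/-- Collection turns `T` into bounds: some `b` lies above witnesses for all `x < a`. -/
theorem exists_bound (hB : SatisfiesBSigma2 S)
    (hΘ : ∀ {n : ℕ} {f g k : (Fin n → M) → M}, IsDeltaFun S f → IsDeltaFun S g →
      IsDeltaFun S k → IsDelta S (fun v => Θ (f v) (g v) (k v)))
    (hT : ∀ x, ∃ y, ∀ z, Θ x y z) (a : M) : ∃ b, ∀ x < a, ∃ y < b, ∀ z, Θ x y z := by
  have hdef : IsDelta S (fun w : Fin 4 → M => Θ (w 3) (w 2) (w 0)) :=
    hΘ (h.fun_var 3) (h.fun_var 2) (h.fun_var 0)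
  obtain ⟨m, p, φ, V, v, hV, hφ⟩ := hdef.exists_formula
  have key : ∀ w u y x, Θ x y w ↔ φ.Holds V (Matrix.vecCons w (Matrix.vecCons u
      (Matrix.vecCons y (Matrix.vecCons x v)))) := fun w u y x =>
    hφ ![w, u, y, x] _ (fun j => by fin_cases j <;> rfl) (fun i => rfl)
  obtain ⟨b, hb⟩ := hB φ V v hV a (fun x _ => by
    obtain ⟨y, hy⟩ := hT x
    exact ⟨y, 0, fun w => (key w 0 y x).1 (hy w)⟩)
  refine ⟨b, fun x hx => ?_⟩
  obtain ⟨y, hy, u, hu⟩ := hb x hx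
  exact ⟨y, hy, fun z => (key z u y x).2 (hu z)⟩

variable {L : Set M} (hL : IsMonotoneTable S Θ L)
include hL

/-- An unbounded set all of whose unbounded subsets have subsets in `Lₙ · (k, …, k)` has an
unbounded subset that separates it into such blocks. Its elements are found by search: the next
element need only be apart from the earlier ones in the bounded sense, and by collection some
large enough element always is. -/
theorem exists_separating (hB : SatisfiesBSigma2 S)
    (hΘ : ∀ {n : ℕ} {f g k : (Fin n → M) → M}, IsDeltaFun S f → IsDeltaFun S g →
      IsDeltaFun S k → IsDelta S (fun v => Θ (f v) (g v) (k v)))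
    (hT : ∀ x, ∃ y, ∀ z, Θ x y z) {n e k : M} (hek : e = 0 ∨ k ≠ 0) {X : Set M} (hX : X ∈ S)
    (hXu : IsUnbounded X)
    (hlarge : ∀ X' ∈ S, X' ⊆ X → IsUnbounded X' → ∃ F, codedSet F ⊆ X' ∧ quad n e k F ∈ L) :
    ∃ Y ∈ S, Y ⊆ X ∧ IsUnbounded Y ∧ Separates Θ L X Y n e k := by
  have hA := fun {n : ℕ} {f g k : (Fin n → M) → M} => h.delta_apartAt hΘ (f := f) (g := g) (k := k)
  let Blk : M → M → Prop := fun b y =>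
    ∃ G, codedSet G = {x | x < y + 1 ∧ (b ≤ x ∧ x ∈ X)} ∧ quad n e k G ∈ L
  have hBlk : IsDelta S (fun w : Fin 2 → M => Blk (w 0) (w 1)) := by
    refine h.isDelta_of_sigma_pi
      (Q := fun G v => codedSet G = {x | x < v 1 + 1 ∧ (v 0 ≤ x ∧ x ∈ X)} ∧ quad n e k G ∈ L)
      (R := fun G v => codedSet G = {x | x < v 1 + 1 ∧ (v 0 ≤ x ∧ x ∈ X)} → quad n e k G ∈ L)
      ?_ ?_ (fun v => Iff.rfl) fun v => ?_
    · simp (maxDischargeDepth := 99) only [h.delta_rules, h.delta_code_eq_Icc hX,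
        h.delta_mem hL.mem, h.fun_quad]
    · simp (maxDischargeDepth := 99) only [h.delta_rules, h.delta_code_eq_Icc hX,
        h.delta_mem hL.mem, h.fun_quad]
    · constructor
      · rintro ⟨G, hG, HG⟩ G' hG'
        exact hL.mono (hG.trans hG'.symm).subset le_rfl HG
      · intro H
        obtain ⟨G, hG⟩ := h.exists_code_Icc hX (v 0) (v 1)
        exact ⟨G, hG, H G hG⟩
  let R : M → M → Prop := fun w y => ∃ b ≤ y, w < b ∧ ApartAt Θ w b y ∧ Blk b y
  obtain ⟨Y, hYS, hY⟩ := h.exists_recursion (Φ := fun A y => y ∈ X ∧ ∀ w < y, w ∈ A → R w y)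
    (by
      unfold R
      simp (maxDischargeDepth := 99) only [h.delta_rules, h.delta_mem hX, h.delta_mem_codedSet, hA,
        h.comp2 hBlk])
    (fun A A' y hAA => and_congr_right fun _ => forall_congr' fun w => by
      constructor
      · exact fun H hw hwA => H hw ((hAA w hw).2 hwA)
      · exact fun H hw hwA => H hw ((hAA w hw).1 hwA))
  refine ⟨Y, hYS, fun y hy => ((hY y).1 hy).1, ?_, ?_⟩
  · -- were `a` a bound of `Y`, a large set far enough above `a` would supply one more element
    intro a
    by_contra! hbd
    obtain ⟨b₀, hb₀⟩ := h.exists_bound hB hΘ hT a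
    obtain ⟨F, hF, HF⟩ := hlarge {x | x ∈ X ∧ max a b₀ < x}
      (h.sep_mem hX (by simp (maxDischargeDepth := 99) only [h.delta_rules]))
      (fun x hx => hx.1) (fun c => by
        obtain ⟨x, hx, hcx⟩ := hXu (max (max a b₀) c)
        exact ⟨x, ⟨hx, (le_max_left _ _).trans_lt hcx⟩, (le_max_right _ _).trans_lt hcx⟩)
    have hne := h.large_nonempty hL hek HF
    obtain ⟨y, hyF, hymax⟩ := h.exists_greatest hne
    obtain ⟨b, hbF, hbmin⟩ := h.exists_isLeast (h.codedSet_mem F) hne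
    have hab : max a b₀ < b := (hF hbF).2
    have hyY : y ∈ Y := by
      refine (hY y).2 ⟨(hF hyF).1, fun w hw hwY => ⟨b, hbmin hyF, ?_, ?_, ?_⟩⟩
      · exact (hbd w hwY).trans_lt ((le_max_left _ _).trans_lt hab)
      · intro x hx
        obtain ⟨u, hu, hz⟩ := hb₀ x (hx.trans_le (hbd w hwY))
        exact ⟨u, hu.trans ((le_max_right _ _).trans_lt hab), fun z _ => hz z⟩
      · obtain ⟨G, hG⟩ := h.exists_code_Icc hX b y
        refine ⟨G, hG, hL.mono ?_ le_rfl HF⟩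
        intro x hx
        rw [hG]
        exact ⟨h.lt_add_one_iff.2 (hymax x hx), hbmin hx, (hF hx).1⟩
    exact absurd (hbd y hyY) (not_le.2 (((le_max_left _ _).trans_lt hab).trans_le (hbmin hyF)))
  · intro w hw y hy hwy
    obtain ⟨b, hby, hwb, hap, G, hG, HG⟩ := ((hY y).1 hy).2 w hwy hw
    refine ⟨b, hby, hwb, hap, fun G' hG' => hL.mono ?_ le_rfl HG⟩
    rw [hG]
    exact fun x hx => hG' x hx.2.2 hx.2.1 (h.lt_add_one_iff.1 hx.1)

/-- A separating set has chains of points of any length. -/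
theorem exists_points {X Y : Set M} {n e k : M} (hYS : Y ∈ S) (hYu : IsUnbounded Y)
    (hsep : Separates Θ L X Y n e k) (j : M) :
    ∃ H, codedSet H ⊆ Y ∧ quad 0 1 j H ∈ L := by
  suffices ∃ H, (∀ x < H, x ∈ codedSet H → x ∈ Y) ∧ quad 0 1 j H ∈ L by
    obtain ⟨H, h1, h2⟩ := this
    exact ⟨H, fun x hx => h1 x (h.lt_of_mem_codedSet hx) hx, h2⟩
  have hmul := hL.table.mul 0 0
  rw [zero_add] at hmul
  refine h.sigma_induction (P := fun H j => (∀ x < H, x ∈ codedSet H → x ∈ Y) ∧ quad 0 1 j H ∈ L)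
    ?_ ?_ ?_ j
  · simp (maxDischargeDepth := 99) only [h.delta_rules, h.delta_mem_codedSet, h.delta_mem hYS,
      h.delta_mem hL.mem, h.fun_quad]
  · refine ⟨0, fun x hx => absurd hx (by simp), (hmul 0 0).2 ⟨fun _ => 0,
      h.isInternalFun_const 0, fun i hi => absurd hi (by simp), fun i j _ hj => ?_⟩⟩
    exact absurd hj (by simp)
  · rintro j ⟨H, hHY, HH⟩
    obtain ⟨f, hf, hfH, hfap⟩ := (hmul j H).1 HH
    obtain ⟨y, hyY, hy⟩ := hYu H
    have hcode : ∀ P : M → Prop, IsDelta S (fun w : Fin 1 → M => P (w 0)) →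
        ∃ c, codedSet c = {x | x < y + 1 ∧ P x} := fun P hP => h.exists_code_of hP (y + 1)
    obtain ⟨c, hc⟩ := hcode (fun x => x = y)
      (by simp (maxDischargeDepth := 99) only [h.delta_rules])
    obtain ⟨H', hH'⟩ := hcode (fun x => x ∈ codedSet H ∨ x = y)
      (by simp (maxDischargeDepth := 99) only [h.delta_rules, h.delta_mem_codedSet])
    have hcy : ∀ x, x ∈ codedSet c ↔ x = y := fun x => by
      rw [hc]
      exact ⟨fun hx => hx.2, fun hx => ⟨hx ▸ lt_add_one x, hx⟩⟩
    have hHy : ∀ x ∈ codedSet H, x < y := fun x hx => (h.lt_of_mem_codedSet hx).trans hy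
    have hHH : codedSet H ⊆ codedSet H' := fun x hx => by
      rw [hH']
      exact ⟨(hHy x hx).trans (lt_add_one y), .inl hx⟩
    have hf' := h.isInternalFun_iff.1 hf
    obtain ⟨g, hg, hgf⟩ := h.exists_choice (k := j + 1)
      (R := fun i G => (i = j ∧ G = c) ∨ (i ≠ j ∧ G = f i))
      (fun {_ _ _} hi hG => by
        simp (maxDischargeDepth := 99) only [h.delta_rules, ne_eq, h.fun_comp1 hf', hi, hG])
      (fun i _ => by
        by_cases hi : i = j
        · exact ⟨c, .inl ⟨hi, rfl⟩⟩
        · exact ⟨f i, .inr ⟨hi, rfl⟩⟩)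
    have hgj : g j = c := by simpa using hgf j (lt_add_one j)
    have hgi : ∀ i < j, g i = f i := fun i hi => by
      simpa [hi.ne] using hgf i (hi.trans (lt_add_one j))
    refine ⟨H', fun x _ hx => ?_, (hmul (j + 1) H').2 ⟨g, hg, fun i hi => ?_, fun i i' hii hi' => ?_⟩⟩
    · rw [hH'] at hx
      rcases hx.2 with hx | rfl
      · exact hHY x (h.lt_of_mem_codedSet hx) hx
      · exact hyY
    · rcases (h.lt_add_one_iff.1 hi).lt_or_eq with hi | rfl
      · rw [hgi i hi]
        exact ⟨(hfH i hi).1.trans hHH, h.large_congr hL (hfH i hi).2⟩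
      · rw [hgj]
        refine ⟨fun x hx => ?_, (hL.table.zero _ _).2 ⟨y, (hcy y).2 rfl⟩⟩
        rw [hH', (hcy x).1 hx]
        exact ⟨lt_add_one y, .inr rfl⟩
    · rcases (h.lt_add_one_iff.1 hi').lt_or_eq with hi' | rfl
      · rw [hgi i (hii.trans hi'), hgi i' hi']
        exact hfap i i' hii hi'
      · rw [hgi i hii, hgj]
        have hfi := (hfH i hii).1
        constructor
        · intro x hx z hz
          rw [(hcy z).1 hz]
          exact hHy x (hfi hx)
        · rintro x ⟨w, hw, hxw⟩
          have hwH := hfi hw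
          obtain ⟨b, hby, -, hap, -⟩ := hsep w (hHY w (h.lt_of_mem_codedSet hwH) hwH) y hyY
            (hHy w hwH)
          obtain ⟨u, hu, hz⟩ := hap x hxw
          refine ⟨u, fun z hz => ?_, ?_⟩
          · rw [(hcy z).1 hz]; exact hu.trans_le hby
          · rintro z ⟨z', hz', hzz⟩
            rw [(hcy z').1 hz'] at hzz
            exact hz z hzz

end IsModelRCA0

end Blocks

/-! ### Growth of `J*` -/

section Cut

variable {M : Type*} [CommSemiring M] [LinearOrder M] {S : Set (Set M)}
  [IsStrictOrderedRing M] [CanonicallyOrderedAdd M] {Θ : M → M → M → Prop}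

/-- Every unbounded set of the model has, for every `k ≠ 0`, a finite subset above `k` in
`Lₙ · (k, …, k)` (`e` times `k`). -/
def HasLarge (S : Set (Set M)) (L : Set M) (n e : M) : Prop :=
  ∀ X ∈ S, IsUnbounded X → ∀ k, k ≠ 0 →
    ∃ F, codedSet F ⊆ X ∧ (∀ x ∈ codedSet F, k ≤ x) ∧ quad n e k F ∈ L

theorem IsUnbounded.above {X : Set M} (hX : IsUnbounded X) (k : M) :
    IsUnbounded {x | x ∈ X ∧ k < x} := fun b => by
  obtain ⟨x, hx, hbx⟩ := hX (max k b)
  exact ⟨x, ⟨hx, (le_max_left _ _).trans_lt hbx⟩, (le_max_right _ _).trans_lt hbx⟩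

namespace IsModelRCA0

variable (h : IsModelRCA0 S)
include h

theorem above_mem {X : Set M} (hX : X ∈ S) (k : M) : {x | x ∈ X ∧ k < x} ∈ S :=
  h.sep_mem hX (by simp (maxDischargeDepth := 99) only [h.delta_rules])

variable {L : Set M} (hL : IsMonotoneTable S Θ L)
include hL

/-- By uniqueness, a single table decides largeness. -/
theorem largeStar_iff {n F : M} : LargeStar S Θ n F ↔ quad n 0 0 F ∈ L :=
  ⟨fun ⟨_, hL', hT', H⟩ => (h.largenessTable_unique hL' hL.mem hT' hL.table n 0 0 F).1 H,
    fun H => ⟨L, hL.mem, hL.table, H⟩⟩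

theorem mem_jStar_iff {n : M} : n ∈ JStar S Θ ↔ ∀ X ∈ S, IsUnbounded X →
    ∃ F, codedSet F ⊆ X ∧ (∀ x ∈ codedSet F, 3 ≤ x) ∧ quad n 0 0 F ∈ L := by
  have : n ∈ JStar S Θ ↔ ∀ X ∈ S, IsUnbounded X →
    ∃ F, codedSet F ⊆ X ∧ (∀ x ∈ codedSet F, 3 ≤ x) ∧ LargeStar S Θ n F := Iff.rfl
  simp only [this, h.largeStar_iff hL]

theorem jStar_isLowerSet : IsLowerSet (JStar S Θ) := by
  intro n' n hn hn'
  rw [h.mem_jStar_iff hL] at hn' ⊢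
  intro X hX hXu
  obtain ⟨F, hF, hF3, H⟩ := hn' X hX hXu
  refine ⟨F, hF, hF3, h.large_of_le hL hn (fun x hx => ?_) H⟩
  rintro rfl
  exact absurd (hF3 0 hx) (not_le.2 three_pos)

theorem zero_mem_jStar : (0 : M) ∈ JStar S Θ := by
  rw [h.mem_jStar_iff hL]
  intro X hX hXu
  obtain ⟨x, hx, h3⟩ := hXu 3
  obtain ⟨F, hF⟩ := h.exists_code_of (P := fun y => y = x)
    (by simp (maxDischargeDepth := 99) only [h.delta_rules]) (x + 1)
  have hF' : ∀ y ∈ codedSet F, y = x := fun y hy => by rw [hF] at hy; exact hy.2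
  refine ⟨F, fun y hy => hF' y hy ▸ hx, fun y hy => hF' y hy ▸ h3.le,
    (hL.table.zero 0 F).2 ⟨x, ?_⟩⟩
  rw [hF]; exact ⟨lt_add_one x, rfl⟩

theorem hasLarge_of_mem_jStar {n : M} (hn : n ∈ JStar S Θ) : HasLarge S L n 0 := by
  rw [h.mem_jStar_iff hL] at hn
  intro X hX hXu k hk
  obtain ⟨F, hF, -, H⟩ := hn _ (h.above_mem hX k) (hXu.above k)
  exact ⟨F, fun x hx => (hF hx).1, fun x hx => (hF hx).2.le, h.large_congr hL H⟩

variable (hB : SatisfiesBSigma2 S)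
  (hΘ : ∀ {n : ℕ} {f g k : (Fin n → M) → M}, IsDeltaFun S f → IsDeltaFun S g →
    IsDeltaFun S k → IsDelta S (fun v => Θ (f v) (g v) (k v)))
  (hT : ∀ x, ∃ y, ∀ z, Θ x y z)
include hB hΘ hT

/-- One more factor `k` is always available. A separating set has `k + 1` pairwise apart sets of
points; between the maximum of each and a point of the next lies a block in `Lₙ · (k, …, k)`, and
these `k` blocks are pairwise apart. -/
theorem hasLarge_succ {n e : M} (hne : HasLarge S L n e) : HasLarge S L n (e + 1) := by
  intro X₀ hX₀ hX₀u k hk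
  set X := {x | x ∈ X₀ ∧ k < x} with hXdef
  have hX : X ∈ S := h.above_mem hX₀ k
  obtain ⟨Y, hYS, hYX, hYu, hsep⟩ := h.exists_separating hL hB hΘ hT (n := n) (e := e) (k := k)
    (.inr hk) hX (hX₀u.above k) fun X' hX' _ hX'u => by
      obtain ⟨F, hF, -, H⟩ := hne X' hX' hX'u k hk
      exact ⟨F, hF, H⟩
  obtain ⟨H, hHY, HH⟩ := h.exists_points hL hYS hYu hsep (k + 1)
  have hmul := hL.table.mul 0 0
  rw [zero_add] at hmul
  obtain ⟨f, hf, hfH, hfap⟩ := (hmul _ _).1 HH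
  have hf' := h.isInternalFun_iff.1 hf
  have hA := fun {n : ℕ} {f g k : (Fin n → M) → M} => h.delta_apartAt hΘ (f := f) (g := g) (k := k)
  have hne' : ∀ i < k + 1, (codedSet (f i)).Nonempty := fun i hi =>
    h.large_nonempty hL (.inl rfl) (hfH i hi).2
  have hfY : ∀ i < k + 1, codedSet (f i) ⊆ Y := fun i hi => (hfH i hi).1.trans hHY
  let R : M → M → Prop := fun i G => ∃ y < f (i + 1), y ∈ codedSet (f (i + 1)) ∧ ∃ b ≤ y,
    (∀ w < f i, w ∈ codedSet (f i) → w < b ∧ ApartAt Θ w b y) ∧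
    codedSet G = {x | x < y + 1 ∧ (b ≤ x ∧ x ∈ X)} ∧ quad n e k G ∈ L
  have hR : IsDelta S (fun w : Fin 2 → M => R (w 0) (w 1)) := by
    unfold R
    simp (maxDischargeDepth := 99) only [h.delta_rules, h.delta_mem_codedSet, h.fun_comp1 hf',
      h.delta_code_eq_Icc hX, hA, h.fun_quad, h.delta_mem hL.mem]
  obtain ⟨g, hg, hgR⟩ := h.exists_choice (k := k) (R := R) (fun hi hG => h.comp2 hR hi hG)
    fun i hi => by
      have hi1 : i + 1 < k + 1 := by gcongr
      have hi0 : i < k + 1 := (lt_add_one i).trans hi1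
      obtain ⟨w, hw, hwmax⟩ := h.exists_greatest (hne' i hi0)
      obtain ⟨y, hy⟩ := hne' _ hi1
      have hwy : w < y := (hfap i (i + 1) (lt_add_one i) hi1).1 w hw y hy
      obtain ⟨b, hby, hwb, hap, hG⟩ := hsep w (hfY _ hi0 hw) y (hfY _ hi1 hy) hwy
      obtain ⟨G, hG'⟩ := h.exists_code_Icc hX b y
      refine ⟨G, y, h.lt_of_mem_codedSet hy, hy, b, hby, fun w' _ hw' =>
        ⟨(hwmax w' hw').trans_lt hwb, hap.mono (hwmax w' hw')⟩, hG', hG G fun x hx hbx hxy => ?_⟩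
      rw [hG']; exact ⟨h.lt_add_one_iff.2 hxy, hbx, hx⟩
  obtain ⟨F, hF⟩ := h.exists_code hX H
  refine ⟨F, fun x hx => ?_, fun x hx => ?_, (hL.table.mul _ _ _ _).2 ⟨g, hg, fun i hi => ?_, ?_⟩⟩
  · rw [hF] at hx; exact hx.2.1
  · rw [hF] at hx; exact hx.2.2.le
  · obtain ⟨y, -, hy, b, -, -, hG, HG⟩ := hgR i hi
    refine ⟨fun x hx => ?_, HG⟩
    rw [hG] at hx
    rw [hF]
    have hyH := h.lt_of_mem_codedSet ((hfH (i + 1) (by gcongr)).1 hy)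
    exact ⟨(h.lt_add_one_iff.1 hx.1).trans_lt hyH, hx.2.2⟩
  · intro i j hij hj
    have hj0 : j < k + 1 := hj.trans (lt_add_one k)
    obtain ⟨y, -, hy, b, -, -, hG, -⟩ := hgR i (hij.trans hj)
    obtain ⟨y', -, hy', b', -, hb', hG', -⟩ := hgR j hj
    -- an element of the point block `f j` between the two intervals
    obtain ⟨w, hw, hyw⟩ : ∃ w ∈ codedSet (f j), y ≤ w := by
      rcases (h.discrete _ _ hij).lt_or_eq with hlt | rfl
      · obtain ⟨w, hw⟩ := hne' j hj0
        exact ⟨w, hw, ((hfap _ _ hlt hj0).1 y hy w hw).le⟩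
      · exact ⟨y, hy, le_rfl⟩
    obtain ⟨hwb, hap⟩ := hb' w (h.lt_of_mem_codedSet hw) hw
    rw [hG, hG']
    constructor
    · intro x hx z hz
      exact (((h.lt_add_one_iff.1 hx.1).trans hyw).trans_lt hwb).trans_le hz.2.1
    · rintro x ⟨t, ht, hxt⟩
      obtain ⟨u, hu, hz⟩ := hap x (hxt.trans_le ((h.lt_add_one_iff.1 ht.1).trans hyw))
      refine ⟨u, fun z hz => hu.trans_le hz.2.1, ?_⟩
      rintro z ⟨t, ht, hzt⟩
      exact hz z (hzt.trans_le (h.lt_add_one_iff.1 ht.1))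

theorem succ_mem_jStar_of_hasLarge {n : M} (hn : HasLarge S L n (n + 1)) :
    n + 1 ∈ JStar S Θ := by
  rw [h.mem_jStar_iff hL]
  intro X hX hXu
  obtain ⟨a, ha, h3⟩ := hXu 3
  have ha0 : a ≠ 0 := by rintro rfl; simp at h3
  obtain ⟨F, hF, -, HF⟩ := hn _ (h.above_mem hX a) (hXu.above a) a ha0
  obtain ⟨G, hG⟩ := h.exists_code_of (P := fun x => x ∈ codedSet F ∨ x = a)
    (by simp (maxDischargeDepth := 99) only [h.delta_rules, h.delta_mem_codedSet]) (F + a + 1)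
  have hG' : ∀ x, x ∈ codedSet G ↔ x ∈ codedSet F ∨ x = a := by
    intro x
    rw [hG]
    refine ⟨fun hx => hx.2, fun hx => ⟨?_, hx⟩⟩
    rw [h.lt_add_one_iff]
    rcases hx with hx | rfl
    · exact (h.lt_of_mem_codedSet hx).le.trans le_self_add
    · exact le_add_self
  refine ⟨G, fun x hx => ?_, fun x hx => ?_, (hL.table.succ n 0 G).2 ⟨a, F, ⟨?_, ?_⟩, ?_, HF⟩⟩
  · rcases (hG' x).1 hx with hx | rfl
    · exact (hF hx).1
    · exact ha
  · rcases (hG' x).1 hx with hx | rfl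
    · exact h3.le.trans (hF hx).2.le
    · exact h3.le
  · exact (hG' a).2 (.inr rfl)
  · intro x hx
    rcases (hG' x).1 hx with hx | rfl
    · exact (hF hx).2.le
    · exact le_rfl
  · ext x
    constructor
    · exact fun hx => ⟨(hG' x).2 (.inl hx), (hF hx).2.ne'⟩
    · rintro ⟨hx, hxa⟩
      exact ((hG' x).1 hx).resolve_right hxa

/-- For standard `n` the `n + 1` factors are obtained one after the other. -/
theorem succ_mem_jStar_of_natCast {n : ℕ} (hn : (n : M) ∈ JStar S Θ) :
    (n : M) + 1 ∈ JStar S Θ := by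
  have key : ∀ e : ℕ, HasLarge S L (n : M) (e : M) := by
    intro e
    induction e with
    | zero => simpa using h.hasLarge_of_mem_jStar hL hn
    | succ e ih =>
      rw [Nat.cast_succ]
      exact h.hasLarge_succ hL hB hΘ hT ih
  refine h.succ_mem_jStar_of_hasLarge hL hB hΘ hT ?_
  simpa using key (n + 1)

omit hB hΘ hT in
/-- The levels `2 (j + i)` of a set `H` of separating points give the levels `n + i` of its hull:
two successive levels `m + 2` and `m + 1` of `H` provide `2 m + 3` factors, of which only
`n + i + 1` are needed. -/
theorem large_hull {X Y : Set M} {n j : M} (hX : X ∈ S) (hYS : Y ∈ S) (hYX : Y ⊆ X)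
    (hX0 : ∀ x ∈ X, x ≠ 0) (hsep : Separates Θ L X Y n 0 0) (hj0 : j ≠ 0) (hj : n ≤ 4 * j)
    (i : M) : ∀ H, codedSet H ⊆ Y → quad (2 * (j + i)) 0 0 H ∈ L →
      ∀ G, hull X (codedSet H) ⊆ codedSet G → quad (n + i) 0 0 G ∈ L := by
  suffices ∀ H, (∀ x < H, x ∈ codedSet H → x ∈ Y) → quad (2 * (j + i)) 0 0 H ∈ L →
      ∀ G, codedSet G = hull X (codedSet H) → quad (n + i) 0 0 G ∈ L by
    intro H hH HH G hG
    obtain ⟨G', hG'⟩ := h.exists_code_hull hX H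
    exact hL.mono (hG'.subset.trans hG) le_rfl
      (this H (fun x _ hx => hH hx) HH G' hG')
  refine h.pi_induction (P := fun i => ∀ H, (∀ x < H, x ∈ codedSet H → x ∈ Y) →
    quad (2 * (j + i)) 0 0 H ∈ L → ∀ G, codedSet G = hull X (codedSet H) →
      quad (n + i) 0 0 G ∈ L) ?_ ?_ ?_ i
  · refine h.pi_forall (h.pi_imp ?_ (h.pi_imp ?_ (h.pi_forall (IsDelta.isPi ?_)))) <;>
    simp (maxDischargeDepth := 99) only [h.delta_rules, h.fun_quad, h.delta_mem hL.mem,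
      h.delta_mem hYS, h.delta_mem_codedSet, h.delta_code_eq_hull hX]
  · intro H hH HH G hG
    have hHY : codedSet H ⊆ Y := fun x hx => hH x (h.lt_of_mem_codedSet hx) hx
    rw [add_zero] at HH ⊢
    obtain ⟨a, ha, y, hy, hay⟩ := h.exists_lt_of_large hL (mul_ne_zero two_ne_zero hj0)
      (fun x hx => hX0 x (hYX (hHY hx))) HH
    obtain ⟨b, -, hab, -, hb⟩ := hsep a (hHY ha) y (hHY hy) hay
    refine hb G fun x hx hbx hxy => ?_
    rw [hG]
    exact ⟨hx, ⟨a, ha, (hab.trans_le hbx).le⟩, y, hy, hxy⟩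
  · intro i ih H hH HH G hG
    have hHY : codedSet H ⊆ Y := fun x hx => hH x (h.lt_of_mem_codedSet hx) hx
    set m := 2 * (j + i) with hm
    have hm2 : 2 * (j + (i + 1)) = m + 1 + 1 := by rw [hm]; ring
    rw [hm2] at HH
    obtain ⟨a, H₁, ha, hH₁, HH₁⟩ := (hL.table.succ _ _ _).1 HH
    have hH₁Y : codedSet H₁ ⊆ Y := by rw [hH₁]; exact Set.sdiff_subset.trans hHY
    have hH₁a : ∀ x ∈ codedSet H₁, a < x := fun x hx => by
      rw [hH₁] at hx
      exact lt_of_le_of_ne (ha.2 hx.1) fun heq => hx.2 heq.symm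
    obtain ⟨H₂, hH₂⟩ := h.exists_code_hull hYS H₁
    have HH₂ := h.large_drop_min hL hYS hH₁Y (fun x hx => (hH₁a x hx).le) HH₁ hH₂
    obtain ⟨G₃, hG₃⟩ := h.exists_code_hull hX H₂
    have HG₃ : quad (n + i) (0 + (m + 1 + (m + 1 + 1))) a G₃ ∈ L := by
      refine h.large_hull_of_mul hL hX hYS (m := m) (d₀ := 0) (fun H G hH _ HH hG => ?_) _ H₂ G₃
        (fun x _ hx => ?_) (by rwa [zero_add]) hG₃
      · exact h.large_congr hL (ih H (fun x _ hx => hH hx) (h.large_congr hL HH) G hG)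
      · rw [hH₂] at hx
        obtain ⟨hxY, ⟨z, hz, hzx⟩, -⟩ := hx
        exact ⟨hxY, (hH₁a z hz).le.trans hzx⟩
    have hd : n + i + 1 ≤ 0 + (m + 1 + (m + 1 + 1)) := by
      calc n + i + 1 ≤ 4 * j + i + 1 := by gcongr
        _ ≤ 4 * j + i + 1 + (3 * i + 2) := le_self_add
        _ = 0 + (m + 1 + (m + 1 + 1)) := by rw [hm]; ring
    have HG₃' := h.large_of_mul_le hL (hX0 a (hYX (hHY ha.1))) hd HG₃
    rw [← add_assoc]
    refine (hL.table.succ _ _ _).2 ?_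
    have haG : IsLeast (codedSet G) a := by
      rw [hG]
      refine ⟨subset_hull (hHY.trans hYX) ha.1, ?_⟩
      rintro x ⟨-, ⟨z, hz, hzx⟩, -⟩
      exact (ha.2 hz).trans hzx
    obtain ⟨G', hG'⟩ := h.exists_code_of (P := fun x => x ∈ codedSet G ∧ x ≠ a)
      (by simp (maxDischargeDepth := 99) only [h.delta_rules, h.delta_mem_codedSet, ne_eq]) G
    have hG'' : codedSet G' = codedSet G \ {a} := by
      rw [hG']; ext x
      exact ⟨fun hx => hx.2, fun hx => ⟨h.lt_of_mem_codedSet hx.1, hx⟩⟩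
    refine ⟨a, G', haG, hG'', hL.mono ?_ le_rfl HG₃'⟩
    rw [hG'', hG₃, hH₂, hG]
    rintro x ⟨hxX, ⟨z, ⟨-, ⟨t, ht, htz⟩, -⟩, hzx⟩, z', ⟨-, -, t', ht', hzt'⟩, hxz'⟩
    have hax : a < x := (hH₁a t ht).trans_le (htz.trans hzx)
    rw [hH₁] at ht ht'
    exact ⟨⟨hxX, ⟨t, ht.1, htz.trans hzx⟩, t', ht'.1, hxz'.trans hzt'⟩, hax.ne'⟩

/-- The growth step: a separating set contains a set on level `2 (j + i) ≤ n`, whose hull is on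
level `n + i`. -/
theorem add_mem_jStar {n j i : M} (hn : n ∈ JStar S Θ) (hj0 : j ≠ 0) (hj : n ≤ 4 * j)
    (hi : 2 * (j + i) ≤ n) : n + i ∈ JStar S Θ := by
  rw [h.mem_jStar_iff hL] at hn ⊢
  intro X₀ hX₀ hX₀u
  set X := {x | x ∈ X₀ ∧ 3 < x} with hXdef
  have hX : X ∈ S := h.above_mem hX₀ 3
  have hX0 : ∀ x ∈ X, x ≠ 0 := by
    rintro x hx rfl
    exact absurd hx.2 (by simp)
  obtain ⟨Y, hYS, hYX, hYu, hsep⟩ := h.exists_separating hL hB hΘ hT (n := n) (e := 0) (k := 0)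
    (.inl rfl) hX (hX₀u.above 3) fun X' hX' _ hX'u => by
      obtain ⟨F, hF, -, H⟩ := hn X' hX' hX'u
      exact ⟨F, hF, H⟩
  obtain ⟨H, hHY, -, HH⟩ := hn Y hYS hYu
  have HH' := h.large_of_le hL hi (fun x hx => hX0 x (hYX (hHY hx))) HH
  obtain ⟨G, hG⟩ := h.exists_code_hull hX H
  have hGX : codedSet G ⊆ X := by rw [hG]; exact fun x hx => hx.1
  exact ⟨G, fun x hx => (hGX hx).1, fun x hx => (hGX hx).2.le,
    h.large_hull hL hX hYS hYX hX0 hsep hj0 hj i H hHY HH' G hG.symm.subset⟩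

end IsModelRCA0

end Cut

/-! ### `J*` is an additive cut -/

section Arithmetic

variable {M : Type*} [CommSemiring M] [LinearOrder M] {S : Set (Set M)}
  [IsStrictOrderedRing M] [CanonicallyOrderedAdd M] {Θ : M → M → M → Prop}

namespace IsModelRCA0

variable (h : IsModelRCA0 S)
include h

theorem exists_natCast_eq_of_lt {n : M} {k : ℕ} (hn : n < k) : ∃ l : ℕ, n = l := by
  induction k with
  | zero => exact absurd hn (by simp)
  | succ k ih =>
    rw [Nat.cast_succ, h.lt_add_one_iff] at hn
    exact hn.lt_or_eq.elim ih fun hk => ⟨k, hk⟩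

theorem exists_mul_le_lt_mul (n : M) {c : M} (hc : c ≠ 0) : ∃ q, c * q ≤ n ∧ n < c * (q + 1) := by
  have hn : n < c * (n + 1) := (lt_add_one n).trans_le
    (le_mul_of_one_le_left zero_le (by simpa using h.add_one_le_iff.2 (pos_iff_ne_zero.2 hc)))
  obtain ⟨x, hx, hmin⟩ := h.exists_least (P := fun x => n < c * x)
    (.lt_poly (.const n) (.mul (.const c) (.var 0))) ⟨_, hn⟩
  obtain ⟨q, rfl⟩ := h.exists_eq_add_one (a := x) (by rintro rfl; simp at hx)
  exact ⟨q, not_lt.1 (hmin q (lt_add_one q)), hx⟩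

variable {L : Set M} (hL : IsMonotoneTable S Θ L) (hB : SatisfiesBSigma2 S)
  (hΘ : ∀ {n : ℕ} {f g k : (Fin n → M) → M}, IsDeltaFun S f → IsDeltaFun S g →
    IsDeltaFun S k → IsDelta S (fun v => Θ (f v) (g v) (k v)))
  (hT : ∀ x, ∃ y, ∀ z, Θ x y z)
include hL hB hΘ hT

theorem succ_mem_jStar {n : M} (hn : n ∈ JStar S Θ) : n + 1 ∈ JStar S Θ := by
  obtain hn8 | hn8 := lt_or_ge n ((8 : ℕ) : M)
  · obtain ⟨l, rfl⟩ := h.exists_natCast_eq_of_lt hn8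
    exact h.succ_mem_jStar_of_natCast hL hB hΘ hT hn
  · obtain ⟨q, hq, hq'⟩ := h.exists_mul_le_lt_mul n (c := 4) four_ne_zero
    have h2 : 2 ≤ q := by
      by_contra! hlt
      have : q + 1 ≤ 2 := h.add_one_le_iff.2 hlt
      have : n < 8 := hq'.trans_le (by
        calc 4 * (q + 1) ≤ 4 * 2 := by gcongr
          _ = 8 := by norm_num)
      exact absurd hn8 (by simpa using this)
    refine h.add_mem_jStar hL hB hΘ hT hn (succ_ne_zero q) hq'.le (le_trans ?_ hq)
    calc 2 * (q + 1 + 1) = 2 * q + 2 * 2 := by ring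
      _ ≤ 2 * q + 2 * q := by gcongr
      _ = 4 * q := by ring

theorem add_natCast_mem_jStar {n : M} (hn : n ∈ JStar S Θ) (k : ℕ) : n + k ∈ JStar S Θ := by
  induction k with
  | zero => simpa using hn
  | succ k ih =>
    rw [Nat.cast_succ, ← add_assoc]
    exact h.succ_mem_jStar hL hB hΘ hT ih

theorem five_mul_mem_jStar {q : M} (hq : 4 * q ∈ JStar S Θ) : 5 * q ∈ JStar S Θ := by
  obtain rfl | hq0 := eq_or_ne q 0
  · simpa using hq
  · have := h.add_mem_jStar hL hB hΘ hT hq (i := q) hq0 le_rfl (by ring_nf; rfl)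
    rwa [show 4 * q + q = 5 * q by ring] at this

/-- Four applications of `4q ↦ 5q` more than double a multiple of `256`, as `5⁴ > 2 · 4⁴`; the
remainder modulo `256` contributes boundedly many successors. -/
theorem add_self_mem_jStar {n : M} (hn : n ∈ JStar S Θ) : n + n ∈ JStar S Θ := by
  have hlow := h.jStar_isLowerSet hL
  have h5 := fun {q : M} => h.five_mul_mem_jStar hL hB hΘ hT (q := q)
  obtain ⟨q, hq, hq'⟩ := h.exists_mul_le_lt_mul n (c := 256) (by norm_num)
  have h0 : 4 * (64 * q) ∈ JStar S Θ := hlow (by ring_nf; rw [mul_comm]; exact hq) hn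
  have h1 : 4 * (80 * q) ∈ JStar S Θ := by convert h5 h0 using 1; ring
  have h2 : 4 * (100 * q) ∈ JStar S Θ := by convert h5 h1 using 1; ring
  have h3 : 4 * (125 * q) ∈ JStar S Θ := by convert h5 h2 using 1; ring
  refine hlow ?_ (h.add_natCast_mem_jStar hL hB hΘ hT (h5 h3) 512)
  calc n + n ≤ 256 * (q + 1) + 256 * (q + 1) := add_le_add hq'.le hq'.le
    _ ≤ 256 * (q + 1) + 256 * (q + 1) + 113 * q := le_self_add
    _ = 5 * (125 * q) + (512 : ℕ) := by push_cast; ring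

end IsModelRCA0

theorem Delta0.isDelta_rel (h : IsModelRCA0 S) {m p : ℕ} (θ : Delta0 m (p + 3))
    {V : Fin m → Set M} (hV : ∀ i, V i ∈ S) (v : Fin p → M) {n : ℕ} {f g k : (Fin n → M) → M}
    (hf : IsDeltaFun S f) (hg : IsDeltaFun S g) (hk : IsDeltaFun S k) :
    IsDelta S (fun w => θ.rel V v (f w) (g w) (k w)) := by
  refine h.comp3 (P := θ.rel V v) ?_ hf hg hk
  have := θ.isDelta_holds (n := 3) hV
    (e := fun i w => (Matrix.vecCons (w 0) (Matrix.vecCons (w 1) (Matrix.vecCons (w 2) v)) :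
      Fin (p + 3) → M) i) ?_
  · exact this
  · intro i
    refine Fin.cases ?_ (fun i => Fin.cases ?_ (fun i => Fin.cases ?_ (fun i => ?_) i) i) i
    · exact .var 0
    · exact .var 1
    · exact .var 2
    · exact .const (v i)

end Arithmetic

end SecondOrderArith

theorem mainTheorem7 {M : Type*} [CommSemiring M] [LinearOrder M] [IsStrictOrderedRing M]
    [CanonicallyOrderedAdd M] (S : Set (Set M))
    (hRCA : SecondOrderArith.IsModelRCA0 S) (hB : SecondOrderArith.SatisfiesBSigma2 S)
    {m p : ℕ} (θ : SecondOrderArith.Delta0 m (p + 3))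
    (V : Fin m → Set M) (hV : ∀ i, V i ∈ S) (v : Fin p → M)
    (hT : ∀ x, ∃ y, ∀ z, θ.rel V v x y z) :
    SecondOrderArith.IsAdditiveCut (SecondOrderArith.JStar S (θ.rel V v)) := by
  have hΘ := fun {n : ℕ} {f g k : (Fin n → M) → M} =>
    θ.isDelta_rel hRCA hV v (f := f) (g := g) (k := k)
  obtain ⟨L, hLS, hLT, hmono⟩ := hRCA.exists_largenessTable hΘ
  have hL : SecondOrderArith.IsMonotoneTable S (θ.rel V v) L := ⟨hLS, hLT, hmono _ _ _ _ _ _⟩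
  exact
    { nonempty := ⟨0, hRCA.zero_mem_jStar hL⟩
      isLowerSet := hRCA.jStar_isLowerSet hL
      succ_mem := fun _ hn => hRCA.succ_mem_jStar hL hB hΘ hT hn
      add_self_mem := fun _ hn => hRCA.add_self_mem_jStar hL hB hΘ hT hn }
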